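/- Let $n,N\ge 0$ and $1\le s\le n+1$ be integers. (a) (Smooth hypersurfaces.) Let $M\subset\mathbb C^{n+1}$ and $M'\subset\mathbb C^{N+1}$ be $C^\infty$-smooth real hypersurfaces through $p$ and $p'$ respectively, and let $H:(\mathbb C^{n+1},p)\to(\mathbb C^{N+1},p')$ be a germ at $p$ of a holomorphic mapping such that $H(M)\subset M'$ (as germs at $p$). Let $H_Z=(\partial H_i/\partial Z_j)$ denote the $(N+1)\times(n+1)$ Jacobian matrix of $H$, let $W_H^s:=\{Z:\ \mathrm{rank}\,H_Z(Z)<s\}$ and $W_H:=W_H^{n+1}$, and let $r$ be the rank of the Levi form of $M'$ at $p'$. Assume that $M$ is of finite type at $p$, i.e. the values at $p$ of the complex Lie algebra generated by the CR vector fields of $M$ near $p$ and their conjugates fill out $\mathbb C T_pM$, and that $$2N-r\le n+s-3 .$$ If the germ of $W_H$ at $p$ is proper (i.e. $H$ has generic rank $n+1$) and the germ of $W_H^s$ at $p$ has codimension at least $2$ in $\mathbb C^{n+1}$, then $H$ is transversal to $M'$ at $p$, i.e. $T_{p'}M'+dH(T_p\mathbb C^{n+1})=T_{p'}\mathbb C^{N+1}$.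 (b) (Formal hypersurfaces.) Let $M\subset\mathbb C^{n+1}$ and $M'\subset\mathbb C^{N+1}$ be formal real hypersurfaces through $0$, given by formal power series $\rho(Z,\xi)$ and $\rho'(Z',\xi')$ which vanish at $0$, have nonzero differential at $0$ and are Hermitian ($\rho(Z,\xi)=\bar\rho(\xi,Z)$, where the bar conjugates the coefficients, and likewise for $\rho'$). Let $H:(\mathbb C^{n+1},0)\to(\mathbb C^{N+1},0)$ be a formal holomorphic mapping sending $M$ into $M'$, i.e. $\rho'(H(Z),\bar H(\xi))=a(Z,\xi)\rho(Z,\xi)$ for some formal power series $a$. Assume that the collection $(\delta_l)$ of those $(n+1)\times(n+1)$-minors of the Jacobian matrix $H_Z$ which are not identically zero is non-empty, that $M$ is of finite type at $0$ (in the same sense as in (a), with formal vector fields), and that $2N-r\le n+s-3$, where $r$ is the rank of the Levi form of $M'$ at $0$. Suppose that for every common divisor $d(Z)$ of the $\delta_l$ in $\mathbb C[[Z]]$ there is a $k\times k$-minor of $H_Z$ with $k\ge s$ that is relatively prime to $d$. Then $H$ is transversal to $M'$ at $0$, i.e. $T_0M'+dH(T_0\mathbb C^{n+1})=T_0\mathbb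 C^{N+1}$. -/

import Mathlib

open Filter
open scoped ContDiff ComplexConjugate Topology

namespace CRTransversal

noncomputable section

/-! ## Linear algebra common to the smooth and the formal setting

A complex tangent vector `∑ aⱼ ∂/∂Zⱼ + ∑ bⱼ ∂/∂Z̄ⱼ` of `ℂ^d` is stored as a function on
`Fin d ⊕ Fin d`, with `aⱼ` at `Sum.inl j` and `bⱼ` at `Sum.inr j`. -/

/-- The space of `(1,0)`-vectors `v` annihilated by the `(1,0)`-covector `c`, i.e. `∑ cⱼ vⱼ = 0`. -/
def tangentOneZero {d : ℕ} (c : Fin d → ℂ) : Submodule ℂ (Fin d → ℂ) where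
  carrier := {v | ∑ j, c j * v j = 0}
  zero_mem' := by simp
  add_mem' := by
    intro v w hv hw
    simp only [Set.mem_ofPred_eq] at hv hw ⊢
    simp [mul_add, Finset.sum_add_distrib, hv, hw]
  smul_mem' := by
    intro t v hv
    simp only [Set.mem_ofPred_eq] at hv ⊢
    have h : ∀ j, c j * (t • v) j = t * (c j * v j) := fun j => by
      simp only [Pi.smul_apply, smul_eq_mul]; ring
    simp only [h, ← Finset.mul_sum, hv, mul_zero]

/-- The restriction to `tangentOneZero c` of the sesquilinear form
`(v, w) ↦ ∑ Lᵢⱼ vᵢ w̄ⱼ`, as a linear map in the first variable. -/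
def leviMap {d : ℕ} (c : Fin d → ℂ) (L : Matrix (Fin d) (Fin d) ℂ) :
    tangentOneZero c →ₗ[ℂ] (tangentOneZero c → ℂ) where
  toFun v w := ∑ i, ∑ j, L i j * (v : Fin d → ℂ) i * conj ((w : Fin d → ℂ) j)
  map_add' := by
    intro v v'
    funext w
    simp [mul_add, add_mul, Finset.sum_add_distrib]
  map_smul' := by
    intro t v
    funext w
    simp only [Submodule.coe_smul, Pi.smul_apply, smul_eq_mul, RingHom.id_apply, Finset.mul_sum]
    refine Finset.sum_congr rfl fun i _ => Finset.sum_congr rfl fun j _ => ?_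
    ring

/-- The rank of the sesquilinear form with matrix `L` restricted to `tangentOneZero c`. -/
def restrictedRank {d : ℕ} (c : Fin d → ℂ) (L : Matrix (Fin d) (Fin d) ℂ) : ℕ :=
  Module.finrank ℂ (LinearMap.range (leviMap c L))

/-- The complexified tangent space: complex vectors annihilated by the full covector `g`. -/
def complexTangent {d : ℕ} (g : Fin d ⊕ Fin d → ℂ) : Set (Fin d ⊕ Fin d → ℂ) :=
  {v | ∑ i, g i * v i = 0}

/-- The real tangent space: the `v ∈ ℂ^d` for which the real vector
`∑ vⱼ ∂/∂Zⱼ + ∑ v̄ⱼ ∂/∂Z̄ⱼ` is annihilated by the full covector `g`. -/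
def realTangent {d : ℕ} (g : Fin d ⊕ Fin d → ℂ) : Submodule ℝ (Fin d → ℂ) where
  carrier := {v | ∑ j, g (Sum.inl j) * v j + ∑ j, g (Sum.inr j) * conj (v j) = 0}
  zero_mem' := by simp
  add_mem' := by
    intro v w hv hw
    simp only [Set.mem_ofPred_eq] at hv hw ⊢
    simp only [Pi.add_apply, map_add, mul_add, Finset.sum_add_distrib]
    linear_combination hv + hw
  smul_mem' := by
    intro t v hv
    simp only [Set.mem_ofPred_eq] at hv ⊢
    have h1 : ∀ j, g (Sum.inl j) * (t • v) j = (t : ℂ) * (g (Sum.inl j) * v j) := fun j => by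
      simp only [Pi.smul_apply, Complex.real_smul]; ring
    have h2 : ∀ j, g (Sum.inr j) * conj ((t • v) j) = (t : ℂ) * (g (Sum.inr j) * conj (v j)) :=
      fun j => by
        simp only [Pi.smul_apply, Complex.real_smul, map_mul, Complex.conj_ofReal]; ring
    simp only [h1, h2, ← Finset.mul_sum, ← mul_add, hv, mul_zero]

/-! ## Smooth real hypersurfaces and holomorphic maps -/

/-- `ρ`, on the open neighbourhood `U` of `p`, is a smooth real-valued local defining function of
the set `M ∋ p`: in other words, `M` is near `p` a smooth real hypersurface through `p`. -/
structure IsDefiningFunction {d : ℕ} (M : Set (Fin d → ℂ)) (p : Fin d → ℂ)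
    (U : Set (Fin d → ℂ)) (ρ : (Fin d → ℂ) → ℝ) : Prop where
  isOpen : IsOpen U
  mem_nhd : p ∈ U
  mem_hypersurface : p ∈ M
  smooth : ContDiffOn ℝ ∞ ρ U
  mem_iff : ∀ z ∈ U, z ∈ M ↔ ρ z = 0
  fderiv_ne_zero : ∀ z ∈ U, ρ z = 0 → fderiv ℝ ρ z ≠ 0

/-- The Wirtinger derivatives of `f` at `z`: `∂f/∂Zⱼ` at `Sum.inl j`, `∂f/∂Z̄ⱼ` at `Sum.inr j`. -/
def wirtinger {d : ℕ} (f : (Fin d → ℂ) → ℂ) (z : Fin d → ℂ) : Fin d ⊕ Fin d → ℂ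
  | Sum.inl j => (1 / 2) * (fderiv ℝ f z (Pi.single j 1)
      - Complex.I * fderiv ℝ f z (Pi.single j Complex.I))
  | Sum.inr j => (1 / 2) * (fderiv ℝ f z (Pi.single j 1)
      + Complex.I * fderiv ℝ f z (Pi.single j Complex.I))

/-- All first Wirtinger derivatives of a real-valued function. -/
def gradient {d : ℕ} (ρ : (Fin d → ℂ) → ℝ) : (Fin d → ℂ) → Fin d ⊕ Fin d → ℂ :=
  wirtinger fun z => (ρ z : ℂ)

/-- The matrix `∂²ρ/∂Zᵢ∂Z̄ⱼ` at `z`. -/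
def leviMatrix {d : ℕ} (ρ : (Fin d → ℂ) → ℝ) (z : Fin d → ℂ) : Matrix (Fin d) (Fin d) ℂ :=
  Matrix.of fun i j => wirtinger (fun w => gradient ρ w (Sum.inr j)) z (Sum.inl i)

/-- The rank at `p` of the Levi form of the hypersurface `ρ = 0`. -/
def leviRank {d : ℕ} (ρ : (Fin d → ℂ) → ℝ) (p : Fin d → ℂ) : ℕ :=
  restrictedRank (fun j => gradient ρ p (Sum.inl j)) (leviMatrix ρ p)

/-- Lie bracket of complex vector fields on (open subsets of) `ℂ^d`:
`[X, Y]ₖ = ∑ᵢ (Xᵢ ∂ᵢ Yₖ - Yᵢ ∂ᵢ Xₖ)`. -/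
def bracket {d : ℕ} (X Y : (Fin d → ℂ) → Fin d ⊕ Fin d → ℂ) :
    (Fin d → ℂ) → Fin d ⊕ Fin d → ℂ :=
  fun z k => ∑ i, (X z i * wirtinger (fun w => Y w k) z i - Y z i * wirtinger (fun w => X w k) z i)

/-- The complex Lie algebra generated by the CR vector fields, and their conjugates, of the
hypersurface `M = {ρ = 0}` in the open set `V`. A vector field along `M` is represented by smooth
extensions to `V`; along `M`, a bracket does not depend on the extensions, since all fields here
are tangent to `M`. -/
inductive CRLieAlgebra {d : ℕ} (V : Set (Fin d → ℂ)) (ρ : (Fin d → ℂ) → ℝ) :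
    ((Fin d → ℂ) → Fin d ⊕ Fin d → ℂ) → Prop
  | cr (X : (Fin d → ℂ) → Fin d ⊕ Fin d → ℂ) (smooth : ContDiffOn ℝ ∞ X V)
      (tangent : ∀ z ∈ V, ρ z = 0 → X z ∈ complexTangent (gradient ρ z))
      (type : ∀ z ∈ V, ρ z = 0 → ∀ j, X z (Sum.inl j) = 0) : CRLieAlgebra V ρ X
  | conjCR (X : (Fin d → ℂ) → Fin d ⊕ Fin d → ℂ) (smooth : ContDiffOn ℝ ∞ X V)
      (tangent : ∀ z ∈ V, ρ z = 0 → X z ∈ complexTangent (gradient ρ z))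
      (type : ∀ z ∈ V, ρ z = 0 → ∀ j, X z (Sum.inr j) = 0) : CRLieAlgebra V ρ X
  | add (X Y : (Fin d → ℂ) → Fin d ⊕ Fin d → ℂ) (hX : CRLieAlgebra V ρ X)
      (hY : CRLieAlgebra V ρ Y) : CRLieAlgebra V ρ (X + Y)
  | smul (c : ℂ) (X : (Fin d → ℂ) → Fin d ⊕ Fin d → ℂ) (hX : CRLieAlgebra V ρ X) :
      CRLieAlgebra V ρ (c • X)
  | lie (X Y : (Fin d → ℂ) → Fin d ⊕ Fin d → ℂ) (hX : CRLieAlgebra V ρ X)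
      (hY : CRLieAlgebra V ρ Y) : CRLieAlgebra V ρ (bracket X Y)

/-- Finite type at `p` (Kohn, Bloom-Graham) of the hypersurface with defining function `ρ` on `U`:
the values at `p` of the Lie algebra generated, near `p`, by the CR vector fields and their
conjugates are all of the complexified tangent space. -/
def IsFiniteTypeAt {d : ℕ} (U : Set (Fin d → ℂ)) (ρ : (Fin d → ℂ) → ℝ) (p : Fin d → ℂ) : Prop :=
  {v | ∃ V, IsOpen V ∧ p ∈ V ∧ V ⊆ U ∧ ∃ X, CRLieAlgebra V ρ X ∧ X p = v}
    = complexTangent (gradient ρ p)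

/-- The holomorphic Jacobian matrix `H_Z = (∂Hᵢ/∂Zⱼ)` at `z`. -/
def jacobian {d e : ℕ} (H : (Fin d → ℂ) → Fin e → ℂ) (z : Fin d → ℂ) :
    Matrix (Fin e) (Fin d) ℂ :=
  Matrix.of fun i j => fderiv ℂ H z (Pi.single j 1) i

/-- The set `W_H^s` of points where the rank of `H_Z` is less than `s`. -/
def degeneracyLocus {d e : ℕ} (H : (Fin d → ℂ) → Fin e → ℂ) (s : ℕ) : Set (Fin d → ℂ) :=
  {z | (jacobian H z).rank < s}

/-- The germ at `p` of the analytic set `A` has dimension at most `k`: there are `k` germs of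
holomorphic functions at `p`, vanishing at `p`, such that near `p` they have no common zero on `A`
other than possibly `p`. -/
def GermDimLE {d : ℕ} (A : Set (Fin d → ℂ)) (p : Fin d → ℂ) (k : ℕ) : Prop :=
  ∃ f : Fin k → (Fin d → ℂ) → ℂ,
    (∀ i, AnalyticAt ℂ (f i) p ∧ f i p = 0) ∧
      ∀ᶠ z in 𝓝 p, z ∈ A → (∀ i, f i z = 0) → z = p

/-- The germ at `p` of the analytic set `A` has codimension at least `c` in `ℂ^d`
(the empty germ has every codimension). -/
def GermCodimGE {d : ℕ} (A : Set (Fin d → ℂ)) (p : Fin d → ℂ) (c : ℕ) : Prop :=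
  (∀ᶠ z in 𝓝 p, z ∉ A) ∨ ∃ k, k + c ≤ d ∧ GermDimLE A p k

/-- Transversality at `p` of the map `H` to the hypersurface `M'` with local defining function `ρ'`
near `H p ∈ M'`: `T_{H(p)}M' + dH(T_p ℂ^d) = T_{H(p)}ℂ^e`, as real vector spaces. -/
def IsTransversalAt {d e : ℕ} (H : (Fin d → ℂ) → Fin e → ℂ) (ρ' : (Fin e → ℂ) → ℝ)
    (p : Fin d → ℂ) : Prop :=
  LinearMap.ker (fderiv ℝ ρ' (H p)).toLinearMap ⊔ LinearMap.range (fderiv ℝ H p).toLinearMap = ⊤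

/-! ## Formal real hypersurfaces and formal holomorphic maps

The ring `ℂ⟦Z, ξ⟧` is `MvPowerSeries (Fin d ⊕ Fin d) ℂ`, with `Zⱼ` the variable `Sum.inl j` and
`ξⱼ`, standing for `Z̄ⱼ`, the variable `Sum.inr j`. -/

/-- The series `ρ(Z, ξ)` defines a formal real hypersurface through `0`: it vanishes at `0`, is
Hermitian, `ρ(Z, ξ) = ρ̄(ξ, Z)`, and has nonzero differential at `0`. -/
structure IsFormalHypersurface {d : ℕ} (ρ : MvPowerSeries (Fin d ⊕ Fin d) ℂ) : Prop where
  constantCoeff_eq_zero : MvPowerSeries.constantCoeff ρ = 0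
  hermitian : ∀ m : Fin d ⊕ Fin d →₀ ℕ,
    MvPowerSeries.coeff (m.mapDomain Sum.swap) ρ = conj (MvPowerSeries.coeff m ρ)
  differential_ne_zero : ∃ i, MvPowerSeries.constantCoeff (MvPowerSeries.pderiv ℂ i ρ) ≠ 0

/-- All first derivatives of `ρ` at `0`. -/
def formalGradient {d : ℕ} (ρ : MvPowerSeries (Fin d ⊕ Fin d) ℂ) : Fin d ⊕ Fin d → ℂ :=
  fun i => MvPowerSeries.constantCoeff (MvPowerSeries.pderiv ℂ i ρ)

/-- The matrix `∂²ρ/∂Zᵢ∂ξⱼ` at `0`. -/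
def formalLeviMatrix {d : ℕ} (ρ : MvPowerSeries (Fin d ⊕ Fin d) ℂ) : Matrix (Fin d) (Fin d) ℂ :=
  Matrix.of fun i j => MvPowerSeries.constantCoeff
    (MvPowerSeries.pderiv ℂ (Sum.inl i) (MvPowerSeries.pderiv ℂ (Sum.inr j) ρ))

/-- The rank at `0` of the Levi form of the formal hypersurface `ρ = 0`. -/
def formalLeviRank {d : ℕ} (ρ : MvPowerSeries (Fin d ⊕ Fin d) ℂ) : ℕ :=
  restrictedRank (fun j => formalGradient ρ (Sum.inl j)) (formalLeviMatrix ρ)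

/-- Lie bracket of formal vector fields `∑ Xᵢ ∂ᵢ` in the variables `(Z, ξ)`. -/
def formalBracket {d : ℕ} (X Y : Fin d ⊕ Fin d → MvPowerSeries (Fin d ⊕ Fin d) ℂ) :
    Fin d ⊕ Fin d → MvPowerSeries (Fin d ⊕ Fin d) ℂ :=
  fun k => ∑ i, (X i * MvPowerSeries.pderiv ℂ i (Y k) - Y i * MvPowerSeries.pderiv ℂ i (X k))

/-- The complex Lie algebra generated by the formal CR vector fields, and their conjugates, of the
formal hypersurface `ρ = 0`; as in the smooth case, fields along the hypersurface (that is,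
modulo `ρ`) are represented by extensions, and a function vanishes along it if `ρ` divides it. -/
inductive FormalCRLieAlgebra {d : ℕ} (ρ : MvPowerSeries (Fin d ⊕ Fin d) ℂ) :
    (Fin d ⊕ Fin d → MvPowerSeries (Fin d ⊕ Fin d) ℂ) → Prop
  | cr (X : Fin d ⊕ Fin d → MvPowerSeries (Fin d ⊕ Fin d) ℂ)
      (tangent : ρ ∣ ∑ i, X i * MvPowerSeries.pderiv ℂ i ρ)
      (type : ∀ j, ρ ∣ X (Sum.inl j)) : FormalCRLieAlgebra ρ X
  | conjCR (X : Fin d ⊕ Fin d → MvPowerSeries (Fin d ⊕ Fin d) ℂ)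
      (tangent : ρ ∣ ∑ i, X i * MvPowerSeries.pderiv ℂ i ρ)
      (type : ∀ j, ρ ∣ X (Sum.inr j)) : FormalCRLieAlgebra ρ X
  | add (X Y : Fin d ⊕ Fin d → MvPowerSeries (Fin d ⊕ Fin d) ℂ) (hX : FormalCRLieAlgebra ρ X)
      (hY : FormalCRLieAlgebra ρ Y) : FormalCRLieAlgebra ρ (X + Y)
  | smul (c : ℂ) (X : Fin d ⊕ Fin d → MvPowerSeries (Fin d ⊕ Fin d) ℂ)
      (hX : FormalCRLieAlgebra ρ X) : FormalCRLieAlgebra ρ (c • X)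
  | lie (X Y : Fin d ⊕ Fin d → MvPowerSeries (Fin d ⊕ Fin d) ℂ) (hX : FormalCRLieAlgebra ρ X)
      (hY : FormalCRLieAlgebra ρ Y) : FormalCRLieAlgebra ρ (formalBracket X Y)

/-- Finite type at `0` of the formal hypersurface `ρ = 0`. -/
def IsFormalFiniteType {d : ℕ} (ρ : MvPowerSeries (Fin d ⊕ Fin d) ℂ) : Prop :=
  {v | ∃ X, FormalCRLieAlgebra ρ X ∧ (fun i => MvPowerSeries.constantCoeff (X i)) = v}
    = complexTangent (formalGradient ρ)

/-- The complexified map `(H(Z), H̄(ξ))`, where `H̄` is obtained by conjugating coefficients. -/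
def complexification {d e : ℕ} (H : Fin e → MvPowerSeries (Fin d) ℂ) :
    Fin e ⊕ Fin e → MvPowerSeries (Fin d ⊕ Fin d) ℂ
  | Sum.inl i => MvPowerSeries.rename Sum.inl (H i)
  | Sum.inr i => MvPowerSeries.rename Sum.inr (MvPowerSeries.map (starRingEnd ℂ) (H i))

/-- The formal map `H : (ℂ^d, 0) → (ℂ^e, 0)` sends `ρ = 0` into `ρ' = 0`:
`ρ'(H(Z), H̄(ξ)) = a(Z, ξ) ρ(Z, ξ)` for some formal series `a`. -/
def SendsInto {d e : ℕ} (H : Fin e → MvPowerSeries (Fin d) ℂ)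
    (ρ : MvPowerSeries (Fin d ⊕ Fin d) ℂ) (ρ' : MvPowerSeries (Fin e ⊕ Fin e) ℂ) : Prop :=
  ∃ a, MvPowerSeries.subst (complexification H) ρ' = a * ρ

/-- The Jacobian matrix `H_Z = (∂Hᵢ/∂Zⱼ)` of formal power series. -/
def formalJacobian {d e : ℕ} (H : Fin e → MvPowerSeries (Fin d) ℂ) :
    Matrix (Fin e) (Fin d) (MvPowerSeries (Fin d) ℂ) :=
  Matrix.of fun i j => MvPowerSeries.pderiv ℂ j (H i)

/-- `δ` is a `k × k`-minor of the matrix `A`. -/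
def IsMinor {d e : ℕ} {R : Type*} [CommRing R] (A : Matrix (Fin e) (Fin d) R) (k : ℕ) (δ : R) :
    Prop :=
  ∃ (a : Fin k ↪o Fin e) (b : Fin k ↪o Fin d), δ = (A.submatrix a b).det

/-- Transversality at `0` of the formal map `H` to the formal hypersurface `ρ' = 0`:
`T₀M' + dH(T₀ℂ^d) = T₀ℂ^e`, as real vector spaces. -/
def IsFormalTransversal {d e : ℕ} (H : Fin e → MvPowerSeries (Fin d) ℂ)
    (ρ' : MvPowerSeries (Fin e ⊕ Fin e) ℂ) : Prop :=
  realTangent (formalGradient ρ') ⊔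
    LinearMap.range ((Matrix.mulVecLin
      ((formalJacobian H).map MvPowerSeries.constantCoeff)).restrictScalars ℝ) = ⊤

end

end CRTransversal

/-! ## Formal power series over a field form a unique factorization domain -/

namespace MvPowerSeries

/-! Everything happens on the complexified hypersurface. Write `ρ'(H(Z), H̄(ξ)) = a ρ`.
Differentiating at the origin gives `ρ'_{Z'} H_Z = a(0) ρ_Z`, so transversality follows once `a(0) ≠
0`. Suppose `a(0) = 0`, put `d = n + 1`, `e = N + 1`, and let `R = ℂ⟦Z, ξ⟧/(ρ)`, which is again a
power series ring by the implicit function theorem, hence a unique factorization domain.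

Where `a` and `ρ` both vanish, the first derivatives of `aρ` vanish, and its mixed second
derivatives form the matrix `a_Z ρ_ξ + ρ_Z a_ξ` of rank at most two. By the chain rule this matrix
is `H_Zᵀ L H̄_ξ`, with `L` the mixed Hessian of `ρ'` along the map. Sylvester's inequality then
yields `rank H_Z + rank H̄_ξ + r ≤ 2e` (`rank_add_rank_add_formalLeviRank_le`), so by assumption the
two ranks add up to at most `d + s - 2`. If `a = 0` in `R`, both ranks are `d`, which is absurd.
Otherwise take a prime factor `f` of `a` in `R` and compute the ranks at its generic point. If `rank
H_Z < d` there, `f` divides a nonzero minor `δ(Z)`; as `ℂ⟦Z⟧` is a retract of `R`, `f` is associated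
with a prime `D(Z)`, and the hypothesis on minors gives `rank H_Z ≥ s`. The same holds for `H̄_ξ`.
Neither rank can be `d`, since the other would be both less than `s` and at least `s`. So `f` is
associated with a series in `Z` and also with a series in `ξ`.

The ideal `(ρ, f)` is then stable under CR fields, which kill series in `Z`, and under their
conjugates, which kill series in `ξ`; hence it is stable under the Lie algebra they generate. By
finite type this algebra spans the tangent space at the origin, and an Euler field argument puts
every proper stable ideal inside `(ρ)` (`le_span_of_invariant`). This contradicts `f ≠ 0`.

The smooth case is reduced to the formal argument by Taylor expansion in `Z` and `Z̄`. Functions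
vanishing on `M` have Taylor series divisible by that of `ρ` (`taylor_dvd_taylor`), and the CR Lie
algebra maps to its formal counterpart (`CRLieAlgebra.taylor`). It remains to see that, when the
rank-below-`s` locus has codimension two, the `s`-minors have no common prime factor `D`
(`exists_isMinor_not_dvd`): together with `d - 2` or fewer further functions they have an isolated
zero, so by the Nullstellensatz (`X_mem_radical_of_isolated_zero`) they generate an ideal with
radical the maximal ideal, and then so do `D` and these functions, against Krull's height theorem.
-/

instance isDomain_of_isDomain {σ K : Type*} [CommRing K] [IsDomain K] :
    IsDomain (MvPowerSeries σ K) :=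
  NoZeroDivisors.to_isDomain _

theorem mem_maximalIdeal_iff {σ K : Type*} [Field K] {f : MvPowerSeries σ K} :
    f ∈ IsLocalRing.maximalIdeal (MvPowerSeries σ K) ↔ constantCoeff f = 0 := by
  rw [IsLocalRing.mem_maximalIdeal, mem_nonunits_iff, isUnit_iff_constantCoeff, isUnit_iff_ne_zero,
    not_not]

/-- Induction on `s`: the terms of `f` that contain the variable `i` form a multiple of `X i`, and
the remaining terms satisfy the hypothesis for the smaller set. -/
theorem mem_span_X_of_coeff_eq_zero {σ K : Type*} [CommRing K] (s : Finset σ) :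
    ∀ f : MvPowerSeries σ K, (∀ α : σ →₀ ℕ, (∀ i ∈ s, α i = 0) → coeff α f = 0) →
      f ∈ Ideal.span (Set.range (X : σ → MvPowerSeries σ K)) := by
  classical
  induction s using Finset.induction_on with
  | empty =>
    intro f hf
    have : f = 0 := by ext α; simpa using hf α (by simp)
    simp [this]
  | insert i s hi ih =>
    intro f hf
    let f₁ : MvPowerSeries σ K := fun α => if α i = 0 then coeff α f else 0
    have hf₁ : ∀ α, coeff α f₁ = if α i = 0 then coeff α f else 0 := fun α => rfl
    have h1 : f₁ ∈ Ideal.span (Set.range (X : σ → MvPowerSeries σ K)) := by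
      refine ih f₁ fun α hα => ?_
      rw [hf₁]
      split_ifs with h
      · exact hf α fun j hj => by
          rcases Finset.mem_insert.1 hj with rfl | hj
          · exact h
          · exact hα j hj
      · rfl
    have h2 : X i ∣ f - f₁ := X_dvd_iff.2 fun α hα => by simp [hf₁, hα]
    have h3 : f - f₁ ∈ Ideal.span (Set.range (X : σ → MvPowerSeries σ K)) :=
      Ideal.mem_of_dvd _ h2 (Ideal.subset_span ⟨i, rfl⟩)
    simpa using add_mem h3 h1

theorem maximalIdeal_eq_span_X (σ K : Type*) [Finite σ] [Field K] :
    IsLocalRing.maximalIdeal (MvPowerSeries σ K) = Ideal.span (Set.range X) := by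
  have := Fintype.ofFinite σ
  apply le_antisymm
  · intro f hf
    rw [mem_maximalIdeal_iff] at hf
    refine mem_span_X_of_coeff_eq_zero Finset.univ f fun α hα => ?_
    have : α = 0 := by ext i; simpa using hα i (Finset.mem_univ i)
    rw [this, coeff_zero_eq_constantCoeff, hf]
  · rw [Ideal.span_le]
    rintro _ ⟨i, rfl⟩
    exact mem_maximalIdeal_iff.2 (by simp)

/-- This is what makes Weierstrass preparation and division available with coefficients in a power
series ring. -/
instance isAdicComplete_maximalIdeal {σ K : Type*} [Finite σ] [Field K] :
    IsAdicComplete (IsLocalRing.maximalIdeal (MvPowerSeries σ K)) (MvPowerSeries σ K) := by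
  rw [maximalIdeal_eq_span_X]
  infer_instance

end MvPowerSeries

/-- Weierstrass preparation replaces `f` by a distinguished polynomial `P`. Irreducibility of `P` as
a series gives irreducibility as a polynomial, Gauss's lemma makes `P` prime in `A[X]`, and the
Weierstrass isomorphism carries primality back to `f`. -/
theorem PowerSeries.prime_of_irreducible {A : Type*} [CommRing A] [IsDomain A]
    [UniqueFactorizationMonoid A] [IsLocalRing A] [IsAdicComplete (IsLocalRing.maximalIdeal A) A]
    {f : PowerSeries A} (hf : f.map (IsLocalRing.residue A) ≠ 0) (hirr : Irreducible f) :
    Prime f := by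
  obtain ⟨P, u, H⟩ := PowerSeries.exists_isWeierstrassFactorization hf
  have hassoc : Associated (P : PowerSeries A) f := by
    rw [H.eq_mul]
    exact associated_mul_unit_right _ _ H.isUnit
  have hPirr : Irreducible (P : PowerSeries A) := hassoc.irreducible_iff.2 hirr
  have hmonic := H.isDistinguishedAt.monic
  have hmap : P.map (IsLocalRing.residue A) = Polynomial.X ^ P.natDegree := by
    ext i
    rw [Polynomial.coeff_map, Polynomial.coeff_X_pow]
    rcases lt_trichotomy i P.natDegree with h | h | h
    · rw [if_neg h.ne, IsLocalRing.residue_eq_zero_iff]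
      exact H.isDistinguishedAt.mem h
    · rw [if_pos h, h, hmonic.coeff_natDegree, map_one]
    · rw [if_neg h.ne', Polynomial.coeff_eq_zero_of_natDegree_lt h, map_zero]
  -- A monic factor of a distinguished polynomial reduces to a power of `X`; if it is a unit as a
  -- series its constant term is a unit, so this power is `X ^ 0` and the factor is `1`.
  have hunit : ∀ G K : Polynomial A, G.Monic → K.Monic → G * K = P →
      IsUnit (G : PowerSeries A) → G = 1 := by
    intro G K hG _ hGK hGu
    have h0 : IsUnit (G.coeff 0) := by
      have := PowerSeries.isUnit_iff_constantCoeff.1 hGu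
      rwa [← PowerSeries.coeff_zero_eq_constantCoeff_apply, Polynomial.coeff_coe] at this
    have hdvd : G.map (IsLocalRing.residue A) ∣ Polynomial.X ^ P.natDegree := by
      rw [← hmap, ← hGK, Polynomial.map_mul]
      exact dvd_mul_right _ _
    obtain ⟨i, hi, hGi⟩ := (dvd_prime_pow Polynomial.prime_X _).1 hdvd
    have hGeq : G.map (IsLocalRing.residue A) = Polynomial.X ^ i :=
      Polynomial.eq_of_monic_of_associated (hG.map _) (Polynomial.monic_X_pow i) hGi
    have hi0 : i = 0 := by
      by_contra hne
      have := congrArg (fun q => q.coeff 0) hGeq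
      simp only [Polynomial.coeff_map, Polynomial.coeff_X_pow, if_neg (Ne.symm hne)] at this
      exact (h0.map (IsLocalRing.residue A)).ne_zero this
    have : G.natDegree = 0 := by
      rw [← hG.natDegree_map (IsLocalRing.residue A), hGeq, hi0]; simp
    exact Polynomial.eq_one_of_monic_natDegree_zero hG this
  have hP1 : P ≠ 1 := by
    rintro rfl
    exact hPirr.not_isUnit (by simp)
  have hPirr' : Irreducible P := by
    rw [Polynomial.irreducible_of_monic hmonic hP1]
    intro G K hG hK hGK
    have := hPirr.isUnit_or_isUnit (a := (G : PowerSeries A)) (b := (K : PowerSeries A))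
      (by rw [← Polynomial.coe_mul, hGK])
    rcases this with h | h
    · exact Or.inl (hunit G K hG hK hGK h)
    · exact Or.inr (hunit K G hK hG (by rw [mul_comm, hGK]) h)
  have hPprime : Prime P := hPirr'.prime
  have hf0 : f ≠ 0 := hirr.ne_zero
  rw [← Ideal.span_singleton_prime hf0]
  have h1 : (Ideal.span {P}).IsPrime := (Ideal.span_singleton_prime hPprime.ne_zero).2 hPprime
  rw [← Ideal.Quotient.isDomain_iff_prime] at h1 ⊢
  -- Division by `P` identifies `A[X]/(P)` with `A⟦X⟧/(f)`.
  exact (H.algEquivQuotient.symm : _ ≃ₐ[A] _).toMulEquiv.isDomain _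

/-! ### Linear changes of variables and the induction for unique factorization -/

namespace MvPowerSeries

section LinearSubstitution

variable {σ K : Type*} [Fintype σ] [Field K]

theorem hasSubst_linear (M : Matrix σ σ K) :
    HasSubst fun i => (∑ j, M i j • X j : MvPowerSeries σ K) :=
  hasSubst_of_constantCoeff_zero fun i => by simp

/-- The substitution `Xᵢ ↦ ∑ⱼ Mᵢⱼ Xⱼ`. -/
noncomputable def linearSubst (M : Matrix σ σ K) : MvPowerSeries σ K →ₐ[K] MvPowerSeries σ K :=
  substAlgHom (hasSubst_linear M)

theorem linearSubst_X (M : Matrix σ σ K) (i : σ) : linearSubst M (X i) = ∑ j, M i j • X j := by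
  rw [linearSubst, substAlgHom_X]

theorem linearSubst_one [DecidableEq σ] (f : MvPowerSeries σ K) : linearSubst 1 f = f := by
  have : (fun i => (∑ j, (1 : Matrix σ σ K) i j • X j : MvPowerSeries σ K)) = X := by
    funext i
    simp [Matrix.one_apply, ite_smul]
  rw [linearSubst, substAlgHom_apply, this, subst_self, id]

theorem linearSubst_linearSubst (M M' : Matrix σ σ K) (f : MvPowerSeries σ K) :
    linearSubst M (linearSubst M' f) = linearSubst (M' * M) f := by
  simp only [linearSubst, substAlgHom_apply]
  rw [subst_comp_subst_apply (hasSubst_linear M') (hasSubst_linear M)]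
  congr 1
  funext i
  rw [← substAlgHom_apply (hasSubst_linear M), map_sum]
  simp only [map_smul, substAlgHom_X, Finset.smul_sum, smul_smul, Matrix.mul_apply, Finset.sum_smul]
  rw [Finset.sum_comm]

/-- The automorphism `Xᵢ ↦ ∑ⱼ Mᵢⱼ Xⱼ` given by an invertible matrix. -/
noncomputable def linearEquiv [DecidableEq σ] (M : Matrix σ σ K) (hM : IsUnit M.det) :
    MvPowerSeries σ K ≃ₐ[K] MvPowerSeries σ K :=
  AlgEquiv.ofAlgHom (linearSubst M) (linearSubst M⁻¹)
    (AlgHom.ext fun f => by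
      simp [linearSubst_linearSubst, Matrix.nonsing_inv_mul M hM, linearSubst_one])
    (AlgHom.ext fun f => by
      simp [linearSubst_linearSubst, Matrix.mul_nonsing_inv M hM, linearSubst_one])

end LinearSubstitution

end MvPowerSeries

namespace MvPowerSeries

section Regular

variable {σ K : Type*} [Fintype σ] [Field K]

/-- A coefficient on the `o`-axis is unchanged when all other variables are set to zero, and then `∑
j, M i j • X j` becomes `M i o • X o`. -/
theorem coeff_single_prod_linear (M : Matrix σ σ K) (o : σ) (m : ℕ) (α : σ →₀ ℕ) :
    coeff (Finsupp.single o m) (α.prod fun i e => (∑ j, M i j • X j : MvPowerSeries σ K) ^ e) =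
      if α.degree = m then α.prod (fun i e => M i o ^ e) else 0 := by
  let e : Unit ↪ σ := ⟨fun _ => o, fun _ _ _ => rfl⟩
  have h1 : Finsupp.single o m = Finsupp.embDomain e (Finsupp.single () m) := by
    rw [Finsupp.embDomain_single]; rfl
  have h2 : ∀ i, killCompl e (∑ j, M i j • X j : MvPowerSeries σ K) = M i o • X () := by
    intro i
    rw [map_sum, Finset.sum_eq_single o]
    · rw [map_smul]; congr 1; exact killCompl_X ()
    · intro j _ hj
      rw [map_smul, killCompl_X_eq_zero (by rintro ⟨_, h⟩; exact hj h.symm), smul_zero]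
    · simp
  have h3 : killCompl e (α.prod fun i e => (∑ j, M i j • X j : MvPowerSeries σ K) ^ e) =
      monomial (Finsupp.single () α.degree) (α.prod (fun i e => M i o ^ e)) := by
    rw [Finsupp.prod, map_prod]
    simp only [map_pow, h2, smul_pow]
    rw [Finset.prod_smul, Finset.prod_pow_eq_pow_sum, X_pow_eq, ← (monomial _).map_smul,
      smul_eq_mul, mul_one]
    rfl
  rw [h1, ← coeff_killCompl, h3, coeff_monomial]
  congr 1
  simp [eq_comm]

/-- Restricting `f` to a line `t ↦ t v` makes the coefficient of `t ^ m` the value at `v` of the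
homogeneous part of degree `m`. Over an infinite field some `v` avoids the zeros of that part, and
an invertible matrix can carry the `o`-axis to this line. -/
theorem exists_linearEquiv_coeff_ne_zero [DecidableEq σ] [Infinite K] {f : MvPowerSeries σ K} (hf : f ≠ 0)
    (o : σ) : ∃ (M : Matrix σ σ K) (_ : IsUnit M.det) (m : ℕ),
      coeff (Finsupp.single o m) (linearSubst M f) ≠ 0 := by
  obtain ⟨α₀, hα₀⟩ : ∃ α, coeff α f ≠ 0 := by
    by_contra! h
    exact hf (by ext α; simpa using h α)
  set m := α₀.degree
  have hfin : {α : σ →₀ ℕ | α.degree = m}.Finite :=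
    (Finsupp.finite_of_degree_le m).subset fun α hα => le_of_eq hα
  let p : MvPolynomial σ K := ∑ α ∈ hfin.toFinset, MvPolynomial.monomial α (coeff α f)
  have hp : p ≠ 0 := by
    intro h
    apply hα₀
    have := congrArg (MvPolynomial.coeff α₀) h
    simp only [p, MvPolynomial.coeff_sum, MvPolynomial.coeff_monomial, Finset.sum_ite_eq',
      MvPolynomial.coeff_zero] at this
    simpa [m] using this
  -- The extra factor `X o` ensures `v o ≠ 0`, which is the determinant of the identity matrix with
  -- column `o` replaced by `v`.
  obtain ⟨v, hv⟩ : ∃ v, MvPolynomial.eval v (MvPolynomial.X o * p) ≠ 0 := by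
    by_contra! h
    exact mul_ne_zero (MvPolynomial.X_ne_zero o) hp (MvPolynomial.funext fun v => by simpa using h v)
  rw [map_mul, MvPolynomial.eval_X] at hv
  let M : Matrix σ σ K := (1 : Matrix σ σ K).updateCol o v
  have hM : M.det = v o := by rw [← Matrix.cramer_apply]; simp
  refine ⟨M, by rw [hM]; exact (left_ne_zero_of_mul hv).isUnit, m, ?_⟩
  have hMo : ∀ i, M i o = v i := fun i => by simp [M]
  rw [linearSubst, substAlgHom_apply, coeff_subst (hasSubst_linear M)]
  simp only [coeff_single_prod_linear, hMo]
  rw [finsum_eq_sum_of_support_subset (s := hfin.toFinset)]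
  · have : ∀ α ∈ hfin.toFinset, (coeff α f • if α.degree = m then α.prod (fun i e => v i ^ e)
        else 0) = MvPolynomial.eval v (MvPolynomial.monomial α (coeff α f)) := by
      intro α hα
      rw [if_pos (by simpa using hα), MvPolynomial.eval_monomial, smul_eq_mul]
    rw [Finset.sum_congr rfl this, ← map_sum]
    exact right_ne_zero_of_mul hv
  · intro α hα
    by_contra h
    simp only [Set.Finite.coe_toFinset, Set.mem_ofPred_eq] at h
    simp [h] at hα

end Regular

/-- Induction on the number of variables. Factorizations exist because the ring is Noetherian;
irreducibles are prime because, after a linear change, each is regular in the first variable and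
`PowerSeries.prime_of_irreducible` applies. -/
theorem uniqueFactorizationMonoid_fin (K : Type*) [Field K] [Infinite K] (d : ℕ) :
    UniqueFactorizationMonoid (MvPowerSeries (Fin d) K) := by
  induction d with
  | zero =>
    exact (isEmptyEquiv (σ := Fin 0) (R := K)).symm.toMulEquiv.uniqueFactorizationMonoid
      inferInstance
  | succ d ih =>
    have : WfDvdMonoid (MvPowerSeries (Fin (d + 1)) K) := IsNoetherianRing.wfDvdMonoid
    refine ⟨fun {f} => ⟨fun hirr => ?_, Prime.irreducible⟩⟩
    obtain ⟨M, hM, m, hm⟩ := exists_linearEquiv_coeff_ne_zero hirr.ne_zero (0 : Fin (d + 1))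
    let φ := (linearEquiv M hM).trans (finSuccEquiv K d)
    rw [← MulEquiv.prime_iff φ]
    rw [← MulEquiv.irreducible_iff φ] at hirr
    refine PowerSeries.prime_of_irreducible (fun h => hm ?_) hirr
    have h1 := congrArg (PowerSeries.coeff m) h
    rw [PowerSeries.coeff_map, map_zero, IsLocalRing.residue_eq_zero_iff, mem_maximalIdeal_iff,
      ← coeff_zero_eq_constantCoeff_apply] at h1
    change coeff 0 (PowerSeries.coeff m (finSuccEquiv K d (linearSubst M f))) = 0 at h1
    rw [coeff_coeff_finSuccEquiv] at h1
    rw [← h1]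
    congr 2
    ext i
    refine Fin.cases ?_ (fun i => ?_) i
    · simp
    · simp

instance uniqueFactorizationMonoid (σ K : Type*) [Finite σ] [Field K] [Infinite K] :
    UniqueFactorizationMonoid (MvPowerSeries σ K) :=
  (renameEquiv K (Finite.equivFin σ).symm).toMulEquiv.uniqueFactorizationMonoid
    (uniqueFactorizationMonoid_fin K _)

end MvPowerSeries

/-! ## Quotients by a series of order one -/

/-- The implicit function theorem in algebraic form: modulo the maximal ideal `g` has order one, so
the remainder of Weierstrass division by `g` is a constant, and it is unique. -/
theorem PowerSeries.bijective_algebraMap_quotient_of_isUnit_coeff_one {A : Type*} [CommRing A]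
    [IsLocalRing A] [IsAdicComplete (IsLocalRing.maximalIdeal A) A] {g : PowerSeries A}
    (h0 : PowerSeries.coeff 0 g ∈ IsLocalRing.maximalIdeal A)
    (h1 : IsUnit (PowerSeries.coeff 1 g)) :
    Function.Bijective (algebraMap A (PowerSeries A ⧸ Ideal.span {g})) := by
  have hres : PowerSeries.coeff 1 (g.map (IsLocalRing.residue A)) ≠ 0 := by
    rw [PowerSeries.coeff_map]
    exact (h1.map _).ne_zero
  have hg : g.map (IsLocalRing.residue A) ≠ 0 := fun h => hres (by rw [h, map_zero])
  have hord : (g.map (IsLocalRing.residue A)).order = 1 := by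
    refine PowerSeries.order_eq_nat.2 ⟨hres, fun i hi => ?_⟩
    obtain rfl : i = 0 := by omega
    rw [PowerSeries.coeff_map, IsLocalRing.residue_eq_zero_iff]
    exact h0
  constructor
  · rw [injective_iff_map_eq_zero]
    intro a ha
    change Ideal.Quotient.mk _ (PowerSeries.C a) = 0 at ha
    rw [Ideal.Quotient.eq_zero_iff_mem, Ideal.mem_span_singleton] at ha
    obtain ⟨q, hq⟩ := ha
    have H : PowerSeries.IsWeierstrassDivision 0 g q (- Polynomial.C a) := by
      refine ⟨?_, by simp [hq]⟩
      rw [Polynomial.degree_neg]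
      refine lt_of_le_of_lt Polynomial.degree_C_le ?_
      change (0 : WithBot ℕ) < ((g.map (IsLocalRing.residue A)).order.toNat : WithBot ℕ)
      rw [hord]
      exact_mod_cast one_pos
    have := (H.eq_zero hg).2
    simpa using this
  · intro x
    obtain ⟨f, rfl⟩ := Ideal.Quotient.mk_surjective x
    obtain ⟨q, r, H⟩ := f.exists_isWeierstrassDivision hg
    have hr : r.degree ≤ 0 := by
      have h2 : r.degree < ((g.map (IsLocalRing.residue A)).order.toNat : WithBot ℕ) := H.1
      rw [hord] at h2
      exact Polynomial.natDegree_eq_zero_iff_degree_le_zero.1 (by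
        by_contra h
        have h3 : 1 ≤ r.natDegree := Nat.one_le_iff_ne_zero.2 h
        rw [Polynomial.degree_eq_natDegree (by rintro rfl; simp at h)] at h2
        have : r.natDegree < 1 := by exact_mod_cast h2
        omega)
    refine ⟨r.coeff 0, ?_⟩
    change Ideal.Quotient.mk _ (PowerSeries.C (r.coeff 0)) = _
    rw [Ideal.Quotient.eq, Ideal.mem_span_singleton]
    refine ⟨-q, ?_⟩
    rw [H.2, Polynomial.eq_C_of_degree_le_zero hr]
    simp

namespace MvPowerSeries

/-- A series in the variables `none` and `some i` of order one in `none` can be solved for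
`none`. -/
theorem exists_ringEquiv_quotient_of_option {σ K : Type*} [Finite σ] [Field K]
    {g : MvPowerSeries (Option σ) K} (h0 : constantCoeff g = 0)
    (h1 : coeff (Finsupp.single none 1) g ≠ 0) :
    ∃ e : MvPowerSeries σ K ≃+* (MvPowerSeries (Option σ) K ⧸ Ideal.span {g}),
      ∀ f, e f = Ideal.Quotient.mk _ (rename some f) := by
  let φ := optionEquivLeft σ K
  have hb := PowerSeries.bijective_algebraMap_quotient_of_isUnit_coeff_one (g := φ g)
    (by
      rw [mem_maximalIdeal_iff, ← coeff_zero_eq_constantCoeff_apply, coeff_coeff_optionEquivLeft]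
      convert! h0
      rw [← coeff_zero_eq_constantCoeff]
      congr 2
      ext i
      cases i <;> simp)
    (by
      rw [isUnit_iff_constantCoeff, ← coeff_zero_eq_constantCoeff_apply,
        coeff_coeff_optionEquivLeft, isUnit_iff_ne_zero]
      convert! h1)
  let ψ : (MvPowerSeries (Option σ) K ⧸ Ideal.span {g}) ≃+*
      (PowerSeries (MvPowerSeries σ K) ⧸ Ideal.span {φ g}) :=
    Ideal.quotientEquiv _ _ φ.toRingEquiv (by rw [Ideal.map_span]; simp)
  refine ⟨(RingEquiv.ofBijective _ hb).trans ψ.symm, fun f => ?_⟩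
  rw [RingEquiv.trans_apply, RingEquiv.symm_apply_eq]
  change Ideal.Quotient.mk _ (PowerSeries.C f) = Ideal.Quotient.mk _ (φ (rename some f))
  congr 1
  ext n α
  rw [coeff_coeff_optionEquivLeft, PowerSeries.coeff_C]
  split_ifs with hn
  · have : Finsupp.optionElim n α = Finsupp.embDomain Function.Embedding.some α := by
      subst hn
      ext i
      cases i with
      | none => rw [Finsupp.optionElim_apply_none, Finsupp.embDomain_of_notMem_range]; simp
      | some i =>
        rw [Finsupp.optionElim_apply_some]
        exact (Finsupp.embDomain_apply_self Function.Embedding.some α i).symm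
    rw [this]
    exact (coeff_embDomain_rename Function.Embedding.some f α).symm
  · rw [map_zero, eq_comm]
    apply coeff_rename_eq_zero
    rintro ⟨β, hβ⟩
    apply hn
    have := congrArg (fun γ => γ none) hβ
    simp only [Finsupp.optionElim_apply_none] at this
    rw [← this, Finsupp.mapDomain_of_notMem_range]
    simp

end MvPowerSeries

namespace MvPowerSeries

section QuotientBySeries

variable {τ K : Type*} [Field K] {ρ : MvPowerSeries τ K}

theorem exists_ringEquiv_quotient [Finite τ] (h0 : constantCoeff ρ = 0) {i₀ : τ}
    (h1 : coeff (Finsupp.single i₀ 1) ρ ≠ 0) :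
    Nonempty (MvPowerSeries {i : τ // i ≠ i₀} K ≃+* (MvPowerSeries τ K ⧸ Ideal.span {ρ})) := by
  classical
  let φ := renameEquiv K (Equiv.optionSubtypeNe i₀).symm
  have hc : coeff (Finsupp.single none 1) (φ ρ) ≠ 0 := by
    convert! h1
    have : Finsupp.single none 1 =
        Finsupp.embDomain (Equiv.optionSubtypeNe i₀).symm.toEmbedding (Finsupp.single i₀ 1) := by
      rw [Finsupp.embDomain_single]; simp
    rw [this]
    exact coeff_embDomain_rename (Equiv.optionSubtypeNe i₀).symm.toEmbedding ρ _
  obtain ⟨e, -⟩ := exists_ringEquiv_quotient_of_option (g := φ ρ)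
    (by simpa [φ] using h0) hc
  exact ⟨e.trans (Ideal.quotientEquiv (Ideal.span {ρ}) _ φ.toRingEquiv
    (by rw [Ideal.map_span]; simp)).symm⟩

theorem isDomain_quotient [Finite τ] (h0 : constantCoeff ρ = 0) {i₀ : τ}
    (h1 : coeff (Finsupp.single i₀ 1) ρ ≠ 0) :
    IsDomain (MvPowerSeries τ K ⧸ Ideal.span {ρ}) := by
  obtain ⟨e⟩ := exists_ringEquiv_quotient h0 h1
  exact e.symm.toMulEquiv.isDomain _

theorem uniqueFactorizationMonoid_quotient [Finite τ] [Infinite K] (h0 : constantCoeff ρ = 0) {i₀ : τ}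
    (h1 : coeff (Finsupp.single i₀ 1) ρ ≠ 0) :
    UniqueFactorizationMonoid (MvPowerSeries τ K ⧸ Ideal.span {ρ}) := by
  obtain ⟨e⟩ := exists_ringEquiv_quotient h0 h1
  exact e.toMulEquiv.uniqueFactorizationMonoid inferInstance

/-- Set to zero every variable outside `e` and `i₀`. What is left of `ρ` can be solved for the
variable `i₀`, so the quotient maps onto series in the variables of `e`: a section of the projection
from `ρ = 0` to these variables. -/
theorem exists_retraction_quotient {σ : Type*} [Finite σ] (e : σ ↪ τ)
    (h0 : constantCoeff ρ = 0) {i₀ : τ} (hi₀ : i₀ ∉ Set.range e)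
    (h1 : coeff (Finsupp.single i₀ 1) ρ ≠ 0) :
    ∃ π : (MvPowerSeries τ K ⧸ Ideal.span {ρ}) →+* MvPowerSeries σ K,
      ∀ f, π (Ideal.Quotient.mk _ (rename e f)) = f := by
  let e' : Option σ ↪ τ := e.optionElim i₀ hi₀
  have hc : coeff (Finsupp.single none 1) (killCompl e' ρ) ≠ 0 := by
    rw [coeff_killCompl, Finsupp.embDomain_single]
    exact h1
  obtain ⟨ε, hε⟩ := exists_ringEquiv_quotient_of_option (g := killCompl e' ρ)
    (by
      rw [← coeff_zero_eq_constantCoeff_apply, coeff_killCompl, Finsupp.embDomain_zero]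
      simpa using h0) hc
  refine ⟨ε.symm.toRingHom.comp (Ideal.quotientMap _ (killCompl e').toRingHom (by
    rw [Ideal.span_singleton_le_iff_mem, Ideal.mem_comap]
    exact Ideal.mem_span_singleton_self _)), fun f => ?_⟩
  rw [RingHom.comp_apply, Ideal.quotientMap_mk]
  change ε.symm _ = f
  rw [RingEquiv.symm_apply_eq, hε]
  congr 1
  change killCompl e' (rename e f) = _
  have : (e : σ → τ) = e' ∘ some := by funext i; rfl
  rw [show rename (⇑e) f = rename e' (rename some f) by rw [rename_rename]; rfl,
    killCompl_rename_app]

end QuotientBySeries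

end MvPowerSeries

/-- A prime dividing a nonzero element which comes from a retract comes itself from the retract. -/
theorem exists_prime_associated_of_retraction {A R : Type*} [CommRing A] [IsDomain A]
    [UniqueFactorizationMonoid A] [CommRing R] [IsLocalRing R] (ι : A →+* R) (π : R →+* A)
    (hπ : ∀ a, π (ι a) = a) {f : R} (hf : Prime f) {δ : A} (hδ : δ ≠ 0) (hdvd : f ∣ ι δ) :
    ∃ d : A, Prime d ∧ Associated f (ι d) ∧ ∀ a, f ∣ ι a → d ∣ a := by
  have hloc : IsLocalHom π := .of_surjective π fun a => ⟨ι a, hπ a⟩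
  have hprime : ∃ d, Prime d ∧ f ∣ ι d := by
    induction δ using UniqueFactorizationMonoid.induction_on_prime with
    | h₁ => exact absurd rfl hδ
    | h₂ x hx => exact absurd (isUnit_of_dvd_unit hdvd (hx.map ι)) hf.not_isUnit
    | h₃ a p ha hp ih =>
      rw [map_mul] at hdvd
      rcases hf.dvd_or_dvd hdvd with h | h
      · exact ⟨p, hp, h⟩
      · exact ih ha h
  obtain ⟨d, hd, g, hg⟩ := hprime
  -- The retraction is a local homomorphism, so `π f` is not a unit. As `d` is irreducible, `π g` is
  -- a unit, and hence so is `g`.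
  have hdf : d = π f * π g := by rw [← map_mul, ← hg, hπ]
  have hg' : IsUnit g := by
    rcases hd.irreducible.isUnit_or_isUnit hdf with h | h
    · exact absurd (isUnit_of_map_unit π f h) hf.not_isUnit
    · exact isUnit_of_map_unit π g h
  refine ⟨d, hd, hg ▸ associated_mul_unit_right f g hg', fun a ⟨b, hb⟩ => ?_⟩
  have h1 : ι d ∣ ι a := by
    rw [hg]
    obtain ⟨u, rfl⟩ := hg'
    exact ⟨↑u⁻¹ * b, by rw [hb]; simp [mul_assoc]⟩
  simpa [hπ] using map_dvd π h1

/-! ## Ranks of matrices -/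

namespace Matrix

variable {K : Type*} [Field K] {l m n : Type*} [Fintype l] [Fintype m] [Fintype n]

omit [Fintype l] [Fintype m] in
theorem rank_add_le_rank_add_rank [Finite m] (A B : Matrix m n K) :
    (A + B).rank ≤ A.rank + B.rank := by
  unfold Matrix.rank
  rw [mulVecLin_add]
  exact (Submodule.finrank_mono (LinearMap.range_add_le _ _)).trans
    (Submodule.finrank_add_le_finrank_add_finrank _ _)

omit [Fintype l] in
-- Sylvester's inequality: passing from `B` to `A * B` loses at most the kernel of `A`.
theorem rank_add_rank_le_card_add_rank_mul (A : Matrix l m K) (B : Matrix m n K) :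
    A.rank + B.rank ≤ Fintype.card m + (A * B).rank := by
  have h1 := (A.mulVecLin).finrank_range_add_finrank_ker
  rw [Module.finrank_fintype_fun_eq_card] at h1
  have h2 := (A.mulVecLin.domRestrict (LinearMap.range B.mulVecLin)).finrank_range_add_finrank_ker
  have h3 : LinearMap.range (A.mulVecLin.domRestrict (LinearMap.range B.mulVecLin)) =
      LinearMap.range (A * B).mulVecLin := by
    rw [Matrix.mulVecLin_mul, LinearMap.range_comp, LinearMap.range_domRestrict]
  have h4 : Module.finrank K (LinearMap.ker
      (A.mulVecLin.domRestrict (LinearMap.range B.mulVecLin))) ≤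
      Module.finrank K (LinearMap.ker A.mulVecLin) := by
    refine LinearMap.finrank_le_finrank_of_injective
      (f := ((LinearMap.range B.mulVecLin).subtype.comp (Submodule.subtype _)).codRestrict
        (LinearMap.ker A.mulVecLin) fun x => ?_) ?_
    · exact x.2
    · intro x y hxy
      have := congrArg Subtype.val hxy
      exact Subtype.ext (Subtype.ext this)
  rw [h3] at h2
  unfold Matrix.rank
  omega

omit [Fintype l] [Fintype m] in
theorem le_rank_of_det_submatrix_ne_zero (A : Matrix m n K) {ι : Type*} [Fintype ι] [DecidableEq ι]
    (a : ι → m) (b : ι → n) (h : (A.submatrix a b).det ≠ 0) : Fintype.card ι ≤ A.rank := by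
  rw [← rank_of_det_ne_zero h]
  exact rank_submatrix_le A a b

theorem exists_linearIndependent_rows (A : Matrix m n K) {k : ℕ} (hk : k ≤ A.rank) :
    ∃ a : Fin k → m, LinearIndependent K (A.submatrix a id).row := by
  rw [rank_eq_finrank_span_row] at hk
  obtain ⟨s, hs, hspan, hli⟩ := exists_linearIndependent K (Set.range A.row)
  have hfin : s.Finite := (Set.finite_range _).subset hs
  have := hfin.fintype
  have hcard : Fintype.card s = Module.finrank K (Submodule.span K (Set.range A.row)) := by
    rw [← hspan, finrank_span_set_eq_card hli, Set.toFinset_card]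
  obtain ⟨e⟩ : Nonempty (Fin k ↪ s) := Function.Embedding.nonempty_of_card_le (by
    rw [Fintype.card_fin, hcard]; exact hk)
  choose g hg using fun x : s => hs x.2
  refine ⟨fun i => g (e i), ?_⟩
  have : (A.submatrix (fun i => g (e i)) id).row = fun i => ((e i : s) : n → K) := by
    funext i
    rw [← hg (e i)]
    rfl
  rw [this]
  exact hli.comp e e.injective

theorem exists_det_submatrix_ne_zero (A : Matrix m n K) {k : ℕ} (hk : k ≤ A.rank) :
    ∃ (a : Fin k → m) (b : Fin k → n), (A.submatrix a b).det ≠ 0 := by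
  obtain ⟨a, ha⟩ := A.exists_linearIndependent_rows hk
  have h1 : k ≤ (A.submatrix a id)ᵀ.rank := by
    rw [rank_transpose, ha.rank_matrix, Fintype.card_fin]
  obtain ⟨b, hb⟩ := exists_linearIndependent_rows _ h1
  refine ⟨a, b, ?_⟩
  have h2 : ((A.submatrix a id)ᵀ.submatrix b id) = (A.submatrix a b)ᵀ := rfl
  rw [h2, linearIndependent_rows_iff_isUnit, isUnit_iff_isUnit_det, det_transpose] at hb
  exact hb.ne_zero

omit [Fintype m] [Fintype n] in
theorem injective_of_det_submatrix_ne_zero (A : Matrix m n K) {ι : Type*} [Fintype ι]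
    [DecidableEq ι] {a : ι → m} {b : ι → n} (h : (A.submatrix a b).det ≠ 0) :
    Function.Injective a := by
  intro i j hij
  by_contra hne
  exact h (det_zero_of_row_eq hne (by funext x; simp [hij]))

/-- `IsMinor` uses increasing row and column indices; sorting an arbitrary injective choice changes
the determinant only by a sign. -/
theorem exists_minor_ne_zero {d e : ℕ} (A : Matrix (Fin e) (Fin d) K) {k : ℕ} (hk : k ≤ A.rank) :
    ∃ (a : Fin k ↪o Fin e) (b : Fin k ↪o Fin d), (A.submatrix a b).det ≠ 0 := by
  obtain ⟨a, b, hab⟩ := A.exists_det_submatrix_ne_zero hk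
  have ha := A.injective_of_det_submatrix_ne_zero hab
  have hb : Function.Injective b := by
    rw [← det_transpose] at hab
    exact injective_of_det_submatrix_ne_zero Aᵀ (a := b) (b := a) hab
  have key : ∀ {e : ℕ} (a : Fin k → Fin e), Function.Injective a →
      ∃ (a' : Fin k ↪o Fin e) (σ : Equiv.Perm (Fin k)), a = a' ∘ σ := by
    intro e a ha
    have hmono : StrictMono (a ∘ Tuple.sort a) :=
      (Tuple.monotone_sort a).strictMono_of_injective (ha.comp (Tuple.sort a).injective)
    refine ⟨OrderEmbedding.ofStrictMono _ hmono, (Tuple.sort a)⁻¹, ?_⟩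
    funext i
    simp
  obtain ⟨a', σ, rfl⟩ := key a ha
  obtain ⟨b', τ, rfl⟩ := key b hb
  refine ⟨a', b', fun h => hab ?_⟩
  have : A.submatrix (a' ∘ σ) (b' ∘ τ) = ((A.submatrix a' b').submatrix σ id).submatrix id τ := rfl
  rw [this, det_permute', det_permute, h]
  simp

theorem card_add_rank_le_rank_fromBlocks_one {o : Type*} [Fintype o] [DecidableEq o]
    (A : Matrix m n K) : Fintype.card o + A.rank ≤ (fromBlocks (1 : Matrix o o K) 0 0 A).rank := by
  obtain ⟨a, b, h⟩ := A.exists_det_submatrix_ne_zero le_rfl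
  have := le_rank_of_det_submatrix_ne_zero (fromBlocks (1 : Matrix o o K) 0 0 A)
    (Sum.map id a) (Sum.map id b) (by
      have : (fromBlocks (1 : Matrix o o K) 0 0 A).submatrix (Sum.map id a) (Sum.map id b) =
          fromBlocks 1 0 0 (A.submatrix a b) := by
        ext i j
        rcases i with i | i <;> rcases j with j | j <;> rfl
      rw [this, det_fromBlocks_zero₂₁, det_one, one_mul]
      exact h)
  simpa using this

/-- The rank does not drop under generization. -/
theorem le_rank_map_of_le_rank_map {S k : Type*} [CommRing S] [Field k] (χ : S →+* k)
    [IsLocalHom χ] (φ : S →+* K) (M : Matrix m n S) :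
    (M.map χ).rank ≤ (M.map φ).rank := by
  obtain ⟨a, b, h⟩ := (M.map χ).exists_det_submatrix_ne_zero le_rfl
  have h1 : ((M.map χ).submatrix a b).det = χ (M.submatrix a b).det := by
    rw [RingHom.map_det]; rfl
  have h2 : ((M.map φ).submatrix a b).det = φ (M.submatrix a b).det := by
    rw [RingHom.map_det]; rfl
  rw [h1] at h
  -- A minor that is nonzero under the local homomorphism `χ` is already a unit of `S`, so no
  -- homomorphism to a field can kill it.
  have h3 : IsUnit (M.submatrix a b).det := isUnit_of_map_unit χ _ h.isUnit
  simpa using le_rank_of_det_submatrix_ne_zero (M.map φ) a b (by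
    rw [h2]; exact (h3.map φ).ne_zero)

/-- The matrix `L` bordered by the row `v` and the column `u`. -/
def bordered {R : Type*} [Zero R] (u v : m → R) (L : Matrix m m R) :
    Matrix (Unit ⊕ m) (Unit ⊕ m) R :=
  fromBlocks 0 (replicateRow Unit v) (replicateCol Unit u) L

/-- Enlarge `A` and `A'` by a block `1`. The product of the transpose of the first, the bordered
matrix and the second has zero border because `u` and `v` kill `A` and `A'`, so its rank is at most
two. Two applications of Sylvester's inequality finish. -/
theorem rank_add_rank_add_rank_bordered_le (A A' : Matrix m n K) (L : Matrix m m K) (u v : m → K)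
    (p q p' q' : n → K) (hu : u ᵥ* A = 0) (hv : v ᵥ* A' = 0)
    (hL : Aᵀ * L * A' = vecMulVec p q + vecMulVec p' q') :
    A.rank + A'.rank + (bordered u v L).rank ≤ 2 * Fintype.card m + 2 := by
  classical
  have h1 := card_add_rank_le_rank_fromBlocks_one (o := Unit) A
  have h2 := card_add_rank_le_rank_fromBlocks_one (o := Unit) A'
  have h3 := rank_add_rank_le_card_add_rank_mul
    (fromBlocks (1 : Matrix Unit Unit K) 0 0 A)ᵀ (bordered u v L)
  have h4 := rank_add_rank_le_card_add_rank_mul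
    ((fromBlocks (1 : Matrix Unit Unit K) 0 0 A)ᵀ * bordered u v L)
    (fromBlocks (1 : Matrix Unit Unit K) 0 0 A')
  have h5 : (fromBlocks (1 : Matrix Unit Unit K) 0 0 A)ᵀ * bordered u v L *
      fromBlocks (1 : Matrix Unit Unit K) 0 0 A' =
      vecMulVec (Sum.elim 0 p) (Sum.elim 0 q) + vecMulVec (Sum.elim 0 p') (Sum.elim 0 q') := by
    rw [fromBlocks_transpose, bordered, fromBlocks_multiply, fromBlocks_multiply]
    have e1 : replicateRow Unit v * A' = 0 := by
      rw [← replicateRow_vecMul, hv]; rfl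
    have e2 : Aᵀ * replicateCol Unit u = 0 := by
      rw [← replicateCol_mulVec, mulVec_transpose, hu]; rfl
    ext i j
    rcases i with i | i <;> rcases j with j | j <;>
      simp [vecMulVec_apply, e1, e2, hL]
  rw [h5] at h4
  have h6 := rank_add_le_rank_add_rank (vecMulVec (Sum.elim (0 : Unit → K) p) (Sum.elim (0 : Unit → K) q))
    (vecMulVec (Sum.elim (0 : Unit → K) p') (Sum.elim (0 : Unit → K) q'))
  have h7 := rank_vecMulVec_le (Sum.elim (0 : Unit → K) p) (Sum.elim (0 : Unit → K) q)
  have h8 := rank_vecMulVec_le (Sum.elim (0 : Unit → K) p') (Sum.elim (0 : Unit → K) q')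
  rw [rank_transpose] at h3
  simp only [Fintype.card_sum, Fintype.card_unit] at *
  omega

end Matrix

/-! ### The rank of the Levi form through the bordered matrix -/

namespace CRTransversal

open Matrix

/-- A vector `(t, x)` in the left kernel of the bordered matrix has `x` tangent and `L(x, ·) = -t
c̄`, which vanishes on tangent vectors; so `x` lies in the kernel of the Levi form, and it
determines `t` since `c ≠ 0`. The bordered matrix is preferred to the restricted form because its
rank can be compared at different points without moving the tangent space. -/
theorem restrictedRank_add_two_le {d : ℕ} (c : Fin d → ℂ) (hc : c ≠ 0)
    (L : Matrix (Fin d) (Fin d) ℂ) :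
    restrictedRank c L + 2 ≤ (bordered c (fun j => conj (c j)) L).rank := by
  set B := bordered c (fun j => conj (c j)) L
  have h1 := (leviMap c L).finrank_range_add_finrank_ker
  have h2 := Bᵀ.mulVecLin.finrank_range_add_finrank_ker
  rw [Module.finrank_fintype_fun_eq_card] at h2
  -- The gain of two comes from the dimensions: `d + 1` for the bordered matrix against `d - 1` for
  -- the tangent space.
  have h3 : Module.finrank ℂ (tangentOneZero c) + 1 = d := by
    let φ : (Fin d → ℂ) →ₗ[ℂ] ℂ := dotProductBilin ℂ ℂ c
    have hφ : LinearMap.ker φ = tangentOneZero c := by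
      ext v; rfl
    have h := φ.finrank_range_add_finrank_ker
    have hr : LinearMap.range φ = ⊤ := by
      apply LinearMap.range_eq_top.2
      apply LinearMap.surjective
      intro h0
      apply hc
      funext j
      have := congrArg (fun f => f (Pi.single j 1)) h0
      simpa [φ, dotProductBilin] using this
    rw [hr, hφ, finrank_top, Module.finrank_self, Module.finrank_fintype_fun_eq_card,
      Fintype.card_fin] at h
    omega
  have hker : ∀ x ∈ LinearMap.ker Bᵀ.mulVecLin, (∑ j, c j * x (Sum.inr j) = 0) ∧
      ∀ j, conj (c j) * x (Sum.inl ()) + ∑ i, L i j * x (Sum.inr i) = 0 := by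
    intro x hx
    rw [LinearMap.mem_ker, mulVecLin_apply] at hx
    constructor
    · have := congrFun hx (Sum.inl ())
      simpa [B, bordered, mulVec, dotProduct] using this
    · intro j
      have := congrFun hx (Sum.inr j)
      simpa [B, bordered, mulVec, dotProduct] using this
  have h4 : Module.finrank ℂ (LinearMap.ker Bᵀ.mulVecLin) ≤
      Module.finrank ℂ (LinearMap.ker (leviMap c L)) := by
    let f : LinearMap.ker Bᵀ.mulVecLin →ₗ[ℂ] LinearMap.ker (leviMap c L) :=
      { toFun := fun x => ⟨⟨fun j => x.1 (Sum.inr j), (hker x x.2).1⟩, by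
          rw [LinearMap.mem_ker]
          funext w
          change ∑ i, ∑ j, L i j * x.1 (Sum.inr i) * conj ((w : Fin d → ℂ) j) = 0
          rw [Finset.sum_comm]
          have e1 : ∀ j, ∑ i, L i j * x.1 (Sum.inr i) * conj ((w : Fin d → ℂ) j) =
              - x.1 (Sum.inl ()) * conj (c j * (w : Fin d → ℂ) j) := by
            intro j
            rw [← Finset.sum_mul, map_mul]
            linear_combination conj ((w : Fin d → ℂ) j) * (hker x x.2).2 j
          simp only [e1, ← Finset.mul_sum, ← map_sum]
          have : ∑ j, c j * (w : Fin d → ℂ) j = 0 := w.2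
          rw [this]; simp⟩
        map_add' := fun x y => rfl
        map_smul' := fun t x => rfl }
    refine LinearMap.finrank_le_finrank_of_injective (f := f) ?_
    rw [injective_iff_map_eq_zero]
    intro x hx
    have hx' : ∀ j, x.1 (Sum.inr j) = 0 := fun j =>
      congrFun (congrArg (fun y => (y.1.1 : Fin d → ℂ)) hx) j
    obtain ⟨j, hj⟩ := Function.ne_iff.1 hc
    have h0 := (hker x x.2).2 j
    simp only [hx', mul_zero, Finset.sum_const_zero, add_zero, mul_eq_zero] at h0
    ext i
    rcases i with i | i
    · exact h0.resolve_left (by simpa using hj)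
    · exact hx' i
  have h5 : Module.finrank ℂ (LinearMap.range Bᵀ.mulVecLin) = B.rank := rank_transpose B
  simp only [Fintype.card_sum, Fintype.card_unit, Fintype.card_fin] at h2
  unfold restrictedRank
  omega

end CRTransversal

/-! ## Formal vector fields and their invariant ideals -/

theorem Ideal.mem_sup_of_mem_sup_mul_left {R : Type*} [CommRing R] {I A B : Ideal R} {x : R}
    (h : x ∈ I ⊔ A * B) : x ∈ I ⊔ A :=
  (sup_le_sup_left Ideal.mul_le_left I : I ⊔ A * B ≤ I ⊔ A) h

theorem Ideal.mem_sup_of_mem_sup_mul_right {R : Type*} [CommRing R] {I A B : Ideal R} {x : R}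
    (h : x ∈ I ⊔ A * B) : x ∈ I ⊔ B :=
  (sup_le_sup_left Ideal.mul_le_right I : I ⊔ A * B ≤ I ⊔ B) h

namespace MvPowerSeries

open IsLocalRing

theorem constantCoeff_pderiv {τ K : Type*} [Field K] (i : τ) (f : MvPowerSeries τ K) :
    constantCoeff (pderiv K i f) = coeff (Finsupp.single i 1) f := by
  rw [← coeff_zero_eq_constantCoeff_apply, coeff_pderiv]
  simp

section Euler

variable {τ K : Type*} [Fintype τ] [Field K]

theorem sub_sum_coeff_mul_X_mem_sq {f : MvPowerSeries τ K} (hf : constantCoeff f = 0) :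
    f - ∑ i, C (coeff (Finsupp.single i 1) f) * X i ∈
      maximalIdeal (MvPowerSeries τ K) ^ 2 := by
  classical
  have hf' : f ∈ Ideal.span (Set.range (X : τ → MvPowerSeries τ K)) := by
    rw [← maximalIdeal_eq_span_X]
    exact mem_maximalIdeal_iff.2 hf
  clear hf
  induction hf' using Submodule.span_induction with
  | mem x hx =>
    obtain ⟨j, rfl⟩ := hx
    rw [Finset.sum_eq_single j]
    · simp
    · intro i _ hij
      rw [coeff_X, if_neg (by simpa [Finsupp.single_left_inj] using hij)]
      simp
    · simp
  | zero => simp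
  | add x y _ _ hx hy =>
    have := add_mem hx hy
    convert this using 1
    simp only [map_add, add_mul, Finset.sum_add_distrib]
    ring
  | smul s x hx ih =>
    have hx0 : constantCoeff x = 0 := by
      refine mem_maximalIdeal_iff.1 ?_
      rw [maximalIdeal_eq_span_X]
      exact hx
    have h1 : ∀ i, coeff (Finsupp.single i 1) (s • x) =
        constantCoeff s * coeff (Finsupp.single i 1) x := by
      intro i
      simp only [← constantCoeff_pderiv, smul_eq_mul, Derivation.leibniz, map_add, map_mul, hx0]
      ring
    have h2 : s - C (constantCoeff s) ∈ maximalIdeal (MvPowerSeries τ K) :=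
      mem_maximalIdeal_iff.2 (by simp)
    have h3 : x ∈ maximalIdeal (MvPowerSeries τ K) := mem_maximalIdeal_iff.2 hx0
    have h4 := add_mem (Ideal.mul_mem_left _ (C (constantCoeff s)) ih)
      (by rw [pow_two]; exact Ideal.mul_mem_mul h2 h3 :
        (s - C (constantCoeff s)) * x ∈ maximalIdeal (MvPowerSeries τ K) ^ 2)
    convert h4 using 1
    simp only [h1, map_mul, mul_sub, Finset.mul_sum, mul_assoc]
    rw [smul_eq_mul]
    ring

/-- The derivation `∑ Vᵢ ∂ᵢ`. -/
noncomputable def vectorField (V : τ → MvPowerSeries τ K) :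
    Derivation K (MvPowerSeries τ K) (MvPowerSeries τ K) :=
  ∑ i, V i • pderiv K i

theorem vectorField_apply (V : τ → MvPowerSeries τ K) (f : MvPowerSeries τ K) :
    vectorField V f = ∑ i, V i * pderiv K i f := by
  rw [vectorField, ← Derivation.coeFnAddMonoidHom_apply, map_sum, Finset.sum_apply]
  rfl

theorem vectorField_X (V : τ → MvPowerSeries τ K) (j : τ) : vectorField V (X j) = V j := by
  classical
  simp [vectorField_apply, pderiv_X, Pi.single_apply]

/-- Krull's intersection theorem in the Noetherian local ring `MvPowerSeries τ K ⧸ I`. -/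
theorem iInf_maximalIdeal_pow_sup (I : Ideal (MvPowerSeries τ K)) (hI : I ≠ ⊤)
    {f : MvPowerSeries τ K} (hf : ∀ k, f ∈ maximalIdeal (MvPowerSeries τ K) ^ k ⊔ I) : f ∈ I := by
  have : Nontrivial (MvPowerSeries τ K ⧸ I) := Ideal.Quotient.nontrivial_iff.2 hI
  have : IsLocalRing (MvPowerSeries τ K ⧸ I) :=
    .of_surjective' (Ideal.Quotient.mk I) Ideal.Quotient.mk_surjective
  have h1 := Ideal.iInf_pow_eq_bot_of_isLocalRing
    ((maximalIdeal (MvPowerSeries τ K)).map (Ideal.Quotient.mk I))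
    (by
      intro h
      have hloc : IsLocalHom (Ideal.Quotient.mk I) :=
        .of_surjective _ Ideal.Quotient.mk_surjective
      have : (maximalIdeal (MvPowerSeries τ K)).map (Ideal.Quotient.mk I) ≤
          maximalIdeal (MvPowerSeries τ K ⧸ I) :=
        Ideal.map_le_iff_le_comap.2 fun x hx hu => hx (isUnit_of_map_unit _ x hu)
      rw [h, top_le_iff] at this
      exact (maximalIdeal.isMaximal _).ne_top this)
  rw [← Ideal.Quotient.eq_zero_iff_mem, ← Ideal.mem_bot, ← h1, Ideal.mem_iInf]
  intro k
  rw [← Ideal.map_pow]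
  have := Ideal.mem_map_of_mem (Ideal.Quotient.mk I) (hf k)
  rwa [Ideal.map_sup, Ideal.map_quotient_self, sup_bot_eq] at this

variable [CharZero K]

/-- A set of series vanishing at the origin which is mapped into higher order by a derivation that
is modulo `ρ` of Euler type consists of multiples of `ρ`. -/
theorem mem_span_of_euler (E : Derivation K (MvPowerSeries τ K) (MvPowerSeries τ K))
    {ρ : MvPowerSeries τ K} (hρ : constantCoeff ρ = 0) (hEρ : E ρ ∈ Ideal.span {ρ})
    (hE : ∀ y ∈ maximalIdeal (MvPowerSeries τ K),
      E y - y ∈ maximalIdeal (MvPowerSeries τ K) ^ 2 ⊔ Ideal.span {ρ})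
    (I : Set (MvPowerSeries τ K)) (hI : ∀ f ∈ I, constantCoeff f = 0)
    (hEI : ∀ k, (∀ f ∈ I, f ∈ maximalIdeal (MvPowerSeries τ K) ^ k ⊔ Ideal.span {ρ}) →
      ∀ f ∈ I, E f ∈ maximalIdeal (MvPowerSeries τ K) ^ (k + 1) ⊔ Ideal.span {ρ})
    {f : MvPowerSeries τ K} (hf : f ∈ I) : f ∈ Ideal.span {ρ} := by
  set 𝔪 := maximalIdeal (MvPowerSeries τ K)
  -- By the Leibniz rule `E` acts on `𝔪 ^ (k + 1)`, modulo higher order and `ρ`, as multiplication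
  -- by the degree, just like the Euler field.
  have euler : ∀ k : ℕ, ∀ f ∈ 𝔪 ^ (k + 1), E f - ((k + 1 : ℕ) : MvPowerSeries τ K) * f ∈
      𝔪 ^ (k + 2) ⊔ Ideal.span {ρ} := by
    intro k
    induction k with
    | zero =>
      intro f hf
      simpa using hE f (by simpa using hf)
    | succ k ih =>
      intro f hf
      rw [pow_succ] at hf
      induction hf using Submodule.mul_induction_on' with
      | mem_mul_mem a ha b hb =>
        have h1 : (E a - ((k + 1 : ℕ) : MvPowerSeries τ K) * a) * b ∈
            𝔪 ^ (k + 3) ⊔ Ideal.span {ρ} := by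
          have := Ideal.mul_mem_mul (ih a ha) hb
          rw [Ideal.sup_mul, ← pow_succ] at this
          exact Ideal.mem_sup_of_mem_sup_mul_left this
        have h2 : a * (E b - b) ∈ 𝔪 ^ (k + 3) ⊔ Ideal.span {ρ} := by
          have := Ideal.mul_mem_mul ha (hE b hb)
          rw [Ideal.mul_sup, ← pow_add] at this
          exact Ideal.mem_sup_of_mem_sup_mul_right this
        have := add_mem h1 h2
        convert this using 1
        rw [Derivation.leibniz]
        simp only [smul_eq_mul]
        push_cast
        ring
      | add x _ y _ hx hy =>
        have := add_mem hx hy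
        convert this using 1
        rw [map_add]
        ring
  -- Modulo `ρ`, an element of order `k + 1` is multiplied by `k + 1` under `E`, while by assumption
  -- its image has order `k + 2`. Characteristic zero allows dividing by `k + 1`, so the order of
  -- the element itself goes up.
  have main : ∀ k : ℕ, ∀ f ∈ I, f ∈ 𝔪 ^ (k + 1) ⊔ Ideal.span {ρ} := by
    intro k
    induction k with
    | zero =>
      intro f hf
      exact Ideal.mem_sup_left (by rw [zero_add, pow_one]; exact mem_maximalIdeal_iff.2 (hI f hf))
    | succ k ih =>
      intro f hf
      have h1 := hEI (k + 1) ih f hf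
      obtain ⟨h, hh, c, hc, rfl⟩ := Submodule.mem_sup.1 (ih f hf)
      have h2 : E c ∈ Ideal.span {ρ} := by
        obtain ⟨b, rfl⟩ := Ideal.mem_span_singleton'.1 hc
        rw [Derivation.leibniz, smul_eq_mul, smul_eq_mul]
        exact add_mem (Ideal.mul_mem_left _ _ hEρ)
          (Ideal.mul_mem_right _ _ (Ideal.mem_span_singleton_self ρ))
      have h3 := euler k h hh
      have h4 : ((k + 1 : ℕ) : MvPowerSeries τ K) * h ∈ 𝔪 ^ (k + 2) ⊔ Ideal.span {ρ} := by
        have := sub_mem (sub_mem h1 (Ideal.mem_sup_right h2)) h3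
        convert this using 1
        rw [map_add]
        ring
      have h5 : h ∈ 𝔪 ^ (k + 2) ⊔ Ideal.span {ρ} := by
        have := Ideal.mul_mem_left _ (C (((k + 1 : ℕ) : K)⁻¹)) h4
        rwa [← mul_assoc, ← map_natCast (C : K →+* MvPowerSeries τ K), ← map_mul,
          inv_mul_cancel₀ (Nat.cast_ne_zero.2 (Nat.succ_ne_zero k)), map_one, one_mul] at this
      exact add_mem h5 (Ideal.mem_sup_right hc)
  have hne : Ideal.span {ρ} ≠ ⊤ := by
    rw [Ne, Ideal.span_singleton_eq_top, isUnit_iff_constantCoeff, hρ]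
    exact not_isUnit_zero
  refine iInf_maximalIdeal_pow_sup _ hne fun k => ?_
  rcases k with _ | k
  · simp
  · exact main k f hf

/-- Vector fields tangent to `ρ = 0` whose values at the origin are the projections of the
coordinate fields span enough to detect divisibility by `ρ`. -/
theorem mem_span_of_vectorFields [DecidableEq τ] {ρ : MvPowerSeries τ K}
    (hρ : constantCoeff ρ = 0) {i₀ : τ}
    (V : τ → τ → MvPowerSeries τ K)
    (hV : ∀ i j, constantCoeff (V i j) = (if i = j then 1 else 0) -
      if j = i₀ then coeff (Finsupp.single i 1) ρ / coeff (Finsupp.single i₀ 1) ρ else 0)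
    (hVρ : ∀ i, vectorField (V i) ρ ∈ Ideal.span {ρ})
    (I : Set (MvPowerSeries τ K)) (hI : ∀ f ∈ I, constantCoeff f = 0)
    (hVI : ∀ i, ∀ f ∈ I, vectorField (V i) f ∈ I)
    {f : MvPowerSeries τ K} (hf : f ∈ I) : f ∈ Ideal.span {ρ} := by
  -- The Euler field built from the given fields instead of the coordinate fields. The field `V i`
  -- has at the origin the value of `∂ᵢ` projected along `∂_{i₀}` to the tangent space.
  let E : Derivation K (MvPowerSeries τ K) (MvPowerSeries τ K) :=
    ∑ i, (X i : MvPowerSeries τ K) • vectorField (V i)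
  have hEapp : ∀ f, E f = ∑ i, X i * vectorField (V i) f := by
    intro f
    rw [← Derivation.coeFnAddMonoidHom_apply, map_sum, Finset.sum_apply]
    rfl
  have hX : ∀ i : τ, (X i : MvPowerSeries τ K) ∈ maximalIdeal (MvPowerSeries τ K) := fun i =>
    mem_maximalIdeal_iff.2 (by simp)
  have hEmem : ∀ f, E f ∈ maximalIdeal (MvPowerSeries τ K) := by
    intro f
    rw [hEapp]
    exact Ideal.sum_mem _ fun i _ => Ideal.mul_mem_right _ _ (hX i)
  refine mem_span_of_euler E hρ ?_ ?_ I hI ?_ hf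
  · rw [hEapp]
    exact Ideal.sum_mem _ fun i _ => Ideal.mul_mem_left _ _ (hVρ i)
  · intro y hy
    rw [maximalIdeal_eq_span_X] at hy
    induction hy using Submodule.span_induction with
    | mem x hx =>
      obtain ⟨j, rfl⟩ := hx
      -- The projection disturbs only the coordinate `i₀`: there `E (X i₀) - X i₀` is, modulo order
      -- two, `-t` times the linear part of `ρ`, hence `-t ρ`.
      set t := (if j = i₀ then (coeff (Finsupp.single i₀ 1) ρ)⁻¹ else 0) with ht
      have h1 : ∑ i, X i * (V i j - C (constantCoeff (V i j))) ∈
          maximalIdeal (MvPowerSeries τ K) ^ 2 := by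
        refine Ideal.sum_mem _ fun i _ => ?_
        rw [pow_two]
        exact Ideal.mul_mem_mul (hX i) (mem_maximalIdeal_iff.2 (by simp))
      have h2 := Ideal.mul_mem_left _ (C t) (sub_sum_coeff_mul_X_mem_sq hρ)
      have h3 := Ideal.mul_mem_left _ (C t) (Ideal.mem_span_singleton_self ρ)
      have h4 := sub_mem (Ideal.mem_sup_left (T := Ideal.span {ρ}) (add_mem h1 h2))
        (Ideal.mem_sup_right (S := maximalIdeal (MvPowerSeries τ K) ^ 2) h3)
      convert h4 using 1
      have h5 : ∑ i, X i * C (constantCoeff (V i j)) =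
          X j - C t * ∑ i, C (coeff (Finsupp.single i 1) ρ) * X i := by
        have : ∀ i, X i * C (constantCoeff (V i j)) =
            (if i = j then (X j : MvPowerSeries τ K) else 0) -
              C t * (C (coeff (Finsupp.single i 1) ρ) * X i) := by
          intro i
          rw [hV, ht, map_sub, mul_sub]
          congr 1
          · split_ifs with h
            · rw [h, map_one, mul_one]
            · simp
          · split_ifs with h
            · rw [div_eq_mul_inv, map_mul]; ring
            · simp
        rw [Finset.sum_congr rfl fun i _ => this i, Finset.sum_sub_distrib, Finset.mul_sum]
        simp
      simp only [hEapp, vectorField_X, mul_sub, Finset.sum_sub_distrib] at h5 ⊢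
      rw [h5]
      ring
    | zero => simp
    | add x y _ _ hx hy =>
      have := add_mem hx hy
      convert this using 1
      rw [map_add]
      ring
    | smul s x hx ih =>
      replace hx : x ∈ maximalIdeal (MvPowerSeries τ K) := by
        rw [maximalIdeal_eq_span_X]
        exact hx
      have h1 := add_mem (Ideal.mul_mem_left _ s ih) (Ideal.mem_sup_left (T := Ideal.span {ρ})
        (by rw [pow_two]; exact Ideal.mul_mem_mul hx (hEmem s) :
          x * E s ∈ maximalIdeal (MvPowerSeries τ K) ^ 2))
      convert h1 using 1
      rw [smul_eq_mul, Derivation.leibniz, smul_eq_mul, smul_eq_mul]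
      ring
  · intro k hk f hf
    rw [hEapp]
    refine Ideal.sum_mem _ fun i _ => ?_
    have := Ideal.mul_mem_mul (hX i) (hk _ (hVI i f hf))
    rw [Ideal.mul_sup, ← pow_succ'] at this
    exact Ideal.mem_sup_of_mem_sup_mul_right this

end Euler

theorem pderiv_rename_of_notMem {σ τ K : Type*} [Finite σ] [Field K] {e : σ → τ} {i : τ}
    (hi : i ∉ Set.range e) (f : MvPowerSeries σ K) : pderiv K i (rename e f) = 0 := by
  ext α
  rw [coeff_pderiv, coeff_rename_eq_zero, zero_mul, map_zero]
  rintro ⟨β, hβ⟩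
  have := congrArg (fun γ => γ i) hβ
  simp only [Finsupp.add_apply, Finsupp.single_eq_same] at this
  rw [Finsupp.mapDomain_of_notMem_range _ _ hi] at this
  omega

theorem pderiv_comm {τ K : Type*} [Field K] (i j : τ) (f : MvPowerSeries τ K) :
    pderiv K i (pderiv K j f) = pderiv K j (pderiv K i f) := by
  classical
  ext α
  simp only [coeff_pderiv]
  rw [add_right_comm]
  by_cases h : i = j
  · subst h; rfl
  · simp only [Finsupp.add_apply, Finsupp.single_apply, if_neg h, if_neg (Ne.symm h), add_zero]
    ring

end MvPowerSeries

/-! ### Ideals stable under the CR Lie algebra -/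

namespace CRTransversal

open MvPowerSeries IsLocalRing

/-- Second order terms of the two compositions agree by symmetry of mixed derivatives and cancel in
the commutator. -/
theorem vectorField_formalBracket {d : ℕ}
    (X Y : Fin d ⊕ Fin d → MvPowerSeries (Fin d ⊕ Fin d) ℂ) (f : MvPowerSeries (Fin d ⊕ Fin d) ℂ) :
    vectorField (formalBracket X Y) f =
      vectorField X (vectorField Y f) - vectorField Y (vectorField X f) := by
  have key : ∀ X Y : Fin d ⊕ Fin d → MvPowerSeries (Fin d ⊕ Fin d) ℂ,
      vectorField X (vectorField Y f) = ∑ k, ∑ i, X i * pderiv ℂ i (Y k) * pderiv ℂ k f +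
        ∑ k, ∑ i, X i * Y k * pderiv ℂ i (pderiv ℂ k f) := by
    intro X Y
    rw [vectorField_apply, vectorField_apply, ← Finset.sum_add_distrib]
    simp only [← Finset.sum_add_distrib]
    rw [Finset.sum_comm]
    refine Finset.sum_congr rfl fun i _ => ?_
    rw [map_sum, Finset.mul_sum]
    refine Finset.sum_congr rfl fun k _ => ?_
    rw [Derivation.leibniz, smul_eq_mul, smul_eq_mul]
    ring
  have h2 : ∑ k, ∑ i, X i * Y k * pderiv ℂ i (pderiv ℂ k f) =
      ∑ k, ∑ i, Y i * X k * pderiv ℂ i (pderiv ℂ k f) := by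
    rw [Finset.sum_comm]
    refine Finset.sum_congr rfl fun i _ => Finset.sum_congr rfl fun k _ => ?_
    rw [pderiv_comm, mul_comm (X i)]
  rw [key, key, h2, add_sub_add_right_eq_sub, vectorField_apply, ← Finset.sum_sub_distrib]
  refine Finset.sum_congr rfl fun k _ => ?_
  rw [formalBracket, Finset.sum_mul, ← Finset.sum_sub_distrib]
  refine Finset.sum_congr rfl fun i _ => ?_
  rw [sub_mul]

/-- An ideal which contains `ρ` and is, modulo `ρ`, generated both by a series in `Z` and by a
series in `ξ` is stable under the Lie algebra generated by the CR vector fields. -/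
theorem vectorField_mem_of_formalCRLieAlgebra {d : ℕ} {ρ : MvPowerSeries (Fin d ⊕ Fin d) ℂ}
    {J : Ideal (MvPowerSeries (Fin d ⊕ Fin d) ℂ)} {a b : MvPowerSeries (Fin d) ℂ}
    (ha : J = Ideal.span {ρ, rename Sum.inl a}) (hb : J = Ideal.span {ρ, rename Sum.inr b})
    {X : Fin d ⊕ Fin d → MvPowerSeries (Fin d ⊕ Fin d) ℂ} (hX : FormalCRLieAlgebra ρ X) :
    ∀ f ∈ J, vectorField X f ∈ J := by
  have key : ∀ (D : Derivation ℂ (MvPowerSeries (Fin d ⊕ Fin d) ℂ)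
      (MvPowerSeries (Fin d ⊕ Fin d) ℂ)) (g : MvPowerSeries (Fin d ⊕ Fin d) ℂ),
      J = Ideal.span {ρ, g} → ρ ∣ D ρ → ρ ∣ D g → ∀ f ∈ J, D f ∈ J := by
    intro D g hJ hρ hg f hf
    have hρJ : ρ ∈ J := hJ ▸ Ideal.subset_span (by simp)
    have hgJ : g ∈ J := hJ ▸ Ideal.subset_span (by simp)
    rw [hJ] at hf
    obtain ⟨u, v, rfl⟩ := Ideal.mem_span_pair.1 hf
    simp only [map_add, Derivation.leibniz, smul_eq_mul]
    exact add_mem (add_mem (J.mul_mem_left _ (J.mem_of_dvd hρ hρJ)) (J.mul_mem_right _ hρJ))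
      (add_mem (J.mul_mem_left _ (J.mem_of_dvd hg hρJ)) (J.mul_mem_right _ hgJ))
  induction hX with
  | cr X tangent type =>
    -- A CR field has components in the `Z` directions divisible by `ρ`, so it maps a series in `Z`
    -- into `(ρ)`; for a conjugate field the generator in `ξ` is used instead.
    refine key _ _ ha (by rwa [vectorField_apply]) ?_
    rw [vectorField_apply, Fintype.sum_sum_type]
    refine dvd_add (Finset.dvd_sum fun j _ => (type j).mul_right _) (Finset.dvd_sum fun j _ => ?_)
    rw [pderiv_rename_of_notMem (by simp), mul_zero]
    exact dvd_zero _
  | conjCR X tangent type =>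
    refine key _ _ hb (by rwa [vectorField_apply]) ?_
    rw [vectorField_apply, Fintype.sum_sum_type]
    refine dvd_add (Finset.dvd_sum fun j _ => ?_) (Finset.dvd_sum fun j _ => (type j).mul_right _)
    rw [pderiv_rename_of_notMem (by simp), mul_zero]
    exact dvd_zero _
  | add X Y _ _ hX hY =>
    intro f hf
    have : vectorField (X + Y) f = vectorField X f + vectorField Y f := by
      simp [vectorField_apply, add_mul, Finset.sum_add_distrib]
    rw [this]
    exact add_mem (hX f hf) (hY f hf)
  | smul c X _ hX =>
    intro f hf
    have : vectorField (c • X) f = C c * vectorField X f := by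
      simp only [vectorField_apply, smul_eq_C_mul, Pi.smul_apply, mul_assoc, Finset.mul_sum]
    rw [this]
    exact J.mul_mem_left _ (hX f hf)
  | lie X Y _ _ hX hY =>
    intro f hf
    rw [vectorField_formalBracket]
    exact sub_mem (hX _ (hY f hf)) (hY _ (hX f hf))

/-- On a hypersurface of finite type, no proper ideal is invariant. -/
theorem le_span_of_invariant {d : ℕ} {ρ : MvPowerSeries (Fin d ⊕ Fin d) ℂ}
    (hρ : constantCoeff ρ = 0) {i₀ : Fin d ⊕ Fin d} (hi₀ : formalGradient ρ i₀ ≠ 0)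
    (hft : ∀ v ∈ complexTangent (formalGradient ρ), ∃ X, FormalCRLieAlgebra ρ X ∧
      (fun i => constantCoeff (X i)) = v)
    {J : Ideal (MvPowerSeries (Fin d ⊕ Fin d) ℂ)} {a b : MvPowerSeries (Fin d) ℂ}
    (ha : J = Ideal.span {ρ, rename Sum.inl a}) (hb : J = Ideal.span {ρ, rename Sum.inr b})
    (hJ : J ≠ ⊤) : J ≤ Ideal.span {ρ} := by
  have hg : ∀ i, formalGradient ρ i = coeff (Finsupp.single i 1) ρ := fun i =>
    constantCoeff_pderiv i ρ
  -- The projections of the coordinate fields to the tangent space along `∂_{i₀}`, as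
  -- `mem_span_of_vectorFields` requires them; finite type realizes each as the value of a field in
  -- the Lie algebra.
  have hv : ∀ i, (fun j => (if i = j then 1 else 0) -
      if j = i₀ then coeff (Finsupp.single i 1) ρ / coeff (Finsupp.single i₀ 1) ρ else 0) ∈
      complexTangent (formalGradient ρ) := by
    intro i
    change ∑ j, _ = 0
    rw [hg] at hi₀
    simp only [hg, mul_sub, Finset.sum_sub_distrib, mul_ite, mul_one, mul_zero,
      Finset.sum_ite_eq, Finset.sum_ite_eq', Finset.mem_univ, if_true]
    field_simp
    ring
  choose V hV hV0 using fun i => hft _ (hv i)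
  have hinv := fun {X} hX => vectorField_mem_of_formalCRLieAlgebra ha hb (X := X) hX
  -- The case `J = (ρ)` of the stability statement, with both extra generators zero, shows that all
  -- fields of the algebra are tangent to `ρ = 0`.
  have hT : ∀ X, FormalCRLieAlgebra ρ X → vectorField X ρ ∈ Ideal.span {ρ} := fun X hX =>
    vectorField_mem_of_formalCRLieAlgebra (a := 0) (b := 0) (by simp [Ideal.span_insert])
      (by simp [Ideal.span_insert]) hX ρ (Ideal.mem_span_singleton_self ρ)
  intro f hf
  refine mem_span_of_vectorFields hρ V (fun i j => congrFun (hV0 i) j)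
    (fun i => hT _ (hV i)) (J : Set _) ?_ (fun i => hinv (hV i)) hf
  intro f hf
  exact mem_maximalIdeal_iff.1 (le_maximalIdeal hJ hf)

end CRTransversal

/-! ## The chain rule for formal power series -/

namespace MvPowerSeries

open IsLocalRing

variable {σ τ K : Type*} [Field K]

theorem eq_zero_of_mem_maximalIdeal_pow [Fintype τ] {f : MvPowerSeries τ K}
    (hf : ∀ k, f ∈ maximalIdeal (MvPowerSeries τ K) ^ k) : f = 0 := by
  have := iInf_maximalIdeal_pow_sup (⊥ : Ideal (MvPowerSeries τ K)) bot_ne_top (f := f)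
    fun k => Ideal.mem_sup_left (hf k)
  simpa using this

/-- An additive map that vanishes on constants and raises the order vanishes. -/
theorem eq_zero_of_raises_order [Fintype σ] [Fintype τ] (Δ : MvPowerSeries σ K →+ MvPowerSeries τ K)
    (hC : ∀ c, Δ (C c) = 0)
    (hX : ∀ i f, ∃ b ∈ maximalIdeal (MvPowerSeries τ K), Δ (f * X i) = b * Δ f)
    (f : MvPowerSeries σ K) : Δ f = 0 := by
  refine eq_zero_of_mem_maximalIdeal_pow fun k => ?_
  induction k generalizing f with
  | zero => simp
  | succ k ih =>
    have h1 : ∀ g ∈ maximalIdeal (MvPowerSeries σ K),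
        Δ g ∈ maximalIdeal (MvPowerSeries τ K) ^ (k + 1) := by
      intro g hg
      rw [maximalIdeal_eq_span_X, Ideal.mem_span_range_iff_exists_fun] at hg
      obtain ⟨c, rfl⟩ := hg
      rw [map_sum]
      refine Ideal.sum_mem _ fun i _ => ?_
      obtain ⟨b, hb, h⟩ := hX i (c i)
      rw [h, pow_succ']
      exact Ideal.mul_mem_mul hb (ih _)
    have h2 : Δ f = Δ (f - C (constantCoeff f)) := by rw [map_sub, hC, sub_zero]
    rw [h2]
    exact h1 _ (mem_maximalIdeal_iff.2 (by simp))

theorem constantCoeff_subst_of_constantCoeff_eq_zero [Finite σ] {a : σ → MvPowerSeries τ K}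
    (ha : ∀ i, constantCoeff (a i) = 0) (f : MvPowerSeries σ K) :
    constantCoeff (subst a f) = constantCoeff f := by
  have hs := hasSubst_of_constantCoeff_zero ha
  have h1 := constantCoeff_subst_eq_zero hs ha (f := f - C (constantCoeff f)) (by simp)
  rw [subst_sub hs, map_sub, subst_C] at h1
  simpa [sub_eq_zero] using h1

/-- The difference `Δ` of the two sides is additive, vanishes on constants and satisfies `Δ (g * X
l) = a l * Δ g` by the Leibniz rule; since `a l` has no constant term, `Δ` raises orders
indefinitely and vanishes. -/
theorem pderiv_subst [Fintype σ] [Fintype τ] {a : σ → MvPowerSeries τ K}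
    (ha : ∀ i, constantCoeff (a i) = 0) (j : τ) (f : MvPowerSeries σ K) :
    pderiv K j (subst a f) = ∑ i, subst a (pderiv K i f) * pderiv K j (a i) := by
  classical
  have hs := hasSubst_of_constantCoeff_zero ha
  set φ : MvPowerSeries σ K →ₐ[K] MvPowerSeries τ K := substAlgHom hs with hφ
  have hφX : ∀ i, φ (X i) = a i := substAlgHom_X hs
  have hφC : ∀ c, φ (C c) = C c := fun c => by rw [hφ, substAlgHom_apply, subst_C]
  have hφe : ∀ g, subst a g = φ g := fun g => by rw [hφ, substAlgHom_apply]
  simp only [hφe]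
  clear_value φ
  let Δ : MvPowerSeries σ K →+ MvPowerSeries τ K :=
    { toFun := fun g => pderiv K j (φ g) - ∑ i, φ (pderiv K i g) * pderiv K j (a i)
      map_zero' := by simp
      map_add' := fun g h => by
        simp only [map_add, add_mul, Finset.sum_add_distrib]; ring }
  refine sub_eq_zero.1 (eq_zero_of_raises_order Δ (fun c => ?_) (fun l g => ?_) f)
  · change pderiv K j (φ (C c)) - ∑ i, φ (pderiv K i (C c)) * pderiv K j (a i) = 0
    simp [hφC]
  · refine ⟨a l, mem_maximalIdeal_iff.2 (ha l), ?_⟩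
    change pderiv K j (φ (g * X l)) - ∑ i, φ (pderiv K i (g * X l)) * pderiv K j (a i) =
      a l * (pderiv K j (φ g) - ∑ i, φ (pderiv K i g) * pderiv K j (a i))
    have h1 : ∀ i, φ (pderiv K i (g * X l)) * pderiv K j (a i) =
        (if i = l then φ g * pderiv K j (a l) else 0) +
          a l * (φ (pderiv K i g) * pderiv K j (a i)) := by
      intro i
      rw [Derivation.leibniz, pderiv_X, smul_eq_mul, smul_eq_mul, map_add, map_mul, map_mul, hφX]
      by_cases h : i = l
      · subst h; simp; ring
      · rw [if_neg h, Pi.single_eq_of_ne (Ne.symm h)]; simp; ring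
    rw [Finset.sum_congr rfl fun i _ => h1 i, Finset.sum_add_distrib, ← Finset.mul_sum,
      Finset.sum_ite_eq' Finset.univ l, if_pos (Finset.mem_univ _), map_mul, hφX,
      Derivation.leibniz, smul_eq_mul, smul_eq_mul]
    ring

theorem pderiv_rename [Finite σ] (e : σ ↪ τ) (i : σ) (f : MvPowerSeries σ K) :
    pderiv K (e i) (rename e f) = rename e (pderiv K i f) := by
  classical
  ext α
  by_cases hα : α ∈ Set.range (Finsupp.mapDomain e)
  · obtain ⟨β, rfl⟩ := hα
    rw [← Finsupp.embDomain_eq_mapDomain, coeff_embDomain_rename, coeff_pderiv, coeff_pderiv]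
    have : Finsupp.embDomain e β + Finsupp.single (e i) 1 =
        Finsupp.embDomain e (β + Finsupp.single i 1) := by
      rw [Finsupp.embDomain_add, Finsupp.embDomain_single]
    rw [this, coeff_embDomain_rename, Finsupp.embDomain_apply_self]
  · rw [coeff_rename_eq_zero (f := (e : σ → τ)) (pderiv K i f) hα, coeff_pderiv,
      coeff_rename_eq_zero (f := (e : σ → τ)) f, zero_mul]
    rintro ⟨β, hβ⟩
    apply hα
    have hle : Finsupp.single i 1 ≤ β := by
      rw [Finsupp.single_le_iff]
      have := DFunLike.congr_fun hβ (e i)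
      rw [Finsupp.mapDomain_apply e.injective] at this
      rw [this]; simp
    refine ⟨β - Finsupp.single i 1, ?_⟩
    have h2 : Finsupp.mapDomain e (β - Finsupp.single i 1) + Finsupp.single (e i) 1 =
        α + Finsupp.single (e i) 1 := by
      rw [← hβ, ← Finsupp.mapDomain_single (f := e), ← Finsupp.mapDomain_add,
        tsub_add_cancel_of_le hle]
    exact add_right_cancel h2

theorem pderiv_map {L : Type*} [Field L] (φ : K →+* L) (i : σ) (f : MvPowerSeries σ K) :
    pderiv L i (map φ f) = map φ (pderiv K i f) := by
  ext α
  simp [coeff_pderiv]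

end MvPowerSeries

/-! ## The formal transversality theorem -/

namespace CRTransversal

open MvPowerSeries

/-- Holomorphic series as series in `(Z, ξ)`. -/
noncomputable def holo (d : ℕ) : MvPowerSeries (Fin d) ℂ →+* MvPowerSeries (Fin d ⊕ Fin d) ℂ :=
  (rename (Sum.inl : Fin d → Fin d ⊕ Fin d) :
    MvPowerSeries (Fin d) ℂ →ₐ[ℂ] MvPowerSeries (Fin d ⊕ Fin d) ℂ).toRingHom

/-- The conjugate series in the variables `ξ`. -/
noncomputable def antiholo (d : ℕ) :
    MvPowerSeries (Fin d) ℂ →+* MvPowerSeries (Fin d ⊕ Fin d) ℂ :=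
  (rename (Sum.inr : Fin d → Fin d ⊕ Fin d) :
    MvPowerSeries (Fin d) ℂ →ₐ[ℂ] MvPowerSeries (Fin d ⊕ Fin d) ℂ).toRingHom.comp
      (map (starRingEnd ℂ))

section

variable {d e : ℕ}

theorem holo_apply (f : MvPowerSeries (Fin d) ℂ) : holo d f = rename Sum.inl f := rfl

theorem antiholo_apply (f : MvPowerSeries (Fin d) ℂ) :
    antiholo d f = rename Sum.inr (map (starRingEnd ℂ) f) := rfl

theorem pderiv_inl_holo (j : Fin d) (f : MvPowerSeries (Fin d) ℂ) :
    pderiv ℂ (Sum.inl j) (holo d f) = holo d (pderiv ℂ j f) :=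
  pderiv_rename Function.Embedding.inl j f

theorem pderiv_inr_holo (j : Fin d) (f : MvPowerSeries (Fin d) ℂ) :
    pderiv ℂ (Sum.inr j) (holo d f) = 0 :=
  pderiv_rename_of_notMem (e := Function.Embedding.inl) (by rintro ⟨i, hi⟩; cases hi) f

theorem pderiv_inr_antiholo (j : Fin d) (f : MvPowerSeries (Fin d) ℂ) :
    pderiv ℂ (Sum.inr j) (antiholo d f) = antiholo d (pderiv ℂ j f) := by
  rw [antiholo_apply, antiholo_apply, ← pderiv_map]
  exact pderiv_rename Function.Embedding.inr j _

theorem pderiv_inl_antiholo (j : Fin d) (f : MvPowerSeries (Fin d) ℂ) :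
    pderiv ℂ (Sum.inl j) (antiholo d f) = 0 :=
  pderiv_rename_of_notMem (e := Function.Embedding.inr) (by rintro ⟨i, hi⟩; cases hi) _

variable {H : Fin e → MvPowerSeries (Fin d) ℂ}

theorem complexification_inl (i : Fin e) : complexification H (Sum.inl i) = holo d (H i) := rfl

theorem complexification_inr (i : Fin e) : complexification H (Sum.inr i) = antiholo d (H i) := rfl

theorem constantCoeff_complexification (hH : ∀ i, constantCoeff (H i) = 0) (i : Fin e ⊕ Fin e) :
    constantCoeff (complexification H i) = 0 := by
  rcases i with i | i
  · rw [complexification_inl, holo_apply, constantCoeff_rename, hH]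
  · rw [complexification_inr, antiholo_apply, constantCoeff_rename]
    simp [hH]

theorem pderiv_inl_subst_complexification (hH : ∀ i, constantCoeff (H i) = 0) (j : Fin d)
    (f : MvPowerSeries (Fin e ⊕ Fin e) ℂ) :
    pderiv ℂ (Sum.inl j) (subst (complexification H) f) =
      ∑ i, subst (complexification H) (pderiv ℂ (Sum.inl i) f) *
        holo d (formalJacobian H i j) := by
  rw [pderiv_subst (constantCoeff_complexification hH), Fintype.sum_sum_type]
  simp [complexification_inl, complexification_inr, pderiv_inl_holo, pderiv_inl_antiholo,
    formalJacobian]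

theorem pderiv_inr_subst_complexification (hH : ∀ i, constantCoeff (H i) = 0) (j : Fin d)
    (f : MvPowerSeries (Fin e ⊕ Fin e) ℂ) :
    pderiv ℂ (Sum.inr j) (subst (complexification H) f) =
      ∑ i, subst (complexification H) (pderiv ℂ (Sum.inr i) f) *
        antiholo d (formalJacobian H i j) := by
  rw [pderiv_subst (constantCoeff_complexification hH), Fintype.sum_sum_type]
  simp [complexification_inl, complexification_inr, pderiv_inr_holo, pderiv_inr_antiholo,
    formalJacobian]

/-- No second derivatives of `H` occur, because `∂/∂Z` kills `H̄(ξ)`: the mixed Hessian pulls back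
as `H_Zᵀ L H̄_ξ`. -/
theorem pderiv_pderiv_subst_complexification (hH : ∀ i, constantCoeff (H i) = 0) (j l : Fin d)
    (f : MvPowerSeries (Fin e ⊕ Fin e) ℂ) :
    pderiv ℂ (Sum.inl j) (pderiv ℂ (Sum.inr l) (subst (complexification H) f)) =
      ∑ k, (∑ i, holo d (formalJacobian H i j) *
        subst (complexification H) (pderiv ℂ (Sum.inl i) (pderiv ℂ (Sum.inr k) f))) *
        antiholo d (formalJacobian H k l) := by
  rw [pderiv_inr_subst_complexification hH, map_sum]
  refine Finset.sum_congr rfl fun k _ => ?_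
  rw [Derivation.leibniz, pderiv_inl_antiholo, smul_zero, zero_add,
    pderiv_inl_subst_complexification hH, smul_eq_mul, mul_comm]
  simp only [mul_comm]

theorem IsFormalHypersurface.formalGradient_inr {ρ : MvPowerSeries (Fin d ⊕ Fin d) ℂ}
    (hρ : IsFormalHypersurface ρ) (j : Fin d) :
    formalGradient ρ (Sum.inr j) = conj (formalGradient ρ (Sum.inl j)) := by
  unfold formalGradient
  rw [constantCoeff_pderiv, constantCoeff_pderiv, ← hρ.hermitian, Finsupp.mapDomain_single,
    Sum.swap_inl]

theorem IsFormalHypersurface.exists_formalGradient_inl {ρ : MvPowerSeries (Fin d ⊕ Fin d) ℂ}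
    (hρ : IsFormalHypersurface ρ) : ∃ j, formalGradient ρ (Sum.inl j) ≠ 0 := by
  obtain ⟨i | i, hi⟩ := hρ.differential_ne_zero
  · exact ⟨i, hi⟩
  · refine ⟨i, fun h => hi ?_⟩
    have := hρ.formalGradient_inr i
    rw [h, map_zero] at this
    exact this

theorem IsMinor.map {R S : Type*} [CommRing R] [CommRing S] {A : Matrix (Fin e) (Fin d) R}
    {k : ℕ} {δ : R} (h : IsMinor A k δ) (φ : R →+* S) : IsMinor (A.map φ) k (φ δ) := by
  obtain ⟨a, b, rfl⟩ := h
  exact ⟨a, b, by rw [Matrix.submatrix_map, RingHom.map_det, RingHom.mapMatrix_apply]⟩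

theorem IsMinor.le_rank {K : Type*} [Field K] {A : Matrix (Fin e) (Fin d) K}
    {k : ℕ} {δ : K} (h : IsMinor A k δ) (hδ : δ ≠ 0) : k ≤ A.rank := by
  obtain ⟨a, b, rfl⟩ := h
  simpa using A.le_rank_of_det_submatrix_ne_zero a b hδ

theorem exists_isMinor_ne_zero {K : Type*} [Field K] (A : Matrix (Fin e) (Fin d) K)
    {k : ℕ} (h : k ≤ A.rank) : ∃ δ, IsMinor A k δ ∧ δ ≠ 0 := by
  obtain ⟨a, b, hab⟩ := A.exists_minor_ne_zero h
  exact ⟨_, ⟨a, b, rfl⟩, hab⟩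

/-- The rank inequality along a component of the zero set of `a` and `ρ`. -/
theorem rank_add_rank_add_formalLeviRank_le (hH : ∀ i, constantCoeff (H i) = 0)
    {ρ a : MvPowerSeries (Fin d ⊕ Fin d) ℂ} {ρ' : MvPowerSeries (Fin e ⊕ Fin e) ℂ}
    (hρ' : IsFormalHypersurface ρ') (ha : subst (complexification H) ρ' = a * ρ)
    {K : Type*} [Field K] (φ : MvPowerSeries (Fin d ⊕ Fin d) ℂ →+* K) (hφρ : φ ρ = 0)
    (hφa : φ a = 0) :
    ((formalJacobian H).map (φ.comp (holo d))).rank +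
      ((formalJacobian H).map (φ.comp (antiholo d))).rank + formalLeviRank ρ' ≤ 2 * e := by
  let Sub : MvPowerSeries (Fin e ⊕ Fin e) ℂ → MvPowerSeries (Fin d ⊕ Fin d) ℂ :=
    subst (complexification H)
  let u : Fin e → MvPowerSeries (Fin d ⊕ Fin d) ℂ := fun k => Sub (pderiv ℂ (Sum.inl k) ρ')
  let v : Fin e → MvPowerSeries (Fin d ⊕ Fin d) ℂ := fun k => Sub (pderiv ℂ (Sum.inr k) ρ')
  let L : Matrix (Fin e) (Fin e) (MvPowerSeries (Fin d ⊕ Fin d) ℂ) := Matrix.of fun i k =>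
    Sub (pderiv ℂ (Sum.inl i) (pderiv ℂ (Sum.inr k) ρ'))
  have hcc : ∀ f, constantCoeff (Sub f) = constantCoeff f :=
    constantCoeff_subst_of_constantCoeff_eq_zero (constantCoeff_complexification hH)
  -- Since both factors vanish under `φ`, all first derivatives of the product do, which says that
  -- the gradient of `ρ'` along the map kills the Jacobian columns.
  have hd : ∀ i, φ (pderiv ℂ i (a * ρ)) = 0 := fun i => by
    rw [Derivation.leibniz, smul_eq_mul, smul_eq_mul, map_add, map_mul, map_mul, hφρ, hφa]; ring
  have key := Matrix.rank_add_rank_add_rank_bordered_le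
    ((formalJacobian H).map (φ.comp (holo d))) ((formalJacobian H).map (φ.comp (antiholo d)))
    (L.map φ) (fun k => φ (u k)) (fun k => φ (v k))
    (fun j => φ (pderiv ℂ (Sum.inl j) a)) (fun l => φ (pderiv ℂ (Sum.inr l) ρ))
    (fun j => φ (pderiv ℂ (Sum.inl j) ρ)) (fun l => φ (pderiv ℂ (Sum.inr l) a))
    (by
      funext j
      have := hd (Sum.inl j)
      rw [← ha, pderiv_inl_subst_complexification hH] at this
      simpa [Matrix.vecMul, dotProduct, map_sum] using this)
    (by
      funext j
      have := hd (Sum.inr j)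
      rw [← ha, pderiv_inr_subst_complexification hH] at this
      simpa [Matrix.vecMul, dotProduct, map_sum] using this)
    (by
      ext j l
      have h1 := congrArg φ (pderiv_pderiv_subst_complexification hH j l ρ')
      -- Only products of first derivatives survive in the second derivatives: two matrices of rank
      -- at most one.
      have h2 : φ (pderiv ℂ (Sum.inl j) (pderiv ℂ (Sum.inr l) (a * ρ))) =
          φ (pderiv ℂ (Sum.inl j) a) * φ (pderiv ℂ (Sum.inr l) ρ) +
            φ (pderiv ℂ (Sum.inl j) ρ) * φ (pderiv ℂ (Sum.inr l) a) := by
        rw [Derivation.leibniz, map_add, smul_eq_mul, smul_eq_mul, Derivation.leibniz,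
          Derivation.leibniz]
        simp only [smul_eq_mul, map_add, map_mul, hφρ, hφa]
        ring
      rw [ha, h2] at h1
      simp only [Matrix.add_apply, Matrix.vecMulVec_apply]
      rw [h1]
      simp only [Matrix.mul_apply, Matrix.transpose_apply, Matrix.map_apply, RingHom.comp_apply,
        map_sum, map_mul]
      rfl)
  have hloc : IsLocalHom (constantCoeff (σ := Fin d ⊕ Fin d) (R := ℂ)) :=
    ⟨fun f hf => isUnit_iff_constantCoeff.2 hf⟩
  -- The substituted series have the same constant terms as the derivatives of `ρ'`, so the bordered
  -- matrix at the origin is that of the Levi form of `ρ'`; its rank does not drop under `φ`.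
  have hb : ((Matrix.bordered u v L).map (constantCoeff (σ := Fin d ⊕ Fin d) (R := ℂ))).rank ≤
      ((Matrix.bordered u v L).map φ).rank :=
    Matrix.le_rank_map_of_le_rank_map _ _ _
  have hbφ : (Matrix.bordered u v L).map φ =
      Matrix.bordered (fun k => φ (u k)) (fun k => φ (v k)) (L.map φ) := by
    ext (i | i) (j | j) <;> simp [Matrix.bordered]
  have hbc : (Matrix.bordered u v L).map (constantCoeff (σ := Fin d ⊕ Fin d) (R := ℂ)) =
      Matrix.bordered (fun k => formalGradient ρ' (Sum.inl k))
        (fun k => conj (formalGradient ρ' (Sum.inl k))) (formalLeviMatrix ρ') := by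
    ext (i | i) (j | j)
    · simp [Matrix.bordered]
    · simp [Matrix.bordered, v, hcc, ← hρ'.formalGradient_inr]; rfl
    · simp [Matrix.bordered, u, hcc]; rfl
    · simp [Matrix.bordered, L, hcc, formalLeviMatrix]
  have hr := restrictedRank_add_two_le (fun k => formalGradient ρ' (Sum.inl k))
    (by
      obtain ⟨j, hj⟩ := hρ'.exists_formalGradient_inl
      exact fun h => hj (congrFun h j)) (formalLeviMatrix ρ')
  rw [hbφ, hbc] at hb
  rw [Fintype.card_fin] at key
  unfold formalLeviRank
  omega

/-- If the Jacobian matrix has smaller rank along the zero set of a prime `f`, then `f` comes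
from a prime of `ℂ⟦Z⟧`. -/
theorem exists_prime_associated_of_rank_lt {R K : Type*} [CommRing R] [IsLocalRing R] [Field K]
    {A : Matrix (Fin e) (Fin d) (MvPowerSeries (Fin d) ℂ)} {s : ℕ}
    (hgen : ∃ δ, IsMinor A d δ ∧ δ ≠ 0)
    (hstar : ∀ D, Prime D → (∀ δ, IsMinor A d δ → D ∣ δ) →
      ∃ k, s ≤ k ∧ ∃ δ', IsMinor A k δ' ∧ ¬ D ∣ δ')
    (ι : MvPowerSeries (Fin d) ℂ →+* R) (π : R →+* MvPowerSeries (Fin d) ℂ)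
    (hπ : ∀ g, π (ι g) = g) {f : R} (hf : Prime f) (φ : R →+* K) (hφ : ∀ x, φ x = 0 ↔ f ∣ x)
    (hlt : (A.map (φ.comp ι)).rank < d) :
    s ≤ (A.map (φ.comp ι)).rank ∧ ∃ D, Prime D ∧ Associated f (ι D) := by
  have h0 : ∀ δ, IsMinor A d δ → f ∣ ι δ := fun δ hδ => by
    rw [← hφ]
    by_contra h
    exact absurd ((hδ.map (φ.comp ι)).le_rank h) (by omega)
  -- All `d`-minors vanish under `φ`, so `f` divides the image of a nonzero series in `Z` and must
  -- come from a prime `D`. A minor not divisible by `D` remains nonzero in `K` and bounds the rank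
  -- from below.
  obtain ⟨δ, hδ, hδ0⟩ := hgen
  obtain ⟨D, hD, hfD, hdvd⟩ := exists_prime_associated_of_retraction ι π hπ hf hδ0 (h0 δ hδ)
  obtain ⟨k, hk, δ', hδ', hn⟩ := hstar D hD fun δ hδ => hdvd _ (h0 δ hδ)
  refine ⟨hk.trans ((hδ'.map (φ.comp ι)).le_rank fun h => hn (hdvd _ ((hφ _).1 h))), D, hD, hfD⟩

/-- The field is the residue field at the prime `(f)`: ranks over it are ranks at the generic point
of `f = 0`. -/
theorem exists_ringHom_eq_zero_iff_dvd.{u} {R : Type u} [CommRing R] {f : R} (hf : Prime f) :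
    ∃ (K : Type u) (_ : Field K) (φ : R →+* K), ∀ x, φ x = 0 ↔ f ∣ x := by
  have hprime : (Ideal.span {f}).IsPrime := (Ideal.span_singleton_prime hf.ne_zero).2 hf
  refine ⟨FractionRing (R ⧸ Ideal.span {f}), inferInstance,
    (algebraMap (R ⧸ Ideal.span {f}) _).comp (Ideal.Quotient.mk _), fun x => ?_⟩
  rw [← Ideal.mem_span_singleton, ← Ideal.Quotient.eq_zero_iff_mem]
  exact map_eq_zero_iff _ (IsFractionRing.injective (R ⧸ Ideal.span {f}) _)

theorem comap_mk_span_singleton {R : Type*} [CommRing R] (ρ x : R) :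
    (Ideal.span {Ideal.Quotient.mk (Ideal.span {ρ}) x}).comap (Ideal.Quotient.mk (Ideal.span {ρ})) =
      Ideal.span {ρ, x} := by
  rw [← Set.image_singleton, ← Ideal.map_span,
    Ideal.comap_map_of_surjective _ Ideal.Quotient.mk_surjective, ← RingHom.ker_eq_comap_bot,
    Ideal.mk_ker, Ideal.span_insert, sup_comm]

/-- The core of the proof, shared by both settings. The rank inequality forces every prime factor of
`a` on the hypersurface to depend on `Z` alone and on `ξ` alone, up to units, and finite type
forbids this. -/
theorem constantCoeff_ne_zero_of_sendsInto {s : ℕ} (hs : s ≤ d)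
    {ρ a : MvPowerSeries (Fin d ⊕ Fin d) ℂ} {ρ' : MvPowerSeries (Fin e ⊕ Fin e) ℂ}
    (hρ : IsFormalHypersurface ρ) (hρ' : IsFormalHypersurface ρ')
    (hH : ∀ i, constantCoeff (H i) = 0) (ha : subst (complexification H) ρ' = a * ρ)
    (hft : ∀ v ∈ complexTangent (formalGradient ρ), ∃ X, FormalCRLieAlgebra ρ X ∧
      (fun i => constantCoeff (X i)) = v)
    (hle : 2 * e + 2 ≤ formalLeviRank ρ' + d + s)
    (hgen : ∃ δ, IsMinor (formalJacobian H) d δ ∧ δ ≠ 0)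
    (hstar : ∀ D, Prime D → (∀ δ, IsMinor (formalJacobian H) d δ → D ∣ δ) →
      ∃ k, s ≤ k ∧ ∃ δ', IsMinor (formalJacobian H) k δ' ∧ ¬ D ∣ δ') :
    constantCoeff a ≠ 0 := by
  intro ha0
  obtain ⟨j₀, hj₀⟩ := hρ.exists_formalGradient_inl
  have hl : coeff (Finsupp.single (Sum.inl j₀) 1) ρ ≠ 0 := by
    rw [← constantCoeff_pderiv]; exact hj₀
  have hr : coeff (Finsupp.single (Sum.inr j₀) 1) ρ ≠ 0 := by
    rw [← constantCoeff_pderiv]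
    change formalGradient ρ (Sum.inr j₀) ≠ 0
    rw [hρ.formalGradient_inr]
    exact (map_ne_zero _).2 hj₀
  have h0 := hρ.constantCoeff_eq_zero
  let R := MvPowerSeries (Fin d ⊕ Fin d) ℂ ⧸ Ideal.span {ρ}
  let q : MvPowerSeries (Fin d ⊕ Fin d) ℂ →+* R := Ideal.Quotient.mk _
  have : IsDomain R := isDomain_quotient h0 hl
  have : UniqueFactorizationMonoid R := uniqueFactorizationMonoid_quotient h0 hl
  have : IsLocalRing R := IsLocalRing.of_surjective' q Ideal.Quotient.mk_surjective
  have hq : ∀ x, q x = 0 ↔ x ∈ Ideal.span {ρ} := fun x => Ideal.Quotient.eq_zero_iff_mem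
  have hqρ : q ρ = 0 := (hq _).2 (Ideal.mem_span_singleton_self _)
  -- Series in `Z` are a retract of `R` because `ρ` can be solved for `ξ_{j₀}`; the second
  -- retraction, onto series in `ξ`, solves for `Z_{j₀}`.
  obtain ⟨π₁, hπ₁⟩ := exists_retraction_quotient (Function.Embedding.inl : Fin d ↪ Fin d ⊕ Fin d)
    h0 (i₀ := Sum.inr j₀) (by rintro ⟨i, hi⟩; cases hi) hr
  obtain ⟨π₂, hπ₂⟩ := exists_retraction_quotient (Function.Embedding.inr : Fin d ↪ Fin d ⊕ Fin d)
    h0 (i₀ := Sum.inl j₀) (by rintro ⟨i, hi⟩; cases hi) hl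
  have hπ₁' : ∀ g, π₁ (q.comp (holo d) g) = g := hπ₁
  have hconj : ∀ g : MvPowerSeries (Fin d) ℂ,
      map (starRingEnd ℂ) (map (starRingEnd ℂ) g) = g := fun g => by
    ext α; simp
  have hπ₂' : ∀ g, ((MvPowerSeries.map (starRingEnd ℂ)).comp π₂) (q.comp (antiholo d) g) = g := fun g => by
    have := hπ₂ (map (starRingEnd ℂ) g)
    rw [← hconj g, RingHom.comp_apply]
    exact congrArg _ (by rw [hconj]; exact this)
  -- If `a` vanishes on the whole hypersurface, the inequality holds at its generic point. The
  -- retractions show that the nonzero `d`-minor survives there in both sets of variables, so both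
  -- ranks are `d`, too large.
  by_cases hqa : q a = 0
  · let φ : R →+* FractionRing R := algebraMap R _
    have hφ : Function.Injective φ := IsFractionRing.injective R _
    have key := rank_add_rank_add_formalLeviRank_le hH hρ' ha (φ.comp q)
      (by rw [RingHom.comp_apply, hqρ, map_zero]) (by rw [RingHom.comp_apply, hqa, map_zero])
    obtain ⟨δ, hδ, hδ0⟩ := hgen
    have h1 : d ≤ ((formalJacobian H).map ((φ.comp q).comp (holo d))).rank :=
      (hδ.map _).le_rank fun h => hδ0 (by
        rw [← hπ₁' δ]
        have : q.comp (holo d) δ = 0 := hφ (by rw [map_zero]; exact h)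
        rw [this, map_zero])
    have h2 : d ≤ ((formalJacobian H).map ((φ.comp q).comp (antiholo d))).rank :=
      (hδ.map _).le_rank fun h => hδ0 (by
        rw [← hπ₂' δ]
        have : q.comp (antiholo d) δ = 0 := hφ (by rw [map_zero]; exact h)
        rw [this, map_zero])
    omega
  · have hnu : ¬ IsUnit (q a) := by
      intro hu
      have hloc : IsLocalHom q := .of_surjective q Ideal.Quotient.mk_surjective
      have := isUnit_of_map_unit q a hu
      rw [isUnit_iff_constantCoeff, ha0] at this
      exact not_isUnit_zero this
    obtain ⟨f, hfi, hfa⟩ := WfDvdMonoid.exists_irreducible_factor hnu hqa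
    have hf : Prime f := hfi.prime
    have hprime : (Ideal.span {f}).IsPrime := (Ideal.span_singleton_prime hf.ne_zero).2 hf
    obtain ⟨K, _, φ, hφ⟩ := exists_ringHom_eq_zero_iff_dvd hf
    have key := rank_add_rank_add_formalLeviRank_le hH hρ' ha (φ.comp q)
      (by rw [RingHom.comp_apply, hqρ, map_zero]) (by rw [RingHom.comp_apply, hφ]; exact hfa)
    have c1 := exists_prime_associated_of_rank_lt hgen hstar _ π₁ hπ₁' hf φ hφ
    have c2 := exists_prime_associated_of_rank_lt hgen hstar _ _ hπ₂' hf φ hφ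
    rw [← RingHom.comp_assoc] at c1 c2
    have l1 : ((formalJacobian H).map ((φ.comp q).comp (holo d))).rank ≤ d :=
      (Matrix.rank_le_width _)
    have l2 : ((formalJacobian H).map ((φ.comp q).comp (antiholo d))).rank ≤ d :=
      (Matrix.rank_le_width _)
    -- If one rank equals `d`, the inequality leaves at most `s - 2` for the other, which is below
    -- `d` and hence at least `s`.
    have l1' : ((formalJacobian H).map ((φ.comp q).comp (holo d))).rank < d := by
      by_contra h
      have := (c2 (by omega)).1
      omega
    have l2' : ((formalJacobian H).map ((φ.comp q).comp (antiholo d))).rank < d := by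
      by_contra h
      have := (c1 (by omega)).1
      omega
    obtain ⟨-, D₁, -, hD₁⟩ := c1 l1'
    obtain ⟨-, D₂, -, hD₂⟩ := c2 l2'
    have e1 : (Ideal.span {f}).comap q = Ideal.span {ρ, rename Sum.inl D₁} := by
      rw [Ideal.span_singleton_eq_span_singleton.2 hD₁]
      exact comap_mk_span_singleton ρ _
    have e2 : (Ideal.span {f}).comap q =
        Ideal.span {ρ, rename Sum.inr (map (starRingEnd ℂ) D₂)} := by
      rw [Ideal.span_singleton_eq_span_singleton.2 hD₂]
      exact comap_mk_span_singleton ρ _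
    -- The preimage of `(f)` is generated over `ρ` both by a series in `Z` and by a series in `ξ`,
    -- so it is stable and collapses to `(ρ)`.
    have hle := le_span_of_invariant h0 hj₀ hft e1 e2 (Ideal.comap_ne_top _ hprime.ne_top)
    obtain ⟨x, hx⟩ := Ideal.Quotient.mk_surjective f
    have : x ∈ Ideal.span {ρ} := hle (by
      rw [Ideal.mem_comap]
      change Ideal.Quotient.mk _ x ∈ _
      rw [hx]; exact Ideal.mem_span_singleton_self _)
    rw [← hq] at this
    exact hf.ne_zero (hx.symm.trans this)

/-- Differentiating `ρ'(H, H̄) = a ρ` with respect to `Z` at the origin gives `ρ'_{Z'} H_Z = a(0)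
ρ_Z`, and `ρ_Z ≠ 0`. -/
theorem exists_sum_formalGradient_mul_ne_zero {ρ a : MvPowerSeries (Fin d ⊕ Fin d) ℂ}
    {ρ' : MvPowerSeries (Fin e ⊕ Fin e) ℂ} (hρ : IsFormalHypersurface ρ)
    (hH : ∀ i, constantCoeff (H i) = 0) (ha : subst (complexification H) ρ' = a * ρ)
    (ha0 : constantCoeff a ≠ 0) :
    ∃ j, ∑ i, formalGradient ρ' (Sum.inl i) * constantCoeff (formalJacobian H i j) ≠ 0 := by
  obtain ⟨j, hj⟩ := hρ.exists_formalGradient_inl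
  refine ⟨j, ?_⟩
  have h := congrArg constantCoeff (pderiv_inl_subst_complexification hH j ρ')
  have hcc := constantCoeff_subst_of_constantCoeff_eq_zero (constantCoeff_complexification hH)
  rw [ha, Derivation.leibniz, smul_eq_mul, smul_eq_mul, map_add, map_mul, map_mul,
    hρ.constantCoeff_eq_zero, zero_mul, add_zero, map_sum] at h
  simp only [map_mul, hcc, holo_apply, constantCoeff_rename] at h
  change _ = ∑ i, formalGradient ρ' (Sum.inl i) * constantCoeff (formalJacobian H i j) at h
  rw [← h]
  exact mul_ne_zero ha0 hj

/-- Subtracting a complex multiple of column `j` makes the `(1,0)`-part of the covector vanish on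
`z`; by reality the conjugate part vanishes as well. -/
theorem realTangent_sup_range_mulVecLin {g : Fin e ⊕ Fin e → ℂ}
    (hg : ∀ j, g (Sum.inr j) = conj (g (Sum.inl j))) (A : Matrix (Fin e) (Fin d) ℂ) (j : Fin d)
    (hj : ∑ i, g (Sum.inl i) * A i j ≠ 0) :
    realTangent g ⊔ LinearMap.range (A.mulVecLin.restrictScalars ℝ) = ⊤ := by
  rw [eq_top_iff]
  rintro z -
  set c := ∑ i, g (Sum.inl i) * A i j
  set t := (∑ i, g (Sum.inl i) * z i) / c
  rw [← sub_add_cancel z (A.mulVec (Pi.single j t))]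
  refine Submodule.add_mem_sup ?_ ⟨Pi.single j t, rfl⟩
  have h : ∑ i, g (Sum.inl i) * (z - A.mulVec (Pi.single j t)) i = 0 := by
    have : ∀ i, g (Sum.inl i) * (z - A.mulVec (Pi.single j t)) i =
        g (Sum.inl i) * z i - t * (g (Sum.inl i) * A i j) := fun i => by
      rw [Pi.sub_apply, Matrix.mulVec_single]
      simp; ring
    rw [Finset.sum_congr rfl fun i _ => this i, Finset.sum_sub_distrib, ← Finset.mul_sum,
      div_mul_cancel₀ _ hj, sub_self]
  change _ + _ = _
  rw [h, zero_add]
  simp only [hg, ← map_mul, ← map_sum]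
  rw [h, map_zero]

end

theorem isFormalTransversal_of_sendsInto {n N s : ℕ} (hsn : s ≤ n + 1)
    (ρ : MvPowerSeries (Fin (n + 1) ⊕ Fin (n + 1)) ℂ)
        (ρ' : MvPowerSeries (Fin (N + 1) ⊕ Fin (N + 1)) ℂ)
        (H : Fin (N + 1) → MvPowerSeries (Fin (n + 1)) ℂ)
     (hρ : IsFormalHypersurface ρ)
      (hρ' : IsFormalHypersurface ρ')
      (hH : ∀ i, MvPowerSeries.constantCoeff (H i) = 0)
      (hSends : SendsInto H ρ ρ')
      (hft : IsFormalFiniteType ρ)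
      (hle : 2 * (N : ℤ) - (formalLeviRank ρ' : ℤ) ≤ (n : ℤ) + (s : ℤ) - 3)
      (hgen : ∃ δ, IsMinor (formalJacobian H) (n + 1) δ ∧ δ ≠ 0)
      (hdiv : ∀ D : MvPowerSeries (Fin (n + 1)) ℂ,
        (∀ δ, IsMinor (formalJacobian H) (n + 1) δ → δ ≠ 0 → D ∣ δ) →
        ∃ k, s ≤ k ∧ ∃ δ', IsMinor (formalJacobian H) k δ' ∧
          IsRelPrime δ' D) :
      IsFormalTransversal H ρ' := by
  obtain ⟨a, ha⟩ := hSends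
  -- With `d = n + 1` and `e = N + 1` the numerical hypothesis reads `2e + 2 ≤ r + d + s`. Only
  -- prime common divisors matter, and a minor relatively prime to a prime `D` is not divisible by
  -- it.
  have h := constantCoeff_ne_zero_of_sendsInto hsn hρ hρ' hH ha
    (fun v hv => by rw [← hft] at hv; exact hv) (by omega) hgen (fun D hD hDdvd => by
      obtain ⟨k, hk, δ', hδ', hr⟩ := hdiv D fun δ hδ _ => hDdvd δ hδ
      exact ⟨k, hk, δ', hδ', fun hdvd => hD.not_isUnit (hr hdvd dvd_rfl)⟩)
  obtain ⟨j, hj⟩ := exists_sum_formalGradient_mul_ne_zero hρ hH ha h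
  exact realTangent_sup_range_mulVecLin hρ'.formalGradient_inr _ j hj
end CRTransversal

/-! ## Convergent power series -/

namespace MvPowerSeries

open scoped NNReal ENNReal

section Weighted

variable {σ : Type*} [Fintype σ]

/-- The weighted `ℓ¹`-norm of a power series for the polyradius `r`. -/
noncomputable def polyNorm (r : σ → ℝ≥0) (F : MvPowerSeries σ ℂ) : ℝ≥0∞ :=
  ∑' α : σ →₀ ℕ, ‖coeff α F‖ₑ * ∏ i, (r i : ℝ≥0∞) ^ α i

/-- The sum of a power series at a point. -/
noncomputable def eval (F : MvPowerSeries σ ℂ) (z : σ → ℂ) : ℂ :=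
  ∑' α : σ →₀ ℕ, coeff α F * ∏ i, z i ^ α i

variable {r r' : σ → ℝ≥0} {F G : MvPowerSeries σ ℂ} {z : σ → ℂ}

theorem polyNorm_mono (h : r ≤ r') (F : MvPowerSeries σ ℂ) : polyNorm r F ≤ polyNorm r' F :=
  ENNReal.tsum_le_tsum fun _ => mul_le_mul_right
    (Finset.prod_le_prod' fun i _ => pow_le_pow_left' (ENNReal.coe_le_coe.2 (h i)) _) _

theorem polyNorm_add_le (r : σ → ℝ≥0) (F G : MvPowerSeries σ ℂ) :
    polyNorm r (F + G) ≤ polyNorm r F + polyNorm r G := by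
  unfold polyNorm
  rw [← ENNReal.tsum_add]
  refine ENNReal.tsum_le_tsum fun α => ?_
  rw [map_add, ← add_mul]
  exact mul_le_mul_left (enorm_add_le _ _) _

theorem polyNorm_neg (r : σ → ℝ≥0) (F : MvPowerSeries σ ℂ) : polyNorm r (-F) = polyNorm r F := by
  simp [polyNorm]

theorem polyNorm_sub_le (r : σ → ℝ≥0) (F G : MvPowerSeries σ ℂ) :
    polyNorm r (F - G) ≤ polyNorm r F + polyNorm r G := by
  rw [sub_eq_add_neg]
  exact (polyNorm_add_le _ _ _).trans_eq (by rw [polyNorm_neg])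

theorem polyNorm_monomial (r : σ → ℝ≥0) (α : σ →₀ ℕ) (c : ℂ) :
    polyNorm r (monomial α c) = ‖c‖ₑ * ∏ i, (r i : ℝ≥0∞) ^ α i := by
  classical
  unfold polyNorm
  rw [tsum_eq_single α fun β hβ => by rw [coeff_monomial, if_neg hβ]; simp]
  rw [coeff_monomial_same]

theorem polyNorm_C (r : σ → ℝ≥0) (c : ℂ) : polyNorm r (C c) = ‖c‖ₑ := by
  rw [← monomial_zero_eq_C_apply, polyNorm_monomial]
  simp

theorem polyNorm_zero (r : σ → ℝ≥0) : polyNorm r (0 : MvPowerSeries σ ℂ) = 0 := by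
  simp [polyNorm]

theorem polyNorm_one (r : σ → ℝ≥0) : polyNorm r (1 : MvPowerSeries σ ℂ) = 1 := by
  simpa using polyNorm_C r 1

theorem polyNorm_X (r : σ → ℝ≥0) (i : σ) : polyNorm r (X i : MvPowerSeries σ ℂ) = r i := by
  classical
  rw [X_def, polyNorm_monomial, Finset.prod_eq_single i]
  · simp
  · intro j _ hj; simp [Finsupp.single_eq_of_ne hj]
  · simp

/-- Rearrangement of a double sum in `ℝ≥0∞`. It makes the convergent series at a fixed polyradius a
ring, so determinants and resultants can be formed without shrinking the polydisc. -/
theorem polyNorm_mul_le (r : σ → ℝ≥0) (F G : MvPowerSeries σ ℂ) :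
    polyNorm r (F * G) ≤ polyNorm r F * polyNorm r G := by
  classical
  let f : (σ →₀ ℕ) → ℝ≥0∞ := fun α => ‖coeff α F‖ₑ * ∏ i, (r i : ℝ≥0∞) ^ α i
  let g : (σ →₀ ℕ) → ℝ≥0∞ := fun α => ‖coeff α G‖ₑ * ∏ i, (r i : ℝ≥0∞) ^ α i
  calc polyNorm r (F * G)
      ≤ ∑' α : σ →₀ ℕ, ∑ p ∈ Finset.HasAntidiagonal.antidiagonal α, f p.1 * g p.2 := by
        refine ENNReal.tsum_le_tsum fun α => ?_
        rw [coeff_mul]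
        refine (mul_le_mul_left (enorm_sum_le _ _) _).trans_eq ?_
        rw [Finset.sum_mul]
        refine Finset.sum_congr rfl fun p hp => ?_
        rw [← Finset.HasAntidiagonal.mem_antidiagonal.1 hp, enorm_mul]
        simp only [f, g, Finsupp.add_apply, pow_add, Finset.prod_mul_distrib]
        ring
    _ = ∑' p : (σ →₀ ℕ) × (σ →₀ ℕ), f p.1 * g p.2 := by
        rw [← Finset.HasAntidiagonal.sigmaAntidiagonalEquivProd.tsum_eq, ENNReal.tsum_sigma']
        refine tsum_congr fun α => ?_
        rw [tsum_fintype, Finset.univ_eq_attach,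
          ← Finset.sum_attach (Finset.HasAntidiagonal.antidiagonal α)]
        rfl
    _ = polyNorm r F * polyNorm r G := by
        rw [ENNReal.tsum_prod']
        simp only [ENNReal.tsum_mul_left, ENNReal.tsum_mul_right]
        rfl

/-- Series that converge absolutely at the polyradius `r`. -/
def convergent (r : σ → ℝ≥0) : Subring (MvPowerSeries σ ℂ) where
  carrier := {F | polyNorm r F ≠ ⊤}
  mul_mem' := fun {F G} hF hG =>
    ne_top_of_le_ne_top (ENNReal.mul_ne_top hF hG) (polyNorm_mul_le r F G)
  one_mem' := by simp [polyNorm_one]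
  add_mem' := fun {F G} hF hG =>
    ne_top_of_le_ne_top (ENNReal.add_ne_top.2 ⟨hF, hG⟩) (polyNorm_add_le r F G)
  zero_mem' := by simp [polyNorm_zero]
  neg_mem' := fun {F} hF => by simpa [polyNorm_neg] using hF

theorem mem_convergent : F ∈ convergent r ↔ polyNorm r F ≠ ⊤ := Iff.rfl

theorem convergent_anti (h : r ≤ r') (hF : F ∈ convergent r') : F ∈ convergent r :=
  ne_top_of_le_ne_top hF (polyNorm_mono h F)

theorem C_mem_convergent (c : ℂ) : C c ∈ convergent r := by
  simp [mem_convergent, polyNorm_C]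

theorem X_mem_convergent (i : σ) : X i ∈ convergent r := by
  simp [mem_convergent, polyNorm_X]

theorem tsum_enorm_le (hz : ∀ i, ‖z i‖₊ ≤ r i) (F : MvPowerSeries σ ℂ) :
    ∑' α : σ →₀ ℕ, ‖coeff α F * ∏ i, z i ^ α i‖ₑ ≤ polyNorm r F := by
  refine ENNReal.tsum_le_tsum fun α => ?_
  rw [enorm_mul]
  refine mul_le_mul_right ?_ _
  have : ‖∏ i, z i ^ α i‖ₑ = ∏ i, ‖z i‖ₑ ^ α i := by
    simp only [enorm_eq_nnnorm, nnnorm_prod, nnnorm_pow, ENNReal.ofNNReal_finsetProd, ENNReal.coe_pow]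
  rw [this]
  exact Finset.prod_le_prod' fun i _ => pow_le_pow_left' (ENNReal.coe_le_coe.2 (hz i)) _

theorem summable_norm_eval (hz : ∀ i, ‖z i‖₊ ≤ r i) (hF : F ∈ convergent r) :
    Summable fun α : σ →₀ ℕ => ‖coeff α F * ∏ i, z i ^ α i‖ := by
  rw [← tsum_enorm_ne_top_iff_summable_norm]
  exact ne_top_of_le_ne_top hF (tsum_enorm_le hz F)

theorem enorm_eval_le (hz : ∀ i, ‖z i‖₊ ≤ r i) (F : MvPowerSeries σ ℂ) :
    ‖eval F z‖ₑ ≤ polyNorm r F :=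
  enorm_tsum_le_tsum_enorm.trans (tsum_enorm_le hz F)

theorem eval_add (hz : ∀ i, ‖z i‖₊ ≤ r i) (hF : F ∈ convergent r) (hG : G ∈ convergent r) :
    eval (F + G) z = eval F z + eval G z := by
  unfold eval
  rw [← (summable_norm_eval hz hF).of_norm.tsum_add (summable_norm_eval hz hG).of_norm]
  simp only [map_add, add_mul]

theorem eval_mul (hz : ∀ i, ‖z i‖₊ ≤ r i) (hF : F ∈ convergent r) (hG : G ∈ convergent r) :
    eval (F * G) z = eval F z * eval G z := by
  classical
  unfold eval
  have hF' := summable_norm_eval hz hF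
  have hG' := summable_norm_eval hz hG
  rw [hF'.of_norm.tsum_mul_tsum_eq_tsum_sum_antidiagonal hG'.of_norm (hF'.mul_norm hG').of_norm]
  refine tsum_congr fun α => ?_
  rw [coeff_mul, Finset.sum_mul]
  refine Finset.sum_congr rfl fun p hp => ?_
  rw [← Finset.HasAntidiagonal.mem_antidiagonal.1 hp]
  simp only [Finsupp.add_apply, pow_add, Finset.prod_mul_distrib]
  ring

theorem eval_monomial (α : σ →₀ ℕ) (c : ℂ) (z : σ → ℂ) :
    eval (monomial α c) z = c * ∏ i, z i ^ α i := by
  classical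
  unfold eval
  rw [tsum_eq_single α fun β hβ => by rw [coeff_monomial, if_neg hβ]; simp]
  rw [coeff_monomial_same]

theorem eval_C (c : ℂ) (z : σ → ℂ) : eval (C c) z = c := by
  rw [← monomial_zero_eq_C_apply, eval_monomial]
  simp

theorem eval_X (i : σ) (z : σ → ℂ) : eval (X i) z = z i := by
  classical
  rw [X_def, eval_monomial, Finset.prod_eq_single i]
  · simp
  · intro j _ hj; simp [Finsupp.single_eq_of_ne hj]
  · simp

/-- Evaluation of convergent series. -/
noncomputable def evalHom (r : σ → ℝ≥0) (z : σ → ℂ) (hz : ∀ i, ‖z i‖₊ ≤ r i) :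
    convergent r →+* ℂ where
  toFun F := eval (F : MvPowerSeries σ ℂ) z
  map_one' := by simpa using eval_C 1 z
  map_mul' F G := eval_mul hz F.2 G.2
  map_zero' := by simpa using eval_C 0 z
  map_add' F G := eval_add hz F.2 G.2

theorem evalHom_apply (hz : ∀ i, ‖z i‖₊ ≤ r i) (F : convergent r) :
    evalHom r z hz F = eval (F : MvPowerSeries σ ℂ) z := rfl

/-- The norm is a supremum of finite partial sums, so a bound passes to coefficientwise limits. -/
theorem polyNorm_le_of_coeff_eq {B : ℝ≥0∞}
    (h : ∀ s : Finset (σ →₀ ℕ), ∃ G, (∀ α ∈ s, coeff α F = coeff α G) ∧ polyNorm r G ≤ B) :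
    polyNorm r F ≤ B := by
  unfold polyNorm
  rw [ENNReal.tsum_eq_iSup_sum]
  refine iSup_le fun s => ?_
  obtain ⟨G, hG, hGB⟩ := h s
  rw [Finset.sum_congr rfl fun α hα => by rw [hG α hα]]
  exact (ENNReal.sum_le_tsum s).trans hGB

/-- A self-map of the power series ring that is contracting for a grading and preserves a ball of
the weighted norm has a fixed point in this ball. -/
theorem exists_fixedPoint_polyNorm_le (T : MvPowerSeries σ ℂ → MvPowerSeries σ ℂ)
    (w : (σ →₀ ℕ) → ℕ)
    (hT : ∀ k F G, (∀ α, w α < k → coeff α F = coeff α G) →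
      ∀ α, w α < k + 1 → coeff α (T F) = coeff α (T G)) {B : ℝ≥0∞}
    (hB : ∀ F, polyNorm r F ≤ B → polyNorm r (T F) ≤ B) :
    ∃ F, T F = F ∧ polyNorm r F ≤ B := by
  -- The coefficient at `α` no longer changes after `w α + 1` iterations; the stable values form the
  -- fixed point.
  let S : ℕ → MvPowerSeries σ ℂ := fun k => T^[k] 0
  have hS : ∀ k, S (k + 1) = T (S k) := fun k => Function.iterate_succ_apply' T k 0
  have h1 : ∀ k α, w α < k → coeff α (S (k + 1)) = coeff α (S k) := by
    intro k
    induction k with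
    | zero => intro α h; omega
    | succ k ih => rw [hS (k + 1), hS k]; exact hT k _ _ (by rw [← hS k]; exact ih)
  have h2 : ∀ k l α, k ≤ l → w α < k → coeff α (S l) = coeff α (S k) := by
    intro k l α hkl hα
    induction l, hkl using Nat.le_induction with
    | base => rfl
    | succ l hkl ih => rw [h1 l α (by omega), ih]
  let F : MvPowerSeries σ ℂ := fun α => coeff α (S (w α + 1))
  have hF : ∀ k α, w α < k → coeff α F = coeff α (S k) := fun k α hα =>
    (h2 (w α + 1) k α hα (by omega)).symm
  refine ⟨F, ?_, polyNorm_le_of_coeff_eq fun s => ?_⟩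
  · ext α
    rw [hT (w α) F (S (w α)) (hF _) α (by omega), ← hS, hF (w α + 1) α (by omega)]
  · refine ⟨S (s.sup w + 1), fun α hα => hF _ _ (Nat.lt_succ_of_le (Finset.le_sup hα)), ?_⟩
    have : ∀ k, polyNorm r (S k) ≤ B := fun k => by
      induction k with
      | zero => change polyNorm r 0 ≤ B; rw [polyNorm_zero]; exact zero_le
      | succ k ih => rw [hS]; exact hB _ ih
    exact this _

end Weighted

end MvPowerSeries

/-! ## Substitution and division with estimates -/

namespace MvPowerSeries

open scoped NNReal ENNReal

section Substitution

variable {σ τ : Type*} [Fintype σ] [Fintype τ] {r : τ → ℝ≥0} {r' : σ → ℝ≥0}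
  {a : σ → MvPowerSeries τ ℂ}

theorem polyNorm_prod_pow_le (ha' : ∀ i, polyNorm r (a i) ≤ r' i) (α : σ →₀ ℕ) :
    polyNorm r (∏ i, a i ^ α i) ≤ ∏ i, (r' i : ℝ≥0∞) ^ α i := by
  classical
  have hpow : ∀ i n, polyNorm r (a i ^ n) ≤ (r' i : ℝ≥0∞) ^ n := by
    intro i n
    induction n with
    | zero => simp [polyNorm_one]
    | succ n ih =>
      rw [pow_succ, pow_succ]
      exact (polyNorm_mul_le _ _ _).trans (mul_le_mul' ih (ha' i))
  have : ∀ s : Finset σ, polyNorm r (∏ i ∈ s, a i ^ α i) ≤ ∏ i ∈ s, (r' i : ℝ≥0∞) ^ α i := by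
    intro s
    induction s using Finset.induction_on with
    | empty => simp [polyNorm_one]
    | insert i s hi ih =>
      rw [Finset.prod_insert hi, Finset.prod_insert hi]
      exact (polyNorm_mul_le _ _ _).trans (mul_le_mul' (hpow _ _) ih)
  exact this _

omit [Fintype τ] in
theorem coeff_subst_eq_tsum (ha : HasSubst a) (F : MvPowerSeries σ ℂ) (β : τ →₀ ℕ) :
    coeff β (subst a F) = ∑' α : σ →₀ ℕ, coeff α F * coeff β (∏ i, a i ^ α i) := by
  rw [coeff_subst ha]
  refine (tsum_eq_finsum (L := .unconditional _) (coeff_subst_finite ha F β)).symm.trans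
    (tsum_congr fun α => ?_)
  rw [Finsupp.prod_fintype _ _ fun i => pow_zero _, smul_eq_mul]

/-- Interchange the two summations; each monomial of `F` then contributes the norm of a product of
the `a i`, which is submultiplicative. -/
theorem polyNorm_subst_le (ha : HasSubst a) (ha' : ∀ i, polyNorm r (a i) ≤ r' i)
    (F : MvPowerSeries σ ℂ) : polyNorm r (subst a F) ≤ polyNorm r' F := by
  calc polyNorm r (subst a F)
      ≤ ∑' β : τ →₀ ℕ, ∑' α : σ →₀ ℕ, ‖coeff α F‖ₑ * (‖coeff β (∏ i, a i ^ α i)‖ₑ *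
          ∏ i, (r i : ℝ≥0∞) ^ β i) := by
        refine ENNReal.tsum_le_tsum fun β => ?_
        rw [coeff_subst_eq_tsum ha]
        refine (mul_le_mul_left enorm_tsum_le_tsum_enorm _).trans_eq ?_
        rw [← ENNReal.tsum_mul_right]
        refine tsum_congr fun α => ?_
        rw [enorm_mul, mul_assoc]
    _ = ∑' α : σ →₀ ℕ, ‖coeff α F‖ₑ * polyNorm r (∏ i, a i ^ α i) := by
        rw [ENNReal.tsum_comm]
        simp only [ENNReal.tsum_mul_left]
        rfl
    _ ≤ polyNorm r' F := ENNReal.tsum_le_tsum fun α =>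
        mul_le_mul_right (polyNorm_prod_pow_le ha' α) _

/-- The estimates behind `polyNorm_subst_le` give absolute convergence of the double series, so the
order of summation may be exchanged. -/
theorem eval_subst (ha : HasSubst a) (ha' : ∀ i, polyNorm r (a i) ≤ r' i)
    {F : MvPowerSeries σ ℂ} (hF : F ∈ convergent r') {z : τ → ℂ} (hz : ∀ i, ‖z i‖₊ ≤ r i) :
    eval (subst a F) z = eval F fun i => eval (a i) z := by
  have hac : ∀ i, a i ∈ convergent r := fun i => ne_top_of_le_ne_top ENNReal.coe_ne_top (ha' i)
  have hprod : ∀ α : σ →₀ ℕ, eval (∏ i, a i ^ α i) z = ∏ i, eval (a i) z ^ α i := fun α => by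
    have h : ∏ i, a i ^ α i =
        ((∏ i, (⟨a i, hac i⟩ : convergent r) ^ α i : convergent r) : MvPowerSeries τ ℂ) := by simp
    rw [h, ← evalHom_apply hz, map_prod]
    simp only [map_pow, evalHom_apply]
  have hsum : Summable (Function.uncurry fun (β : τ →₀ ℕ) (α : σ →₀ ℕ) =>
      coeff α F * (coeff β (∏ i, a i ^ α i) * ∏ i, z i ^ β i)) := by
    refine Summable.of_norm ?_
    rw [← tsum_enorm_ne_top_iff_summable_norm]
    refine ne_top_of_le_ne_top hF ?_
    rw [ENNReal.tsum_prod', ENNReal.tsum_comm]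
    refine ENNReal.tsum_le_tsum fun α => ?_
    simp only [Function.uncurry, enorm_mul (coeff α F)]
    rw [ENNReal.tsum_mul_left]
    exact mul_le_mul_right ((tsum_enorm_le hz _).trans (polyNorm_prod_pow_le ha' α)) _
  calc eval (subst a F) z
      = ∑' β : τ →₀ ℕ, ∑' α : σ →₀ ℕ,
          coeff α F * (coeff β (∏ i, a i ^ α i) * ∏ i, z i ^ β i) := by
        refine tsum_congr fun β => ?_
        rw [coeff_subst_eq_tsum ha, ← tsum_mul_right]
        simp only [mul_assoc]
    _ = ∑' α : σ →₀ ℕ, ∑' β : τ →₀ ℕ,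
          coeff α F * (coeff β (∏ i, a i ^ α i) * ∏ i, z i ^ β i) := hsum.tsum_comm.symm
    _ = _ := by
        refine tsum_congr fun α => ?_
        rw [tsum_mul_left, ← hprod]
        rfl

theorem polyNorm_rename (e : σ ↪ τ) (r : τ → ℝ≥0) (F : MvPowerSeries σ ℂ) :
    polyNorm r (rename e F) ≤ polyNorm (fun i => r (e i)) F := by
  rw [rename_eq_subst]
  exact polyNorm_subst_le (hasSubst_of_constantCoeff_zero (by simp))
    (fun i => (polyNorm_X r (e i)).le) F

theorem eval_rename (e : σ ↪ τ) {F : MvPowerSeries σ ℂ} (hF : F ∈ convergent fun i => r (e i))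
    {z : τ → ℂ} (hz : ∀ i, ‖z i‖₊ ≤ r i) : eval (rename e F) z = eval F fun i => z (e i) := by
  rw [rename_eq_subst]
  refine (eval_subst (hasSubst_of_constantCoeff_zero (by simp))
    (fun i => (polyNorm_X r (e i)).le) hF hz).trans ?_
  simp only [eval_X]

theorem polyNorm_linear_le (M : Matrix σ σ ℂ) (r : σ → ℝ≥0) (i : σ) :
    polyNorm r (∑ j, M i j • X j : MvPowerSeries σ ℂ) ≤
      ((∑ j, ‖M i j‖₊ * r j : ℝ≥0) : ℝ≥0∞) := by
  classical
  have h : ∀ s : Finset σ, polyNorm r (∑ j ∈ s, M i j • X j : MvPowerSeries σ ℂ) ≤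
      ∑ j ∈ s, ‖M i j‖ₑ * r j := by
    intro s
    induction s using Finset.induction_on with
    | empty => simp [polyNorm_zero]
    | insert j s hj ih =>
      rw [Finset.sum_insert hj, Finset.sum_insert hj]
      refine (polyNorm_add_le _ _ _).trans (add_le_add ?_ ih)
      rw [smul_eq_C_mul]
      exact (polyNorm_mul_le _ _ _).trans_eq (by rw [polyNorm_C, polyNorm_X])
  refine (h _).trans_eq ?_
  push_cast
  rfl

theorem linearSubst_mem_convergent (M : Matrix σ σ ℂ) {r r' : σ → ℝ≥0}
    (h : ∀ i, ∑ j, ‖M i j‖₊ * r j ≤ r' i) {F : MvPowerSeries σ ℂ} (hF : F ∈ convergent r') :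
    linearSubst M F ∈ convergent r := by
  rw [linearSubst, substAlgHom_apply]
  exact ne_top_of_le_ne_top hF (polyNorm_subst_le (hasSubst_linear M) (fun i =>
    (polyNorm_linear_le M r i).trans (ENNReal.coe_le_coe.2 (h i))) F)

theorem eval_linearSubst (M : Matrix σ σ ℂ) {r r' : σ → ℝ≥0}
    (h : ∀ i, ∑ j, ‖M i j‖₊ * r j ≤ r' i) {F : MvPowerSeries σ ℂ} (hF : F ∈ convergent r')
    {z : σ → ℂ} (hz : ∀ i, ‖z i‖₊ ≤ r i) :
    eval (linearSubst M F) z = eval F (M.mulVec z) := by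
  rw [linearSubst, substAlgHom_apply, eval_subst (hasSubst_linear M) (fun i =>
    (polyNorm_linear_le M r i).trans (ENNReal.coe_le_coe.2 (h i))) hF hz]
  congr 1
  funext i
  have : (∑ j, M i j • X j : MvPowerSeries σ ℂ) =
      ((∑ j, ⟨C (M i j), C_mem_convergent _⟩ * ⟨X j, X_mem_convergent _⟩ : convergent r) :
        MvPowerSeries σ ℂ) := by
    simp [smul_eq_C_mul]
  rw [this, ← evalHom_apply hz, map_sum]
  simp only [map_mul, evalHom_apply, eval_C, eval_X]
  rfl

end Substitution

/-- Every monomial present contains at least one variable from `s`, so shrinking these radii by `t`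
gains one factor `t`. -/
theorem polyNorm_le_mul_of_le {σ : Type*} [Fintype σ] {r r' : σ → ℝ≥0} {t : ℝ≥0} {s : Set σ}
    (h : r' ≤ r) (hs : ∀ i ∈ s, r' i ≤ t * r i) {F : MvPowerSeries σ ℂ}
    (hF : ∀ α, coeff α F ≠ 0 → ∃ i ∈ s, α i ≠ 0) : polyNorm r' F ≤ t * polyNorm r F := by
  classical
  unfold polyNorm
  rw [← ENNReal.tsum_mul_left]
  refine ENNReal.tsum_le_tsum fun α => ?_
  by_cases hα : coeff α F = 0
  · simp [hα]
  obtain ⟨i, hi, hαi⟩ := hF α hα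
  rw [mul_left_comm]
  refine mul_le_mul_right ?_ _
  rw [← Finset.mul_prod_erase _ _ (Finset.mem_univ i), ← Finset.mul_prod_erase Finset.univ
    (fun i => (r i : ℝ≥0∞) ^ α i) (Finset.mem_univ i), ← mul_assoc]
  refine mul_le_mul' ?_ (Finset.prod_le_prod' fun j _ => pow_le_pow_left'
    (ENNReal.coe_le_coe.2 (h j)) _)
  obtain ⟨k, hk⟩ := Nat.exists_eq_succ_of_ne_zero hαi
  rw [hk, pow_succ', pow_succ', ← mul_assoc]
  exact mul_le_mul' (by exact_mod_cast hs i hi)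
    (pow_le_pow_left' (ENNReal.coe_le_coe.2 (h i)) _)

theorem eventually_mul_lt {N δ : ℝ≥0∞} (hN : N ≠ ⊤) (hδ : δ ≠ 0) :
    ∀ᶠ u : ℝ≥0 in 𝓝[>] 0, (u : ℝ≥0∞) * N < δ := by
  have h : Tendsto (fun u : ℝ≥0 => (u : ℝ≥0∞) * N) (𝓝 0) (𝓝 (((0 : ℝ≥0) : ℝ≥0∞) * N)) :=
    ENNReal.Tendsto.mul_const (ENNReal.continuous_coe.tendsto 0) (Or.inr hN)
  rw [ENNReal.coe_zero, zero_mul] at h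
  exact (h.eventually (gt_mem_nhds (pos_iff_ne_zero.2 hδ))).filter_mono nhdsWithin_le_nhds

/-! ### Expansion in the first variable and Weierstrass division -/

section Slices

variable {d : ℕ} {r : Fin (d + 1) → ℝ≥0}

/-- The coefficient of `X₀ᵏ`. -/
noncomputable def slice (k : ℕ) (F : MvPowerSeries (Fin (d + 1)) ℂ) : MvPowerSeries (Fin d) ℂ :=
  fun β => coeff (Finsupp.cons k β) F

/-- The quotient of `F` by `X₀^q`. -/
noncomputable def upper (q : ℕ) (F : MvPowerSeries (Fin (d + 1)) ℂ) :
    MvPowerSeries (Fin (d + 1)) ℂ :=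
  fun α => coeff (α + Finsupp.single 0 q) F

/-- The part of `F` of degree less than `q` in `X₀`. -/
noncomputable def lower (q : ℕ) (F : MvPowerSeries (Fin (d + 1)) ℂ) :
    MvPowerSeries (Fin (d + 1)) ℂ :=
  fun α => if α 0 < q then coeff α F else 0

variable {q : ℕ} {F G : MvPowerSeries (Fin (d + 1)) ℂ}

theorem coeff_slice (k : ℕ) (F : MvPowerSeries (Fin (d + 1)) ℂ) (β : Fin d →₀ ℕ) :
    coeff β (slice k F) = coeff (Finsupp.cons k β) F := rfl

theorem coeff_upper (q : ℕ) (F : MvPowerSeries (Fin (d + 1)) ℂ) (α : Fin (d + 1) →₀ ℕ) :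
    coeff α (upper q F) = coeff (α + Finsupp.single 0 q) F := rfl

theorem coeff_lower (q : ℕ) (F : MvPowerSeries (Fin (d + 1)) ℂ) (α : Fin (d + 1) →₀ ℕ) :
    coeff α (lower q F) = if α 0 < q then coeff α F else 0 := rfl

theorem upper_add (q : ℕ) (F G : MvPowerSeries (Fin (d + 1)) ℂ) :
    upper q (F + G) = upper q F + upper q G := by
  ext α; simp [coeff_upper]

theorem upper_sub (q : ℕ) (F G : MvPowerSeries (Fin (d + 1)) ℂ) :
    upper q (F - G) = upper q F - upper q G := by
  ext α; simp [coeff_upper]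

theorem upper_X_pow_mul (q : ℕ) (F : MvPowerSeries (Fin (d + 1)) ℂ) :
    upper q (X 0 ^ q * F) = F := by
  ext α
  rw [coeff_upper, X_pow_eq, add_comm α, coeff_add_monomial_mul, one_mul]

theorem lower_add_X_pow_mul_upper (q : ℕ) (F : MvPowerSeries (Fin (d + 1)) ℂ) :
    lower q F + X 0 ^ q * upper q F = F := by
  classical
  ext α
  rw [map_add, coeff_lower, X_pow_eq, coeff_monomial_mul, one_mul]
  by_cases h : α 0 < q
  · rw [if_pos h, if_neg, add_zero]
    rw [Finsupp.single_le_iff]; omega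
  · have hle : Finsupp.single 0 q ≤ α := by rw [Finsupp.single_le_iff]; omega
    rw [if_neg h, if_pos hle, zero_add, coeff_upper, tsub_add_cancel_of_le hle]

theorem lower_eq_self (h : upper q F = 0) : lower q F = F := by
  have := lower_add_X_pow_mul_upper q F
  rwa [h, mul_zero, add_zero] at this

theorem polyNorm_lower_le (q : ℕ) (F : MvPowerSeries (Fin (d + 1)) ℂ) :
    polyNorm r (lower q F) ≤ polyNorm r F := by
  refine ENNReal.tsum_le_tsum fun α => mul_le_mul_left ?_ _
  rw [coeff_lower]
  split_ifs <;> simp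

theorem mul_polyNorm_upper_le (q : ℕ) (F : MvPowerSeries (Fin (d + 1)) ℂ) :
    (r 0 : ℝ≥0∞) ^ q * polyNorm r (upper q F) ≤ polyNorm r F := by
  unfold polyNorm
  rw [← ENNReal.tsum_mul_left]
  refine le_trans (le_of_eq (tsum_congr fun α => ?_))
    (ENNReal.tsum_comp_le_tsum_of_injective (add_left_injective (Finsupp.single (0 : Fin (d + 1)) q))
      (fun α => ‖coeff α F‖ₑ * ∏ i, (r i : ℝ≥0∞) ^ α i))
  rw [coeff_upper]
  simp only [Finsupp.add_apply, pow_add, Finset.prod_mul_distrib]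
  rw [Finset.prod_eq_single (0 : Fin (d + 1)) (f := fun i => (r i : ℝ≥0∞) ^ (Finsupp.single 0 q) i)]
  · simp; ring
  · intro j _ hj; simp [Finsupp.single_eq_of_ne hj]
  · simp

theorem mul_polyNorm_slice_le (k : ℕ) (F : MvPowerSeries (Fin (d + 1)) ℂ) :
    (r 0 : ℝ≥0∞) ^ k * polyNorm (fun i => r i.succ) (slice k F) ≤ polyNorm r F := by
  unfold polyNorm
  rw [← ENNReal.tsum_mul_left]
  refine le_trans (le_of_eq (tsum_congr fun α => ?_))
    (ENNReal.tsum_comp_le_tsum_of_injective (f := fun β : Fin d →₀ ℕ => Finsupp.cons k β)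
      (fun β β' h => by simpa using congrArg Finsupp.tail h)
      (fun α => ‖coeff α F‖ₑ * ∏ i, (r i : ℝ≥0∞) ^ α i))
  rw [coeff_slice, Fin.prod_univ_succ]
  simp only [Finsupp.cons_zero, Finsupp.cons_succ]
  ring

theorem slice_mem_convergent (h0 : r 0 ≠ 0) (k : ℕ) (hF : F ∈ convergent r) :
    slice k F ∈ convergent fun i => r i.succ := by
  intro h
  have := mul_polyNorm_slice_le (r := r) k F
  rw [h, ENNReal.mul_top (pow_ne_zero _ (ENNReal.coe_ne_zero.2 h0)), top_le_iff] at this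
  exact hF this

theorem coeff_rename_succ (f : MvPowerSeries (Fin d) ℂ) (α : Fin (d + 1) →₀ ℕ) :
    coeff α (rename (Fin.succEmb d) f) = if α 0 = 0 then coeff α.tail f else 0 := by
  have hc : ∀ β : Fin d →₀ ℕ, Finsupp.embDomain (Fin.succEmb d) β =
      Finsupp.cons 0 β := by
    intro β
    ext i
    refine Fin.cases ?_ (fun i => ?_) i
    · rw [Finsupp.embDomain_of_notMem_range]
      · simp
      · rintro ⟨j, hj⟩; exact Fin.succ_ne_zero j hj
    · rw [Finsupp.cons_succ]
      exact Finsupp.embDomain_apply_self _ β i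
  split_ifs with h
  · have : α = Finsupp.embDomain (Fin.succEmb d) α.tail := by
      rw [hc, ← h, Finsupp.cons_tail]
    conv_lhs => rw [this]
    exact coeff_embDomain_rename _ _ _
  · refine coeff_rename_eq_zero (R := ℂ) (f := Fin.succEmb d) f ?_
    rintro ⟨β, rfl⟩
    apply h
    rw [← Finsupp.embDomain_eq_mapDomain, hc, Finsupp.cons_zero]

theorem lower_eq_sum (q : ℕ) (F : MvPowerSeries (Fin (d + 1)) ℂ) :
    lower q F = ∑ k ∈ Finset.range q, rename (Fin.succEmb d) (slice k F) * X 0 ^ k := by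
  classical
  ext α
  rw [coeff_lower, map_sum]
  have h : ∀ k, coeff α (rename (Fin.succEmb d) (slice k F) * X 0 ^ k) =
      if α 0 = k then coeff α F else 0 := by
    intro k
    have hle : Finsupp.single 0 k ≤ α ↔ k ≤ α 0 := Finsupp.single_le_iff
    rw [X_pow_eq, coeff_mul_monomial, mul_one, coeff_rename_succ, coeff_slice]
    by_cases h : α 0 = k
    · rw [if_pos h, if_pos (hle.2 h.ge), if_pos (by simp [h])]
      congr 2
      ext i
      refine Fin.cases ?_ (fun i => ?_) i
      · simp [h]
      · simp [Finsupp.tail_apply]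
    · rw [if_neg h]
      split_ifs with h1 h2
      · rw [hle] at h1; simp at h2; omega
      · rfl
      · rfl
  simp only [h]
  rw [Finset.sum_ite_eq]
  simp

end Slices

/-- Weierstrass division of convergent series, with the polyradius kept. -/
theorem exists_upper_sub_mul_eq_zero {d q : ℕ} {r : Fin (d + 1) → ℝ≥0} (h0 : r 0 ≠ 0)
    {F G : MvPowerSeries (Fin (d + 1)) ℂ} (hG : ∀ m < q, coeff (Finsupp.single 0 m) G = 0)
    (hGq : coeff (Finsupp.single 0 q) G = 1)
    (hv : polyNorm r (1 - upper q G) ≤ 1 / 4)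
    (hl : polyNorm r (lower q G) ≤ (r 0 : ℝ≥0∞) ^ q / 4) (hF : F ∈ convergent r) :
    ∃ Q ∈ convergent r, upper q (F - Q * G) = 0 := by
  classical
  set v := 1 - upper q G
  set l := lower q G
  set c := (r 0 : ℝ≥0∞) ^ q
  have hc0 : c ≠ 0 := pow_ne_zero _ (ENNReal.coe_ne_zero.2 h0)
  have hct : c ≠ ⊤ := ENNReal.pow_ne_top ENNReal.coe_ne_top
  have hup : ∀ f, polyNorm r (upper q f) ≤ polyNorm r f / c := fun f => by
    rw [ENNReal.le_div_iff_mul_le (Or.inl hc0) (Or.inl hct), mul_comm]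
    exact mul_polyNorm_upper_le q f
  have hGeq : G = l + X 0 ^ q * (1 - v) := by
    rw [sub_sub_cancel, lower_add_X_pow_mul_upper]
  -- With `G = l + X₀^q (1 - v)`, the equation `upper q (F - Q G) = 0` becomes the fixed point
  -- equation `Q = upper q F + Q v - upper q (Q l)`.
  obtain ⟨Q, hQ, hQB⟩ := exists_fixedPoint_polyNorm_le (r := r)
    (fun Q => upper q F + Q * v - upper q (Q * l))
    -- With this weight both corrections are contracting: `v` has no constant term, and every
    -- monomial of `l` contains a variable other than `X₀`, so it contributes at least `q + 1`, of
    -- which `upper q` takes away only `q`.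
    (fun α => α 0 + (q + 1) * ∑ i : Fin d, α i.succ)
    (by
      intro k Q Q' h α hα
      have hD : ∀ β : Fin (d + 1) →₀ ℕ, β 0 + (q + 1) * ∑ i : Fin d, β i.succ < k →
        coeff β (Q - Q') = 0 := fun β hβ => by rw [map_sub, h β hβ, sub_self]
      rw [← sub_eq_zero, ← map_sub]
      have : upper q F + Q * v - upper q (Q * l) - (upper q F + Q' * v - upper q (Q' * l)) =
          (Q - Q') * v - upper q ((Q - Q') * l) := by
        rw [sub_mul Q Q' l, upper_sub]; ring
      rw [this, map_sub, coeff_upper, coeff_mul, coeff_mul, Finset.sum_eq_zero, Finset.sum_eq_zero,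
        sub_zero]
      · intro p hp
        have hp := Finset.HasAntidiagonal.mem_antidiagonal.1 hp
        by_cases hl0 : coeff p.2 l = 0
        · rw [hl0, mul_zero]
        rw [hD, zero_mul]
        have h1 : ∀ i, p.1 i + p.2 i = α i + Finsupp.single (0 : Fin (d + 1)) q i := fun i => by
          rw [← Finsupp.add_apply, hp, Finsupp.add_apply]
        have h2 : ∑ i : Fin d, p.1 i.succ + ∑ i : Fin d, p.2 i.succ = ∑ i : Fin d, α i.succ := by
          rw [← Finset.sum_add_distrib]
          exact Finset.sum_congr rfl fun i _ => by rw [h1]; simp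
        have h3 : ∑ i : Fin d, p.2 i.succ ≠ 0 := by
          intro h3
          have h4 : p.2 = Finsupp.single 0 (p.2 0) := by
            ext i
            refine Fin.cases ?_ (fun i => ?_) i
            · simp
            · have := Finset.sum_eq_zero_iff.1 h3 i (Finset.mem_univ _)
              rw [this]; simp
          apply hl0
          rw [coeff_lower]
          split_ifs with h5
          · rw [h4]; exact hG _ h5
          · rfl
        have h4 := h1 0
        rw [Finsupp.single_eq_same] at h4
        have h5 : (q + 1) * ∑ i : Fin d, p.1 i.succ + (q + 1) * ∑ i : Fin d, p.2 i.succ =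
          (q + 1) * ∑ i : Fin d, α i.succ := by rw [← mul_add, h2]
        have h6 : (q + 1) * 1 ≤ (q + 1) * ∑ i : Fin d, p.2 i.succ :=
          Nat.mul_le_mul_left _ (Nat.one_le_iff_ne_zero.2 h3)
        omega
      · intro p hp
        have hp := Finset.HasAntidiagonal.mem_antidiagonal.1 hp
        by_cases hp2 : p.2 = 0
        · have : coeff p.2 v = 0 := by
            rw [hp2, map_sub, coeff_upper, zero_add, hGq]; simp
          rw [this, mul_zero]
        rw [hD, zero_mul]
        have h1 : ∀ i, p.1 i + p.2 i = α i := fun i => by rw [← Finsupp.add_apply, hp]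
        have h2 : ∑ i : Fin d, p.1 i.succ + ∑ i : Fin d, p.2 i.succ = ∑ i : Fin d, α i.succ := by
          rw [← Finset.sum_add_distrib]
          exact Finset.sum_congr rfl fun i _ => h1 _
        have h3 : p.2 0 + ∑ i : Fin d, p.2 i.succ ≠ 0 := by
          rw [← Fin.sum_univ_succ]
          intro h
          apply hp2
          ext i
          simpa using Finset.sum_eq_zero_iff.1 h i (Finset.mem_univ _)
        have h5 : (q + 1) * ∑ i : Fin d, p.1 i.succ + (q + 1) * ∑ i : Fin d, p.2 i.succ =
          (q + 1) * ∑ i : Fin d, α i.succ := by rw [← mul_add, h2]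
        have h6 : 1 * ∑ i : Fin d, p.2 i.succ ≤ (q + 1) * ∑ i : Fin d, p.2 i.succ :=
          Nat.mul_le_mul_right _ (by omega)
        have h4 := h1 0
        omega)
    -- With `b` the bound for `upper q F`, the factors `1 / 4` turn the ball of radius `2b` into
    -- itself: `b + b/2 + b/2 = 2b`.
    (B := 2 * (polyNorm r F / c))
    (by
      intro Q hQ
      set b := polyNorm r F / c
      have e1 : polyNorm r (Q * v) ≤ b / 2 := by
        refine (polyNorm_mul_le _ _ _).trans ((mul_le_mul' hQ hv).trans_eq ?_)
        rw [mul_comm 2 b, mul_assoc, div_eq_mul_inv b]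
        congr 1
        rw [← ENNReal.toReal_eq_toReal_iff' (by finiteness) (by finiteness)]
        norm_num
      have e2 : polyNorm r (upper q (Q * l)) ≤ b / 2 := by
        refine (hup _).trans ?_
        rw [ENNReal.div_le_iff hc0 hct]
        refine (polyNorm_mul_le _ _ _).trans ((mul_le_mul' hQ hl).trans_eq ?_)
        rw [mul_comm 2 b, mul_assoc, div_eq_mul_inv b, mul_assoc, div_eq_mul_inv]
        congr 1
        rw [mul_left_comm, mul_comm]
        congr 1
        rw [← ENNReal.toReal_eq_toReal_iff' (by finiteness) (by finiteness)]
        norm_num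
      calc polyNorm r (upper q F + Q * v - upper q (Q * l))
          ≤ b + b / 2 + b / 2 := (polyNorm_sub_le _ _ _).trans (add_le_add
            ((polyNorm_add_le _ _ _).trans (add_le_add (hup F) e1)) e2)
        _ = 2 * b := by rw [add_assoc, ENNReal.add_halves, two_mul])
  refine ⟨Q, ne_top_of_le_ne_top (ENNReal.mul_ne_top (by simp) (ENNReal.div_ne_top hF hc0)) hQB, ?_⟩
  have h1 : Q * G = Q * l + X 0 ^ q * (Q * (1 - v)) := by
    conv_lhs => rw [hGeq]
    ring
  rw [upper_sub, h1, upper_add, upper_X_pow_mul]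
  linear_combination hQ

end MvPowerSeries

/-! ## The Nullstellensatz for isolated zeros -/

namespace MvPowerSeries

open scoped NNReal ENNReal

/-- If `‖t‖ > a`, each of the `q` terms is at most `‖t‖ ^ q / (q + 1)`, so their sum cannot have
norm `‖t‖ ^ q`. -/
theorem norm_le_of_pow_eq_sum {q : ℕ} {a : ℝ} (ha : 0 < a) (c : ℕ → ℂ) {t : ℂ}
    (hc : ∀ k < q, ‖c k‖ ≤ a ^ (q - k) / (q + 1)) (ht : t ^ q = ∑ k ∈ Finset.range q, c k * t ^ k) :
    ‖t‖ ≤ a := by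
  by_contra! h
  have ht0 : 0 < ‖t‖ := ha.trans h
  have h1 : ‖t‖ ^ q ≤ ∑ k ∈ Finset.range q, ‖t‖ ^ q / (q + 1) := by
    rw [← norm_pow, ht]
    refine (norm_sum_le _ _).trans (Finset.sum_le_sum fun k hk => ?_)
    have hk := Finset.mem_range.1 hk
    rw [norm_mul, norm_pow, ← ht, norm_pow]
    calc ‖c k‖ * ‖t‖ ^ k ≤ a ^ (q - k) / (q + 1) * ‖t‖ ^ k := by gcongr; exact hc k hk
      _ ≤ ‖t‖ ^ (q - k) / (q + 1) * ‖t‖ ^ k := by gcongr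
      _ = ‖t‖ ^ q / (q + 1) := by
        rw [div_mul_eq_mul_div, ← pow_add, Nat.sub_add_cancel hk.le]
  rw [Finset.sum_const, Finset.card_range, nsmul_eq_mul, mul_div_assoc', mul_comm] at h1
  rw [le_div_iff₀ (by positivity)] at h1
  have : 0 < ‖t‖ ^ q := by positivity
  nlinarith

/-- The members of a family of polynomials have a common root among the roots of `P` as soon as
sufficiently many of the resultants of `P` with `∑ τⁱ pᵢ` vanish. -/
theorem exists_common_root {m q : ℕ} {P : Polynomial ℂ} (hP : P.Monic) (hq : P.natDegree = q)
    (p : Fin m → Polynomial ℂ) (hp : ∀ i, (p i).natDegree ≤ q + 1)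
    (h : ∀ τ : Fin (q * m + 1),
      P.resultant (∑ i : Fin m, Polynomial.C ((τ : ℂ) ^ (i : ℕ)) * p i) q (q + 1) = 0) :
    ∃ t, P.IsRoot t ∧ ∀ i, (p i).eval t = 0 := by
  classical
  have h1 : ∀ τ : Fin (q * m + 1), ∃ t ∈ P.roots.toFinset,
      ∑ i : Fin m, (τ : ℂ) ^ (i : ℕ) * (p i).eval t = 0 := by
    intro τ
    have hd : (∑ i : Fin m, Polynomial.C ((τ : ℂ) ^ (i : ℕ)) * p i).natDegree ≤ q + 1 :=
      Polynomial.natDegree_sum_le_of_forall_le _ _ fun i _ =>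
        (Polynomial.natDegree_C_mul_le _ _).trans (hp i)
    have h2 := Polynomial.resultant_eq_prod_eval P _ (q + 1) hd (IsAlgClosed.splits P)
    rw [hq, h τ, hP.leadingCoeff, one_pow, one_mul, eq_comm, Multiset.prod_eq_zero_iff,
      Multiset.mem_map] at h2
    obtain ⟨t, ht, ht0⟩ := h2
    refine ⟨t, Multiset.mem_toFinset.2 ht, ?_⟩
    simpa [Polynomial.eval_finsetSum] using ht0
  choose t ht ht0 using h1
  -- Pigeonhole: `P` has at most `q` roots and there are `q * m + 1` values of `τ`, so one root `x`
  -- serves more than `m` of them.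
  obtain ⟨x, hx, hcard⟩ := Finset.exists_lt_card_fiber_of_mul_lt_card_of_maps_to
    (s := Finset.univ) (t := P.roots.toFinset) (f := t) (n := m) (fun τ _ => ht τ) (by
      rw [Finset.card_univ, Fintype.card_fin]
      have : P.roots.toFinset.card ≤ q :=
        (Multiset.toFinset_card_le _).trans (hq ▸ Polynomial.card_roots' P)
      exact Nat.lt_succ_of_le (Nat.mul_le_mul_right m this))
  refine ⟨x, Polynomial.isRoot_of_mem_roots (Multiset.mem_toFinset.1 hx), ?_⟩
  -- As a polynomial in `τ`, with the values `p i` at `x` as coefficients, this has degree below `m`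
  -- if nonzero, but more than `m` zeros.
  let f : Polynomial ℂ := ∑ i : Fin m, Polynomial.monomial (i : ℕ) ((p i).eval x)
  have hf : f = 0 := by
    by_contra hf
    have hdeg : f.natDegree ≤ m - 1 := Polynomial.natDegree_sum_le_of_forall_le _ _ fun i _ =>
      (Polynomial.natDegree_monomial_le _).trans (by omega)
    have hinj : Function.Injective fun τ : Fin (q * m + 1) => ((τ : ℕ) : ℂ) :=
      Nat.cast_injective.comp Fin.val_injective
    have h3 : (Finset.univ.filter fun τ => t τ = x).image
        (fun τ : Fin (q * m + 1) => ((τ : ℕ) : ℂ)) ⊆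
        f.roots.toFinset := by
      intro y hy
      obtain ⟨τ, hτ, rfl⟩ := Finset.mem_image.1 hy
      rw [Finset.mem_filter] at hτ
      rw [Multiset.mem_toFinset, Polynomial.mem_roots hf, Polynomial.IsRoot.def,
        Polynomial.eval_finsetSum, ← ht0 τ, hτ.2]
      refine Finset.sum_congr rfl fun i _ => ?_
      rw [Polynomial.eval_monomial, mul_comm]
    have h4 := Finset.card_le_card h3
    rw [Finset.card_image_of_injective _ hinj] at h4
    have h5 : f.roots.toFinset.card ≤ f.natDegree :=
      (Multiset.toFinset_card_le _).trans (Polynomial.card_roots' f)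
    omega
  intro i
  have := congrArg (fun g => Polynomial.coeff g (i : ℕ)) hf
  simpa [f, Polynomial.finsetSum_coeff, Polynomial.coeff_monomial, Fin.val_inj] using this

/-- The polynomial `∑_{k < q} b_k Tᵏ`. -/
noncomputable def truncPoly {B : Type*} [CommRing B] (q : ℕ) (b : ℕ → B) : Polynomial B :=
  ∑ k ∈ Finset.range q, Polynomial.monomial k (b k)

theorem natDegree_truncPoly_le {B : Type*} [CommRing B] (q : ℕ) (b : ℕ → B) :
    (truncPoly q b).natDegree ≤ q :=
  Polynomial.natDegree_sum_le_of_forall_le _ _ fun _ hk =>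
    (Polynomial.natDegree_monomial_le _).trans (Finset.mem_range.1 hk).le

theorem degree_truncPoly_lt {B : Type*} [CommRing B] (q : ℕ) (b : ℕ → B) :
    (truncPoly q b).degree < q := by
  refine (Polynomial.degree_sum_le _ _).trans_lt ((Finset.sup_lt_iff (WithBot.bot_lt_coe q)).2
    fun k hk => (Polynomial.degree_monomial_le _ _).trans_lt ?_)
  exact Nat.cast_lt.2 (Finset.mem_range.1 hk)

theorem upper_mem_convergent {d q : ℕ} {r : Fin (d + 1) → ℝ≥0} (h0 : r 0 ≠ 0)
    {F : MvPowerSeries (Fin (d + 1)) ℂ} (hF : F ∈ convergent r) : upper q F ∈ convergent r := by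
  intro h
  have := mul_polyNorm_upper_le (r := r) q F
  rw [h, ENNReal.mul_top (pow_ne_zero _ (ENNReal.coe_ne_zero.2 h0)), top_le_iff] at this
  exact hF this

theorem eval_lower {d q : ℕ} {r : Fin (d + 1) → ℝ≥0} (h0 : r 0 ≠ 0)
    {F : MvPowerSeries (Fin (d + 1)) ℂ} (hF : F ∈ convergent r) {z : Fin (d + 1) → ℂ}
    (hz : ∀ i, ‖z i‖₊ ≤ r i) :
    eval (lower q F) z = ∑ k ∈ Finset.range q, eval (slice k F) (fun i => z i.succ) * z 0 ^ k := by
  have hs : ∀ k, slice k F ∈ convergent fun i => r i.succ := fun k => slice_mem_convergent h0 k hF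
  have hr : ∀ k, rename (Fin.succEmb d) (slice k F) ∈ convergent r := fun k =>
    ne_top_of_le_ne_top (hs k) (polyNorm_rename (Fin.succEmb d) r _)
  have h : lower q F = ((∑ k ∈ Finset.range q, (⟨_, hr k⟩ : convergent r) *
      (⟨X 0, X_mem_convergent 0⟩ : convergent r) ^ k : convergent r) :
        MvPowerSeries (Fin (d + 1)) ℂ) := by
    rw [lower_eq_sum]; simp
  rw [h, ← evalHom_apply hz, map_sum]
  refine Finset.sum_congr rfl fun k _ => ?_
  rw [map_mul, map_pow, evalHom_apply, evalHom_apply, eval_X]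
  congr 1
  exact eval_rename (Fin.succEmb d) (hs k) hz

/-- On the `X₀`-axis `G` starts with `X₀^q`, so `Q * G` starts with `Q(0) X₀^q`. -/
theorem coeff_single_mul_of_regular {d q : ℕ} {G : MvPowerSeries (Fin (d + 1)) ℂ}
    (hG : ∀ k < q, coeff (Finsupp.single 0 k) G = 0) (hGq : coeff (Finsupp.single 0 q) G = 1)
    (Q : MvPowerSeries (Fin (d + 1)) ℂ) {k : ℕ} (hk : k ≤ q) :
    coeff (Finsupp.single 0 k) (Q * G) = if k = q then constantCoeff Q else 0 := by
  classical
  have haxis : ∀ p ∈ Finset.HasAntidiagonal.antidiagonal (Finsupp.single (0 : Fin (d + 1)) k),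
      p.1 = Finsupp.single 0 (p.1 0) ∧ p.2 = Finsupp.single 0 (p.2 0) ∧ p.1 0 + p.2 0 = k := by
    intro p hp
    have hp := Finset.HasAntidiagonal.mem_antidiagonal.1 hp
    have h0 : ∀ i : Fin d, p.1 i.succ = 0 ∧ p.2 i.succ = 0 := fun i => by
      have := DFunLike.congr_fun hp i.succ
      simp at this
      exact this
    refine ⟨?_, ?_, ?_⟩
    · ext i
      refine Fin.cases (by simp) (fun i => ?_) i
      rw [(h0 i).1]; simp
    · ext i
      refine Fin.cases (by simp) (fun i => ?_) i
      rw [(h0 i).2]; simp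
    · have := DFunLike.congr_fun hp 0
      simpa using this
  rw [coeff_mul]
  split_ifs with h
  · subst h
    rw [Finset.sum_eq_single (0, Finsupp.single 0 k)]
    · rw [hGq, mul_one]; rfl
    · intro p hp hne
      obtain ⟨h1, h2, h3⟩ := haxis p hp
      rw [h2, hG, mul_zero]
      by_contra hlt
      apply hne
      ext1
      · rw [h1, show p.1 0 = 0 by omega, Finsupp.single_zero]
      · rw [h2, show p.2 0 = k by omega]
    · intro h
      exact absurd (Finset.HasAntidiagonal.mem_antidiagonal.2 (zero_add _)) h
  · refine Finset.sum_eq_zero fun p hp => ?_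
    obtain ⟨h1, h2, h3⟩ := haxis p hp
    rw [h2, hG _ (by omega), mul_zero]

/-- Weierstrass preparation and division on a polydisc adapted to the zeros of the Weierstrass
polynomial. -/
theorem exists_polyradius_division {d q m : ℕ} {g : Fin m → MvPowerSeries (Fin (d + 1)) ℂ}
    {r : Fin (d + 1) → ℝ≥0} (hr : ∀ i, 0 < r i) (hg : ∀ i, g i ∈ convergent r)
    {G : MvPowerSeries (Fin (d + 1)) ℂ} (hGr : G ∈ convergent r)
    (hG : ∀ k < q, coeff (Finsupp.single 0 k) G = 0) (hGq : coeff (Finsupp.single 0 q) G = 1) :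
    ∃ R : Fin (d + 1) → ℝ≥0, (∀ i, 0 < R i) ∧ R ≤ r ∧ ∃ Q ∈ convergent R,
      upper q (X 0 ^ q - Q * G) = 0 ∧ polyNorm R (Q - 1) < 1 ∧
      (∀ k < q, constantCoeff (slice k (X 0 ^ q - Q * G)) = 0 ∧
        polyNorm (fun i => R i.succ) (slice k (X 0 ^ q - Q * G)) ≤
          ((R 0 ^ (q - k) / (q + 1) : ℝ≥0) : ℝ≥0∞)) ∧
      ∀ i, ∃ Q' ∈ convergent R, upper q (g i - Q' * G) = 0 := by
  classical
  have hsm : ∀ᶠ u : ℝ≥0 in 𝓝[>] 0, u ≤ 1 ∧ 0 < u := by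
    refine Eventually.and ?_ self_mem_nhdsWithin
    exact (ge_mem_nhds one_pos : ∀ᶠ u : ℝ≥0 in 𝓝 0, u ≤ 1).filter_mono nhdsWithin_le_nhds
  have hv : 1 - upper q G ∈ convergent r :=
    sub_mem (one_mem _) (upper_mem_convergent (hr 0).ne' hGr)
  have hscale : ∀ {t : ℝ≥0} {r r' : Fin (d + 1) → ℝ≥0} {F : MvPowerSeries (Fin (d + 1)) ℂ},
      (∀ i, r' i ≤ t * r i) → r' ≤ r → constantCoeff F = 0 →
        polyNorm r' F ≤ t * polyNorm r F := by
    intro t r r' F h1 h2 hF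
    refine polyNorm_le_mul_of_le h2 (s := Set.univ) (fun i _ => h1 i) fun α hα => ?_
    by_contra! h
    exact hα (by rw [show α = 0 from Finsupp.ext fun i => h i trivial]; exact hF)
  -- All radii are shrunk together, since `1 - upper q G` has no constant term.
  obtain ⟨t, ht, ht1, ht0⟩ := ((eventually_mul_lt (δ := 1 / 4) hv (by simp)).and hsm).exists
  let r₁ : Fin (d + 1) → ℝ≥0 := fun i => t * r i
  have hr₁ : r₁ ≤ r := fun i => mul_le_of_le_one_left' ht1
  have hr₁0 : ∀ i, 0 < r₁ i := fun i => mul_pos ht0 (hr i)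
  have hv₁ : polyNorm r₁ (1 - upper q G) ≤ 1 / 4 := by
    refine le_trans (hscale (fun i => le_rfl) hr₁ ?_) ht.le
    rw [← coeff_zero_eq_constantCoeff_apply, map_sub, coeff_upper, zero_add, hGq]
    simp
  -- Now only the radii of the other variables shrink, so that `lower q G` becomes small against the
  -- fixed `r₁ 0 ^ q`; this works because `lower q G` contains no pure power of `X₀`.
  obtain ⟨ε, hε, hε1, hε0⟩ := ((eventually_mul_lt (N := polyNorm r₁ (lower q G))
    (δ := (r₁ 0 : ℝ≥0∞) ^ q / 4)
    (ne_top_of_le_ne_top (convergent_anti hr₁ hGr) (polyNorm_lower_le q G))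
    (ENNReal.div_ne_zero.2 ⟨pow_ne_zero _ (ENNReal.coe_ne_zero.2 (hr₁0 0).ne'), by simp⟩)).and
    hsm).exists
  let r₂ : Fin (d + 1) → ℝ≥0 := Fin.cons (r₁ 0) fun i => ε * r₁ i.succ
  have hr₂ : r₂ ≤ r₁ := fun i => Fin.cases le_rfl (fun i => mul_le_of_le_one_left' hε1) i
  have hr₂0 : ∀ i, 0 < r₂ i := fun i => Fin.cases (hr₁0 0) (fun i => mul_pos hε0 (hr₁0 _)) i
  have hl : polyNorm r₂ (lower q G) ≤ (r₂ 0 : ℝ≥0∞) ^ q / 4 := by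
    refine le_trans (polyNorm_le_mul_of_le hr₂ (s := {i | i ≠ 0}) (t := ε) ?_ ?_) hε.le
    · intro i hi
      obtain ⟨i, rfl⟩ := Fin.exists_succ_eq.2 hi
      exact le_rfl
    · intro α hα
      by_contra! h
      apply hα
      rw [coeff_lower]
      split_ifs with h1
      · have : α = Finsupp.single 0 (α 0) := by
          ext i
          refine Fin.cases (by simp) (fun i => ?_) i
          rw [h _ (Fin.succ_ne_zero i)]; simp
        rw [this]
        exact hG _ h1
      · rfl
  have hdiv : ∀ F ∈ convergent r, ∃ Q ∈ convergent r₂, upper q (F - Q * G) = 0 := fun F hF =>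
    exists_upper_sub_mul_eq_zero (hr₂0 0).ne' hG hGq ((polyNorm_mono hr₂ _).trans hv₁) hl
      (convergent_anti (hr₂.trans hr₁) hF)
  obtain ⟨Q, hQ, hQ0⟩ := hdiv (X 0 ^ q) (pow_mem (X_mem_convergent 0) q)
  have hX : ∀ k, coeff (Finsupp.single 0 k) (X 0 ^ q : MvPowerSeries (Fin (d + 1)) ℂ) =
      if k = q then 1 else 0 := fun k => by
    rw [X_pow_eq, coeff_monomial]
    by_cases h : k = q
    · rw [h, if_pos rfl, if_pos rfl]
    · rw [if_neg h, if_neg fun h' => h (Finsupp.single_injective _ h')]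
  have hQ1 : constantCoeff Q = 1 := by
    have := congrArg (coeff 0) hQ0
    rw [coeff_upper, zero_add, map_sub, hX, coeff_single_mul_of_regular hG hGq _ le_rfl,
      if_pos rfl, if_pos rfl, map_zero] at this
    linear_combination -this
  have hslice : ∀ k < q, constantCoeff (slice k (X 0 ^ q - Q * G)) = 0 := fun k hk => by
    have hc : Finsupp.cons k (0 : Fin d →₀ ℕ) = Finsupp.single 0 k := by
      ext i
      refine Fin.cases (by simp) (fun i => by simp) i
    rw [← coeff_zero_eq_constantCoeff_apply, coeff_slice, hc, map_sub, hX,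
      coeff_single_mul_of_regular hG hGq _ hk.le, if_neg hk.ne, if_neg hk.ne, sub_zero]
  -- Since `Q(0) = 1`, a further common shrinking keeps `Q` within distance less than `1` of `1`,
  -- hence without zeros on the polydisc.
  obtain ⟨u, hu, hu1, hu0⟩ := ((eventually_mul_lt (N := polyNorm r₂ (Q - 1)) (δ := 1)
    (sub_mem hQ (one_mem _)) one_ne_zero).and hsm).exists
  have hconv : ∀ k, slice k (X 0 ^ q - Q * G) ∈ convergent fun i => r₂ i.succ := fun k =>
    slice_mem_convergent (hr₂0 0).ne' k (sub_mem (pow_mem (X_mem_convergent 0) q)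
      (mul_mem hQ (convergent_anti (hr₂.trans hr₁) hGr)))
  have hev : ∀ k ∈ Finset.range q, ∀ᶠ w : ℝ≥0 in 𝓝[>] 0,
      (w : ℝ≥0∞) * polyNorm (fun i => r₂ i.succ) (slice k (X 0 ^ q - Q * G)) <
        (((u * r₂ 0) ^ (q - k) / (q + 1) : ℝ≥0) : ℝ≥0∞) := fun k _ => by
    refine eventually_mul_lt (hconv k) (ENNReal.coe_ne_zero.2 (ne_of_gt ?_))
    have := mul_pos hu0 (hr₂0 0)
    positivity
  -- Finally the other variables shrink once more, making the Weierstrass coefficients so small that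
  -- all roots stay within the first radius. Taking `w ≤ u` keeps the earlier bound on `Q - 1`.
  obtain ⟨w, hw, ⟨hw1, hw0⟩, hwu⟩ := (((eventually_all_finset _).2 hev).and (hsm.and
    ((ge_mem_nhds hu0 : ∀ᶠ w : ℝ≥0 in 𝓝 0, w ≤ u).filter_mono nhdsWithin_le_nhds))).exists
  let R : Fin (d + 1) → ℝ≥0 := Fin.cons (u * r₂ 0) fun i => w * r₂ i.succ
  have hRs : ∀ i : Fin d, R i.succ = w * r₂ i.succ := fun i => rfl
  have hRz : R 0 = u * r₂ 0 := rfl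
  have hRu : ∀ i, R i ≤ u * r₂ i := fun i =>
    Fin.cases le_rfl (fun i => mul_le_mul_left hwu _) i
  have hR : R ≤ r₂ := fun i => (hRu i).trans (mul_le_of_le_one_left' hu1)
  have hR0 : ∀ i, 0 < R i := fun i =>
    Fin.cases (mul_pos hu0 (hr₂0 0)) (fun i => mul_pos hw0 (hr₂0 _)) i
  clear_value R
  refine ⟨R, hR0, hR.trans (hr₂.trans hr₁), Q, convergent_anti hR hQ, hQ0, ?_, fun k hk =>
    ⟨hslice k hk, ?_⟩, fun i => ?_⟩
  · refine lt_of_le_of_lt (hscale hRu hR ?_) hu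
    rw [map_sub, hQ1, map_one, sub_self]
  · refine le_trans (polyNorm_le_mul_of_le (r := fun i => r₂ i.succ) (r' := fun i => R i.succ)
      (s := Set.univ) (t := w) (fun i => hR i.succ) (fun i _ => (hRs i).le) fun α hα => ?_)
      ((hw k (Finset.mem_range.2 hk)).le.trans_eq (by rw [hRz]))
    by_contra! h
    exact hα (by rw [show α = 0 from Finsupp.ext fun i => h i trivial]; exact hslice k hk)
  · obtain ⟨Q', hQ', h⟩ := hdiv (g i) (hg i)
    exact ⟨Q', convergent_anti hR hQ', h⟩

/-- The inductive step of `X_mem_radical_of_isolated_zero`. -/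
theorem X_mem_radical_of_regular {d : ℕ}
    (ih : ∀ (m : ℕ) (g : Fin m → MvPowerSeries (Fin d) ℂ) (r : Fin d → ℝ≥0), (∀ i, 0 < r i) →
      (∀ i, g i ∈ convergent r) →
      (∀ z, (∀ i, ‖z i‖₊ ≤ r i) → (∀ i, eval (g i) z = 0) → z = 0) →
      ∀ j, X j ∈ (Ideal.span (Set.range g)).radical)
    {m : ℕ} (g : Fin m → MvPowerSeries (Fin (d + 1)) ℂ) (r : Fin (d + 1) → ℝ≥0)
    (hr : ∀ i, 0 < r i) (hg : ∀ i, g i ∈ convergent r)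
    (hz : ∀ z, (∀ i, ‖z i‖₊ ≤ r i) → (∀ i, eval (g i) z = 0) → z = 0)
    {i₀ : Fin m} {q : ℕ} (hG : ∀ k < q, coeff (Finsupp.single 0 k) (g i₀) = 0)
    (hGq : coeff (Finsupp.single 0 q) (g i₀) = 1) (j : Fin (d + 1)) :
    X j ∈ (Ideal.span (Set.range g)).radical := by
  classical
  obtain ⟨R, hR0, hRr, Q, hQ, hE0, hQ1, he, hdiv⟩ :=
    exists_polyradius_division hr hg (hg i₀) hG hGq
  choose Q' hQ' hD0 using hdiv
  set G := g i₀ with hGdef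
  set E := X 0 ^ q - Q * G with hEdef
  let D : Fin m → MvPowerSeries (Fin (d + 1)) ℂ := fun i => g i - Q' i * G
  have hgR : ∀ i, g i ∈ convergent R := fun i => convergent_anti hRr (hg i)
  have hER : E ∈ convergent R :=
    sub_mem (pow_mem (X_mem_convergent 0) q) (mul_mem hQ (hgR i₀))
  have hDR : ∀ i, D i ∈ convergent R := fun i => sub_mem (hgR i) (mul_mem (hQ' i) (hgR i₀))
  have hDl : ∀ i, lower q (D i) = D i := fun i => lower_eq_self (hD0 i)
  have hR00 : R 0 ≠ 0 := (hR0 0).ne'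
  let ρ : Fin d → ℝ≥0 := fun i => R i.succ
  let e : ℕ → convergent ρ := fun k => ⟨slice k E, slice_mem_convergent hR00 k hER⟩
  let b : Fin m → ℕ → convergent ρ := fun i k => ⟨slice k (D i), slice_mem_convergent hR00 k (hDR i)⟩
  -- The Weierstrass polynomial of `G`. The `p i` below are the remainders of the `g i` modulo `G`,
  -- all with coefficients convergent on the same smaller polydisc.
  let P : Polynomial (convergent ρ) := Polynomial.X ^ q + truncPoly q fun k => -e k
  have hPm : P.Monic := Polynomial.monic_X_pow_add (degree_truncPoly_lt _ _)
  have hPd : P.natDegree = q :=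
    (Polynomial.natDegree_add_eq_left_of_degree_lt (by
      rw [Polynomial.degree_X_pow]; exact degree_truncPoly_lt _ _)).trans
        (Polynomial.natDegree_X_pow q)
  let p : Fin m → Polynomial (convergent ρ) := fun i => truncPoly q (b i)
  let S : Fin (q * m + 1) → Polynomial (convergent ρ) := fun τ =>
    ∑ i : Fin m, Polynomial.C ((τ : convergent ρ) ^ (i : ℕ)) * p i
  have hSd : ∀ τ, (S τ).natDegree ≤ q + 1 := fun τ =>
    Polynomial.natDegree_sum_le_of_forall_le _ _ fun i _ =>
      (Polynomial.natDegree_C_mul_le _ _).trans ((natDegree_truncPoly_le _ _).trans (by omega))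
  -- The formal degree `q + 1` of the second argument is never zero, so the Bézout identity for the
  -- resultant is available even when `q = 0`.
  let N : Fin (q * m + 1) → convergent ρ := fun τ => P.resultant (S τ) q (q + 1)
  -- The resultants have only the zero `0`: a common zero `z'` gives a common root `t` of the
  -- polynomials, and then `(t, z')` is a common zero of the `g i`, hence the origin.
  have key := ih _ (fun τ => (N τ : MvPowerSeries (Fin d) ℂ)) ρ (fun i => hR0 _) (fun τ => (N τ).2)
    (by
      intro z' hz' hN
      let φ := evalHom ρ z' hz'
      have hφe : ∀ k, φ (e k) = eval (slice k E) z' := fun k => rfl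
      obtain ⟨t, htP, htp⟩ := exists_common_root (m := m) (q := q) (hPm.map φ)
        (by rw [hPm.natDegree_map, hPd]) (fun i => (p i).map φ)
        (fun i => Polynomial.natDegree_map_le.trans ((natDegree_truncPoly_le _ _).trans (by omega)))
        (by
          intro τ
          have h1 : (∑ i : Fin m, Polynomial.C ((τ : ℂ) ^ (i : ℕ)) * (p i).map φ) =
              (S τ).map φ := by
            simp [S, Polynomial.map_sum]
          rw [h1, Polynomial.resultant_map_map]
          exact hN τ)
      have htrunc : ∀ c : ℕ → convergent ρ, ((truncPoly q c).map φ).eval t =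
          ∑ k ∈ Finset.range q, φ (c k) * t ^ k := fun c => by
        simp [truncPoly, Polynomial.map_sum, Polynomial.eval_finsetSum]
      have hroot : t ^ q = ∑ k ∈ Finset.range q, φ (e k) * t ^ k := by
        have h1 : (P.map φ).eval t = 0 := htP
        rw [Polynomial.map_add, Polynomial.eval_add, htrunc, Polynomial.map_pow, Polynomial.map_X,
          Polynomial.eval_pow, Polynomial.eval_X] at h1
        simp only [map_neg, neg_mul, Finset.sum_neg_distrib] at h1
        linear_combination h1
      have ht : ‖t‖ ≤ R 0 := by
        refine norm_le_of_pow_eq_sum (NNReal.coe_pos.2 (hR0 0)) (fun k => φ (e k)) (fun k hk => ?_)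
          hroot
        have h1 := (enorm_eval_le hz' (slice k E)).trans (he k hk).2
        rw [enorm_eq_nnnorm, ENNReal.coe_le_coe, ← NNReal.coe_le_coe] at h1
        simpa [hφe] using h1
      let z : Fin (d + 1) → ℂ := Fin.cons t z'
      have hzR : ∀ i, ‖z i‖₊ ≤ R i := fun i => Fin.cases ht hz' i
      have hEz : eval E z = t ^ q := by
        rw [← lower_eq_self hE0, eval_lower hR00 hER hzR, hroot]
        rfl
      have hDz : ∀ i, eval (D i) z = 0 := fun i => by
        rw [← hDl i, eval_lower hR00 (hDR i) hzR, ← htp i, htrunc]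
        rfl
      have hQz : eval Q z ≠ 0 := by
        intro h0
        have h1 := (enorm_eval_le hzR (Q - 1)).trans_lt hQ1
        have h2 : eval (Q - 1) z = -1 := by
          have := map_sub (evalHom R z hzR) ⟨Q, hQ⟩ 1
          rw [map_one, evalHom_apply, evalHom_apply] at this
          simpa [h0] using this
        rw [h2] at h1
        simp at h1
      have hsub : ∀ {F F' : MvPowerSeries (Fin (d + 1)) ℂ}, F ∈ convergent R → F' ∈ convergent R →
          eval (F - F') z = eval F z - eval F' z := fun hF hF' =>
        map_sub (evalHom R z hzR) ⟨_, hF⟩ ⟨_, hF'⟩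
      have hGz : eval G z = 0 := by
        rw [hEdef, hsub (pow_mem (X_mem_convergent 0) q) (mul_mem hQ (hgR i₀)),
          eval_mul hzR hQ (hgR i₀)] at hEz
        have h1 : eval (X 0 ^ q) z = t ^ q := by
          have := map_pow (evalHom R z hzR) ⟨X 0, X_mem_convergent 0⟩ q
          rw [evalHom_apply, evalHom_apply, eval_X] at this
          exact this
        rw [h1, sub_eq_self] at hEz
        exact (mul_eq_zero.1 hEz).resolve_left hQz
      have hgz : ∀ i, eval (g i) z = 0 := fun i => by
        have := hDz i
        rwa [hsub (hgR i) (mul_mem (hQ' i) (hgR i₀)), eval_mul hzR (hQ' i) (hgR i₀), hGz, mul_zero,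
          sub_zero] at this
      have hz0 := hz z (fun i => (hzR i).trans (hRr i)) hgz
      funext i
      exact congrFun hz0 i.succ)
  set I := Ideal.span (Set.range g)
  have hgI : ∀ i, g i ∈ I := fun i => Ideal.subset_span ⟨i, rfl⟩
  let ι : MvPowerSeries (Fin d) ℂ →+* MvPowerSeries (Fin (d + 1)) ℂ :=
    (rename (Fin.succEmb d) : MvPowerSeries (Fin d) ℂ →ₐ[ℂ] MvPowerSeries (Fin (d + 1)) ℂ).toRingHom
  -- Substituting `X 0` for the polynomial variable sends `P` to `Q * G` and `p i` to `g i - Q' i *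
  -- G`, both in `I`. By the Bézout identity the resultants therefore lie in `I`.
  let Ψ : Polynomial (convergent ρ) →+* MvPowerSeries (Fin (d + 1)) ℂ :=
    Polynomial.eval₂RingHom (ι.comp (convergent ρ).subtype) (X 0)
  have hΨC : ∀ c, Ψ (Polynomial.C c) = ι c := fun c => Polynomial.eval₂_C _ _
  have hΨt : ∀ c, Ψ (truncPoly q c) = ∑ k ∈ Finset.range q, ι (c k) * X 0 ^ k := fun c => by
    rw [truncPoly, map_sum]
    exact Finset.sum_congr rfl fun k _ => Polynomial.eval₂_monomial _ _
  have hEsum : E = ∑ k ∈ Finset.range q, ι (e k) * X 0 ^ k := by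
    conv_lhs => rw [← lower_eq_self hE0]
    exact lower_eq_sum q E
  have hΨP : Ψ P ∈ I := by
    have : Ψ P = Q * G := by
      rw [map_add, map_pow, hΨt]
      simp only [NegMemClass.coe_neg, map_neg, neg_mul, Finset.sum_neg_distrib]
      rw [← hEsum, show Ψ Polynomial.X = X 0 from Polynomial.eval₂_X _ _, hEdef]
      ring
    rw [this]
    exact I.mul_mem_left _ (hgI i₀)
  have hΨp : ∀ i, Ψ (p i) ∈ I := fun i => by
    have : Ψ (p i) = D i := by
      rw [hΨt]
      conv_rhs => rw [← hDl i]
      exact (lower_eq_sum q (D i)).symm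
    rw [this]
    exact sub_mem (hgI i) (I.mul_mem_left _ (hgI i₀))
  have hNI : Ideal.span (Set.range fun τ => (N τ : MvPowerSeries (Fin d) ℂ)) ≤ I.comap ι := by
    rw [Ideal.span_le]
    rintro _ ⟨τ, rfl⟩
    change ι (N τ) ∈ I
    obtain ⟨x, y, -, -, hxy⟩ := Polynomial.exists_mul_add_mul_eq_C_resultant P (S τ) hPd.le (hSd τ)
      (Or.inr (Nat.succ_ne_zero q))
    rw [← hΨC, ← hxy, map_add, map_mul, map_mul]
    refine add_mem (I.mul_mem_right _ hΨP) (I.mul_mem_right _ ?_)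
    rw [map_sum]
    exact Ideal.sum_mem _ fun i _ => by rw [map_mul]; exact I.mul_mem_left _ (hΨp i)
  have hsucc : ∀ i : Fin d, ι (X i) ∈ I.radical := fun i => by
    obtain ⟨k, hk⟩ := key i
    exact ⟨k, by rw [← map_pow]; exact hNI hk⟩
  refine Fin.cases ?_ (fun i => ?_) j
  · have hmax : ∀ k < q, ι (e k) ∈ I.radical := fun k hk => by
      have h1 : (e k : MvPowerSeries (Fin d) ℂ) ∈
          IsLocalRing.maximalIdeal (MvPowerSeries (Fin d) ℂ) := mem_maximalIdeal_iff.2 (he k hk).1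
      have h2 : IsLocalRing.maximalIdeal (MvPowerSeries (Fin d) ℂ) ≤ I.radical.comap ι := by
        rw [maximalIdeal_eq_span_X, Ideal.span_le]
        rintro _ ⟨i, rfl⟩
        exact hsucc i
      exact h2 h1
    refine I.radical_isRadical ⟨q, ?_⟩
    have : (X 0 : MvPowerSeries (Fin (d + 1)) ℂ) ^ q = E + Q * G := by rw [hEdef]; ring
    rw [this]
    refine add_mem ?_ (I.le_radical (I.mul_mem_left _ (hgI i₀)))
    rw [hEsum]
    exact Ideal.sum_mem _ fun k hk => Ideal.mul_mem_right _ _ (hmax k (Finset.mem_range.1 hk))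
  · have := hsucc i
    rwa [show ι (X i) = X i.succ from rename_X _ i] at this

/-- The Nullstellensatz for an isolated zero, by elimination: a linear change makes one series
regular in the first variable, and the resultants with its Weierstrass polynomial satisfy the same
hypothesis in one variable less. -/
theorem X_mem_radical_of_isolated_zero (d : ℕ) : ∀ (m : ℕ) (g : Fin m → MvPowerSeries (Fin d) ℂ)
    (r : Fin d → ℝ≥0), (∀ i, 0 < r i) → (∀ i, g i ∈ convergent r) →
    (∀ z, (∀ i, ‖z i‖₊ ≤ r i) → (∀ i, eval (g i) z = 0) → z = 0) →
    ∀ j, X j ∈ (Ideal.span (Set.range g)).radical := by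
  classical
  induction d with
  | zero => intro m g r _ _ _ j; exact j.elim0
  | succ d ih =>
    intro m g r hr hg hz
    obtain ⟨i₀, hi₀⟩ : ∃ i, g i ≠ 0 := by
      by_contra! h
      -- If all series were zero, the corner of the polydisc would be a second common zero.
      have := hz (fun i => (r i : ℂ)) (fun i => by
          rw [← NNReal.coe_le_coe]; simp) (fun i => by
        rw [h i]; simpa using eval_C 0 _)
      have := congrFun this 0
      simp only [Pi.zero_apply, Complex.ofReal_eq_zero, NNReal.coe_eq_zero] at this
      exact (hr 0).ne' this
    obtain ⟨M, hM, hex⟩ := exists_linearEquiv_coeff_ne_zero hi₀ (0 : Fin (d + 1))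
    -- The least such exponent, so all lower coefficients on the axis vanish; dividing by `c`
    -- normalizes the coefficient at `q` to `1`.
    set q := Nat.find hex
    have hq := Nat.find_spec hex
    set c := coeff (Finsupp.single 0 q) (linearSubst M (g i₀))
    have hMinv : ∀ z, M.mulVec z = 0 → z = 0 := fun z h =>
      Matrix.mulVec_injective_of_isUnit ((Matrix.isUnit_iff_isUnit_det M).2 hM)
        (by rw [h, Matrix.mulVec_zero])
    obtain ⟨u, hu0, hu⟩ : ∃ u : ℝ≥0, 0 < u ∧ ∀ i, ∑ j, ‖M i j‖₊ * u ≤ r i := by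
      have h1 : ∀ i, ∀ᶠ u : ℝ≥0 in 𝓝[>] 0, (u : ℝ≥0∞) * ((∑ j, ‖M i j‖₊ : ℝ≥0) : ℝ≥0∞) < r i :=
        fun i => eventually_mul_lt ENNReal.coe_ne_top (ENNReal.coe_ne_zero.2 (hr i).ne')
      obtain ⟨u, hu, hu0⟩ := ((eventually_all.2 h1).and self_mem_nhdsWithin).exists
      refine ⟨u, hu0, fun i => ?_⟩
      have := (hu i).le
      rw [← ENNReal.coe_mul, ENNReal.coe_le_coe] at this
      rwa [← Finset.sum_mul, mul_comm]
    let g' : Fin m → MvPowerSeries (Fin (d + 1)) ℂ := fun i => C c⁻¹ * linearSubst M (g i)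
    have hconv : ∀ i, linearSubst M (g i) ∈ convergent fun _ => u := fun i =>
      linearSubst_mem_convergent M hu (hg i)
    have key := X_mem_radical_of_regular ih g' (fun _ => u) (fun _ => hu0)
      (fun i => mul_mem (C_mem_convergent _) (hconv i))
      (fun z hzu h => hMinv z (hz _ (fun i => by
        rw [Matrix.mulVec, dotProduct]
        refine (nnnorm_sum_le _ _).trans (le_trans (Finset.sum_le_sum fun j _ => ?_) (hu i))
        rw [nnnorm_mul]
        exact mul_le_mul_right (hzu j) _) fun i => by
          have := h i
          rw [eval_mul hzu (C_mem_convergent _) (hconv i), eval_C,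
            eval_linearSubst M hu (hg i) hzu] at this
          exact (mul_eq_zero.1 this).resolve_left (inv_ne_zero hq)))
      (i₀ := i₀) (q := q)
      (fun k hk => by
        have := Nat.find_min hex hk
        rw [not_not] at this
        rw [coeff_C_mul, this, mul_zero])
      (by rw [coeff_C_mul]; exact inv_mul_cancel₀ hq)
    let e := linearEquiv M hM
    have hle : Ideal.span (Set.range g') ≤ (Ideal.span (Set.range g)).comap e.symm := by
      rw [Ideal.span_le]
      rintro _ ⟨i, rfl⟩
      change e.symm (C c⁻¹ * linearSubst M (g i)) ∈ Ideal.span (Set.range g)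
      rw [map_mul]
      refine Ideal.mul_mem_left _ _ ?_
      have : e.symm (linearSubst M (g i)) = g i := e.symm_apply_apply (g i)
      rw [this]
      exact Ideal.subset_span ⟨i, rfl⟩
    intro j
    have h1 : linearSubst M (X j) ∈ (Ideal.span (Set.range g')).radical := by
      rw [linearSubst_X]
      refine Ideal.sum_mem _ fun k _ => ?_
      rw [smul_eq_C_mul]
      exact Ideal.mul_mem_left _ _ (key k)
    obtain ⟨k, hk⟩ := h1
    refine ⟨k, ?_⟩
    have h2 := hle hk
    rw [Ideal.mem_comap, map_pow] at h2
    have : e.symm (linearSubst M (X j)) = X j := e.symm_apply_apply (X j)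
    rwa [this] at h2

end MvPowerSeries

/-! ## Dimension, expansion of analytic functions and derivatives of convergent series -/

namespace MvPowerSeries

open scoped NNReal ENNReal

theorem natCast_le_ringKrullDim (K : Type*) [Field K] (d : ℕ) :
    (d : WithBot ℕ∞) ≤ ringKrullDim (MvPowerSeries (Fin d) K) := by
  induction d with
  | zero => exact_mod_cast ringKrullDim_nonneg_of_nontrivial
  | succ d ih =>
    rw [ringKrullDim_eq_of_ringEquiv (finSuccEquiv K d).toRingEquiv, Nat.cast_add, Nat.cast_one]
    exact (add_le_add_left ih 1).trans ringKrullDim_succ_le_ringKrullDim_powerseries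

/-- A parameter system of `K⟦X₁, …, X_d⟧` has at least `d` elements. -/
theorem le_ncard_of_X_mem_radical {K : Type*} [Field K] {d : ℕ} {s : Set (MvPowerSeries (Fin d) K)}
    (hfin : s.Finite) (hs : ∀ f ∈ s, constantCoeff f = 0)
    (h : ∀ j, X j ∈ (Ideal.span s).radical) : d ≤ s.ncard := by
  -- The maximal ideal is minimal over `span s`, so Krull's height theorem bounds its height, which
  -- is at least `d`, by the number of generators.
  have hmin : IsLocalRing.maximalIdeal (MvPowerSeries (Fin d) K) ∈ (Ideal.span s).minimalPrimes := by
    refine ⟨⟨inferInstance, Ideal.span_le.2 fun f hf => mem_maximalIdeal_iff.2 (hs f hf)⟩, ?_⟩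
    rintro q ⟨hq, hle⟩ -
    rw [maximalIdeal_eq_span_X, Ideal.span_le]
    rintro _ ⟨j, rfl⟩
    exact hq.radical_le_iff.2 hle (h j)
  have h1 := Ideal.height_le_card_of_mem_minimalPrimes_span hfin hmin
  have h2 := natCast_le_ringKrullDim K d
  rw [← IsLocalRing.maximalIdeal_height_eq_ringKrullDim] at h2
  have h3 : (d : WithBot ℕ∞) ≤ ((s.ncard : ℕ∞) : WithBot ℕ∞) :=
    h2.trans (WithBot.coe_le_coe.2 h1)
  exact_mod_cast h3

section Derivative

variable {d : ℕ}

/-- Halving the radius absorbs the exponent produced by differentiation, because `n + 1 ≤ 2 ^ n`. -/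
theorem polyNorm_pderiv_le (r : ℝ≥0) (j : Fin d) (F : MvPowerSeries (Fin d) ℂ) :
    (r : ℝ≥0∞) * polyNorm (fun _ => r / 2) (pderiv ℂ j F) ≤ polyNorm (fun _ => r) F := by
  classical
  unfold polyNorm
  rw [← ENNReal.tsum_mul_left]
  refine le_trans (ENNReal.tsum_le_tsum fun β => ?_)
    (ENNReal.tsum_comp_le_tsum_of_injective (add_left_injective (Finsupp.single j 1))
      (fun α => ‖coeff α F‖ₑ * ∏ i, (r : ℝ≥0∞) ^ α i))
  rw [coeff_pderiv, enorm_mul]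
  have h1 : ∏ i, (r : ℝ≥0∞) ^ (β + Finsupp.single j 1 : Fin d →₀ ℕ) i = r * ∏ i, (r : ℝ≥0∞) ^ β i := by
    simp only [Finsupp.add_apply, pow_add, Finset.prod_mul_distrib]
    rw [mul_comm, Finset.prod_eq_single j
      (f := fun i => (r : ℝ≥0∞) ^ (Finsupp.single j 1 : Fin d →₀ ℕ) i)]
    · simp
    · intro i _ hi; simp [Finsupp.single_eq_of_ne hi]
    · simp
  have h2 : ‖((β j : ℂ) + 1)‖ₑ = ((β j + 1 : ℕ) : ℝ≥0∞) := by
    rw [← Nat.cast_succ, enorm_eq_nnnorm, Complex.nnnorm_natCast]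
    simp
  have h3 : ((β j + 1 : ℕ) : ℝ≥0∞) * ∏ i, ((r / 2 : ℝ≥0) : ℝ≥0∞) ^ β i ≤
      ∏ i, (r : ℝ≥0∞) ^ β i := by
    rw [← Finset.mul_prod_erase _ _ (Finset.mem_univ j), ← Finset.mul_prod_erase Finset.univ
      (fun i => (r : ℝ≥0∞) ^ β i) (Finset.mem_univ j), ← mul_assoc]
    refine mul_le_mul' ?_ (Finset.prod_le_prod' fun i _ => pow_le_pow_left'
      (ENNReal.coe_le_coe.2 (half_le_self (zero_le))) _)
    have h4 : ((β j + 1 : ℕ) : ℝ≥0) * (r / 2) ^ β j ≤ r ^ β j := by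
      rw [div_pow, mul_div_assoc', div_le_iff₀ (by positivity), mul_comm]
      refine mul_le_mul_right ?_ _
      have : β j + 1 ≤ 2 ^ β j := Nat.lt_two_pow_self
      exact_mod_cast this
    exact_mod_cast h4
  change (r : ℝ≥0∞) * (‖coeff (β + Finsupp.single j 1) F‖ₑ * _ * _) ≤
    ‖coeff (β + Finsupp.single j 1) F‖ₑ * ∏ i, (r : ℝ≥0∞) ^ (β + Finsupp.single j 1 : Fin d →₀ ℕ) i
  rw [h1, h2]
  calc (r : ℝ≥0∞) * (‖coeff (β + Finsupp.single j 1) F‖ₑ * ((β j + 1 : ℕ) : ℝ≥0∞) *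
        ∏ i, ((r / 2 : ℝ≥0) : ℝ≥0∞) ^ β i)
      = ‖coeff (β + Finsupp.single j 1) F‖ₑ * (r * (((β j + 1 : ℕ) : ℝ≥0∞) *
        ∏ i, ((r / 2 : ℝ≥0) : ℝ≥0∞) ^ β i)) := by ring
    _ ≤ _ := mul_le_mul_right (mul_le_mul_right h3 _) _

theorem pderiv_mem_convergent {r : ℝ≥0} (hr : 0 < r) (j : Fin d) {F : MvPowerSeries (Fin d) ℂ}
    (hF : F ∈ convergent fun _ => r) : pderiv ℂ j F ∈ convergent fun _ => r / 2 := by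
  intro h
  have := polyNorm_pderiv_le r j F
  rw [h, ENNReal.mul_top (ENNReal.coe_ne_zero.2 hr.ne'), top_le_iff] at this
  exact hF this

theorem deriv_eval {r : ℝ≥0} (j : Fin d) {F : MvPowerSeries (Fin d) ℂ}
    (hF : F ∈ convergent fun _ => r) {z : Fin d → ℂ} (hz : ∀ i, ‖z i‖₊ < r) :
    deriv (fun t : ℂ => eval F (z + Pi.single j t)) 0 = eval (pderiv ℂ j F) z := by
  classical
  let U : Set ℂ := {t | ‖z j + t‖ < r}
  have hprod : ∀ (α : Fin d →₀ ℕ) (t : ℂ), ∏ i, (z + Pi.single j t : Fin d → ℂ) i ^ α i =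
      (z j + t) ^ α j * ∏ i ∈ Finset.univ.erase j, z i ^ α i := by
    intro α t
    rw [← Finset.mul_prod_erase _ _ (Finset.mem_univ j)]
    congr 1
    · simp
    · refine Finset.prod_congr rfl fun i hi => ?_
      rw [Pi.add_apply, Pi.single_eq_of_ne (Finset.ne_of_mem_erase hi), add_zero]
  have hsum := Complex.hasSum_deriv_of_summable_norm (U := U) (z := 0)
    (F := fun (α : Fin d →₀ ℕ) t => coeff α F * ∏ i, (z + Pi.single j t : Fin d → ℂ) i ^ α i)
    -- The majorant for differentiating term by term is the series at the corner of the polydisc.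
    (u := fun α => ‖coeff α F * ∏ i, ((r : ℝ) : ℂ) ^ α i‖)
    (summable_norm_eval (z := fun _ => ((r : ℝ) : ℂ)) (r := fun _ => r)
      (fun i => by rw [← NNReal.coe_le_coe]; simp) hF)
    (fun α => by
      simp only [hprod]
      fun_prop)
    (isOpen_lt (by fun_prop) continuous_const)
    (fun α t ht => by
      rw [norm_mul, norm_mul, norm_prod, norm_prod]
      refine mul_le_mul_of_nonneg_left (Finset.prod_le_prod (fun _ _ => norm_nonneg _)
        fun i _ => ?_) (norm_nonneg _)
      rw [norm_pow, norm_pow]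
      refine pow_le_pow_left₀ (norm_nonneg _) ?_ _
      rw [Complex.norm_real, Real.norm_of_nonneg r.coe_nonneg]
      by_cases hi : i = j
      · subst hi; simpa using le_of_lt ht
      · rw [Pi.add_apply, Pi.single_eq_of_ne hi, add_zero]
        exact_mod_cast (hz i).le)
    (by change ‖z j + 0‖ < r; rw [add_zero]; exact_mod_cast hz j)
  rw [show (fun t : ℂ => eval F (z + Pi.single j t)) = fun w => ∑' α : Fin d →₀ ℕ,
    coeff α F * ∏ i, (z + Pi.single j w : Fin d → ℂ) i ^ α i from rfl, ← hsum.tsum_eq]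
  have hder : ∀ α : Fin d →₀ ℕ,
      deriv (fun t => coeff α F * ∏ i, (z + Pi.single j t : Fin d → ℂ) i ^ α i) 0 =
        coeff α F * ((α j * z j ^ (α j - 1)) * ∏ i ∈ Finset.univ.erase j, z i ^ α i) := by
    intro α
    simp only [hprod]
    have h1 : HasDerivAt (fun t : ℂ => (z j + t) ^ α j) (α j * z j ^ (α j - 1)) 0 := by
      simpa using ((hasDerivAt_id' (0 : ℂ)).const_add (z j)).fun_pow (α j)
    exact ((h1.mul_const _).const_mul _).deriv
  simp only [hder]
  rw [← (add_left_injective (Finsupp.single j 1)).tsum_eq]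
  · refine tsum_congr fun β => ?_
    rw [coeff_pderiv, ← Finset.mul_prod_erase _ _ (Finset.mem_univ j)]
    have : ∀ i ∈ Finset.univ.erase j, (β + Finsupp.single j 1 : Fin d →₀ ℕ) i = β i := fun i hi => by
      simp [Finsupp.single_eq_of_ne (Finset.ne_of_mem_erase hi)]
    simp only [Finsupp.add_apply, Finsupp.single_eq_same, Nat.add_sub_cancel]
    rw [Finset.prod_congr rfl fun i hi => by rw [← Finsupp.add_apply, this i hi]]
    push_cast
    ring
  · intro α hα
    have h1 : α j ≠ 0 := fun h => hα (by simp [h])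
    exact ⟨α - Finsupp.single j 1, tsub_add_cancel_of_le (by rw [Finsupp.single_le_iff]; omega)⟩

end Derivative

section Expansion

variable {d : ℕ}

/-- The multiplicities of a word. -/
noncomputable def wordCount (x : Σ n, Fin n → Fin d) : Fin d →₀ ℕ :=
  ∑ i, Finsupp.single (x.2 i) 1

theorem prod_pow_wordCount {R : Type*} [CommSemiring R] (z : Fin d → R) (x : Σ n, Fin n → Fin d) :
    ∏ j, z j ^ wordCount x j = ∏ i, z (x.2 i) := by
  classical
  have : ∀ j, z j ^ wordCount x j = ∏ i, z j ^ (Finsupp.single (x.2 i) 1 : Fin d →₀ ℕ) j := by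
    intro j
    rw [Finset.prod_pow_eq_pow_sum, wordCount, Finsupp.finsetSum_apply]
  simp only [this]
  rw [Finset.prod_comm]
  refine Finset.prod_congr rfl fun i _ => ?_
  rw [Finset.prod_eq_single (x.2 i)]
  · simp
  · intro j _ hj; simp [Finsupp.single_eq_of_ne hj]
  · simp

/-- Expand the `n`-th multilinear term over words of basis vectors and collect words with equal
multiplicities. There are `d ^ n` words of length `n`, so absolute convergence needs a radius
smaller by the factor `d`. -/
theorem exists_convergent_eval {f : (Fin d → ℂ) → ℂ} {p : Fin d → ℂ} (hf : AnalyticAt ℂ f p) :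
    ∃ (F : MvPowerSeries (Fin d) ℂ) (r : ℝ≥0), 0 < r ∧ F ∈ convergent (fun _ => r) ∧
      ∀ z, (∀ i, ‖z i‖₊ ≤ r) → f (p + z) = eval F z := by
  classical
  obtain ⟨P, R, hP⟩ := hf
  -- The factor `d + 1` gives both `d r < R`, for the count of words, and `r < R`, for the polydisc
  -- to lie in the ball of convergence.
  obtain ⟨r, hr0, hr⟩ : ∃ r : ℝ≥0, 0 < r ∧ (r : ℝ≥0∞) * (d + 1 : ℕ) < R := by
    obtain ⟨r, hr, hr0⟩ := ((eventually_mul_lt (N := ((d + 1 : ℕ) : ℝ≥0∞))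
      (ENNReal.natCast_ne_top _) hP.r_pos.ne').and self_mem_nhdsWithin).exists
    exact ⟨r, hr0, hr⟩
  let a : (Σ n, Fin n → Fin d) → ℂ := fun x => P x.1 fun i => Pi.single (x.2 i) 1
  have hP_expand : ∀ n (z : Fin d → ℂ), P n (fun _ => z) =
      ∑ v : Fin n → Fin d, a ⟨n, v⟩ * ∏ i, z (v i) := by
    intro n z
    have h1 : z = ∑ j, z j • (Pi.single j 1 : Fin d → ℂ) := by
      conv_lhs => rw [← Finset.univ_sum_single z]
      refine Finset.sum_congr rfl fun j _ => ?_
      rw [← Pi.single_smul]; simp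
    conv_lhs => rw [h1]
    rw [ContinuousMultilinearMap.map_sum]
    refine Finset.sum_congr rfl fun v _ => ?_
    rw [ContinuousMultilinearMap.map_smul_univ, smul_eq_mul, mul_comm]
  have ha : ∀ x, ‖a x‖ₑ ≤ ‖P x.1‖ₑ := by
    intro x
    rw [enorm_le_iff_norm_le]
    refine (ContinuousMultilinearMap.le_opNorm _ _).trans_eq ?_
    simp [Pi.norm_single]
  have hsum : ∑' x : Σ n, Fin n → Fin d, ‖a x‖ₑ * (r : ℝ≥0∞) ^ x.1 ≠ ⊤ := by
    have h1 : ((d * r : ℝ≥0) : ℝ≥0∞) < P.radius := by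
      refine lt_of_le_of_lt ?_ (hr.trans_le hP.r_le)
      push_cast
      rw [mul_comm]
      exact mul_le_mul_right (le_self_add) _
    have h2 := P.summable_norm_mul_pow h1
    have h3 : ∑' n, ‖P n‖ₑ * ((d * r : ℝ≥0) : ℝ≥0∞) ^ n ≠ ⊤ := by
      have := (tsum_enorm_ne_top_iff_summable_norm
        (f := fun n => ‖P n‖ * ((d * r : ℝ≥0) : ℝ) ^ n)).2 h2.norm
      convert this using 3 with n
      rw [enorm_mul, enorm_norm, enorm_pow]
      congr 2
      rw [Real.enorm_of_nonneg (NNReal.coe_nonneg _), ENNReal.ofReal_coe_nnreal]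
    refine ne_top_of_le_ne_top h3 ?_
    rw [ENNReal.tsum_sigma']
    refine ENNReal.tsum_le_tsum fun n => ?_
    rw [tsum_fintype]
    refine (Finset.sum_le_sum fun v _ => mul_le_mul_left (ha ⟨n, v⟩) _).trans_eq ?_
    change ∑ _v : Fin n → Fin d, ‖P n‖ₑ * (r : ℝ≥0∞) ^ n = _
    rw [Finset.sum_const, Finset.card_univ, Fintype.card_fun, Fintype.card_fin, Fintype.card_fin]
    push_cast
    rw [mul_pow, nsmul_eq_mul]
    push_cast
    ring
  let e := Equiv.sigmaFiberEquiv (wordCount (d := d))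
  let F : MvPowerSeries (Fin d) ℂ := fun α => ∑' x : {x // wordCount (d := d) x = α}, a x
  have hrw : ∀ x : Σ n, Fin n → Fin d, ∏ i, (r : ℝ≥0∞) ^ wordCount x i = (r : ℝ≥0∞) ^ x.1 := by
    intro x
    rw [prod_pow_wordCount (fun _ => (r : ℝ≥0∞))]
    simp
  refine ⟨F, r, hr0, ?_, fun z hz => ?_⟩
  · refine ne_top_of_le_ne_top hsum ?_
    rw [← e.tsum_eq, ENNReal.tsum_sigma']
    refine ENNReal.tsum_le_tsum fun α => ?_
    refine (mul_le_mul_left (enorm_tsum_le_tsum_enorm) _).trans_eq ?_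
    rw [← ENNReal.tsum_mul_right]
    refine tsum_congr fun x => ?_
    change _ = ‖a x.1‖ₑ * (r : ℝ≥0∞) ^ x.1.1
    rw [← hrw, x.2]
  · have hzs : Summable fun x : Σ n, Fin n → Fin d => a x * ∏ i, z (x.2 i) := by
      refine Summable.of_norm ?_
      rw [← tsum_enorm_ne_top_iff_summable_norm]
      refine ne_top_of_le_ne_top hsum (ENNReal.tsum_le_tsum fun x => ?_)
      rw [enorm_mul]
      refine mul_le_mul_right ?_ _
      rw [enorm_eq_nnnorm, nnnorm_prod, ← ENNReal.coe_pow, ENNReal.coe_le_coe]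
      exact (Finset.prod_le_prod' fun i _ => hz _).trans_eq (by simp)
    have h1 : HasSum (fun n => P n fun _ => z) (f (p + z)) := by
      refine hP.hasSum ?_
      rw [Metric.mem_eball, edist_zero_right]
      refine lt_of_le_of_lt ?_ hr
      refine le_trans ?_ (le_mul_of_one_le_right' (by simp))
      rw [enorm_eq_nnnorm, ENNReal.coe_le_coe]
      exact (pi_nnnorm_le_iff).2 hz
    have h2 : f (p + z) = ∑' x : Σ n, Fin n → Fin d, a x * ∏ i, z (x.2 i) := by
      rw [hzs.tsum_sigma, ← h1.tsum_eq]
      refine tsum_congr fun n => ?_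
      rw [hP_expand, tsum_fintype]
    have hzs' := e.summable_iff.2 hzs
    rw [h2, ← e.tsum_eq]
    refine hzs'.tsum_sigma.trans (tsum_congr fun α => ?_)
    change _ = (∑' x : {x // wordCount (d := d) x = α}, a x) * _
    rw [← tsum_mul_right]
    refine tsum_congr fun x => ?_
    change a x.1 * ∏ i, z (x.1.2 i) = _
    rw [← prod_pow_wordCount z x.1, x.2]

end Expansion

end MvPowerSeries

/-! ## Wirtinger derivatives and Taylor series -/

namespace MvPowerSeries

variable {σ : Type*}

/-- The series without terms of degree less than `n`. -/
def vanishingIdeal (σ : Type*) (n : ℕ) : Ideal (MvPowerSeries σ ℂ) where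
  carrier := {F | ∀ α : σ →₀ ℕ, α.degree < n → coeff α F = 0}
  add_mem' := fun {F G} hF hG α hα => by rw [map_add, hF α hα, hG α hα, add_zero]
  zero_mem' := fun α _ => map_zero _
  smul_mem' := fun G F hF α hα => by
    classical
    rw [smul_eq_mul, coeff_mul]
    refine Finset.sum_eq_zero fun p hp => ?_
    have hp := Finset.HasAntidiagonal.mem_antidiagonal.1 hp
    have : p.1.degree + p.2.degree = α.degree := by rw [← map_add, hp]
    rw [hF p.2 (by omega), mul_zero]

theorem mem_vanishingIdeal_succ {n : ℕ} {F : MvPowerSeries σ ℂ} (h0 : constantCoeff F = 0)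
    (h : ∀ i, pderiv ℂ i F ∈ vanishingIdeal σ n) : F ∈ vanishingIdeal σ (n + 1) := by
  classical
  intro α hα
  by_cases hα0 : α = 0
  · rw [hα0]; exact h0
  obtain ⟨i, hi⟩ : ∃ i, α i ≠ 0 := by
    by_contra! h'
    exact hα0 (Finsupp.ext h')
  have hle : Finsupp.single i 1 ≤ α := by rw [Finsupp.single_le_iff]; omega
  obtain ⟨β, rfl⟩ := exists_add_of_le hle
  have hd : (Finsupp.single i 1 + β).degree = 1 + β.degree := by
    rw [map_add, Finsupp.degree_single]
  have := h i β (by omega)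
  rw [coeff_pderiv, add_comm β] at this
  refine (mul_eq_zero.1 this).resolve_right ?_
  exact Nat.cast_add_one_ne_zero _

/-- A family of series without constant terms whose derivatives lie in the ideal it generates
vanishes. -/
theorem eq_zero_of_pderiv_mem_span {ι : Type*} (D : ι → MvPowerSeries σ ℂ)
    (h0 : ∀ x, constantCoeff (D x) = 0)
    (h : ∀ x i, pderiv ℂ i (D x) ∈ Ideal.span (Set.range D)) (x : ι) : D x = 0 := by
  -- If all members of the ideal vanish to order `n`, so do the derivatives of the generators, and
  -- the generators, having no constant terms, vanish to order `n + 1`.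
  have key : ∀ n, Ideal.span (Set.range D) ≤ vanishingIdeal σ n := by
    intro n
    induction n with
    | zero => intro F _ α hα; exact absurd hα (Nat.not_lt_zero _)
    | succ n ih =>
      rw [Ideal.span_le]
      rintro _ ⟨x, rfl⟩
      exact mem_vanishingIdeal_succ (h0 x) fun i => ih (h x i)
  ext α
  exact key (α.degree + 1) (Ideal.subset_span ⟨x, rfl⟩) α (Nat.lt_succ_self _)

end MvPowerSeries

namespace CRTransversal

open MvPowerSeries

variable {d e : ℕ}

/-- The Wirtinger components of a real-linear form. -/
noncomputable def wirtingerCLM : Fin d ⊕ Fin d → ((Fin d → ℂ) →L[ℝ] ℂ) →L[ℝ] ℂ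
  | Sum.inl j => (1 / 2 : ℂ) • (ContinuousLinearMap.apply ℝ ℂ (Pi.single j (1 : ℂ) : Fin d → ℂ) -
      Complex.I • ContinuousLinearMap.apply ℝ ℂ (Pi.single j Complex.I : Fin d → ℂ))
  | Sum.inr j => (1 / 2 : ℂ) • (ContinuousLinearMap.apply ℝ ℂ (Pi.single j (1 : ℂ) : Fin d → ℂ) +
      Complex.I • ContinuousLinearMap.apply ℝ ℂ (Pi.single j Complex.I : Fin d → ℂ))

theorem wirtingerCLM_inl (j : Fin d) (A : (Fin d → ℂ) →L[ℝ] ℂ) :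
    wirtingerCLM (Sum.inl j) A =
      (1 / 2) * (A (Pi.single j 1) - Complex.I * A (Pi.single j Complex.I)) := rfl

theorem wirtingerCLM_inr (j : Fin d) (A : (Fin d → ℂ) →L[ℝ] ℂ) :
    wirtingerCLM (Sum.inr j) A =
      (1 / 2) * (A (Pi.single j 1) + Complex.I * A (Pi.single j Complex.I)) := rfl

theorem wirtinger_eq (f : (Fin d → ℂ) → ℂ) (z : Fin d → ℂ) (i : Fin d ⊕ Fin d) :
    wirtinger f z i = wirtingerCLM i (fderiv ℝ f z) := by
  rcases i with j | j <;> rfl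

theorem wirtingerCLM_smul (i : Fin d ⊕ Fin d) (c : ℂ) (A : (Fin d → ℂ) →L[ℝ] ℂ) :
    wirtingerCLM i (c • A) = c * wirtingerCLM i A := by
  rcases i with j | j
  · simp only [wirtingerCLM_inl, _root_.smul_apply, smul_eq_mul]; ring
  · simp only [wirtingerCLM_inr, _root_.smul_apply, smul_eq_mul]; ring

/-- A real-linear form is determined by its Wirtinger components. -/
theorem apply_eq_sum_wirtingerCLM (A : (Fin d → ℂ) →L[ℝ] ℂ) (w : Fin d → ℂ) :
    A w = ∑ k, wirtingerCLM (Sum.inl k) A * w k + ∑ k, wirtingerCLM (Sum.inr k) A * conj (w k) := by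
  have hw : w = ∑ k, ((w k).re • (Pi.single k 1 : Fin d → ℂ) +
      (w k).im • (Pi.single k Complex.I : Fin d → ℂ)) := by
    conv_lhs => rw [← Finset.univ_sum_single w]
    refine Finset.sum_congr rfl fun k _ => ?_
    rw [← Pi.single_smul, ← Pi.single_smul, ← Pi.single_add]
    congr 1
    simp [Complex.re_add_im]
  conv_lhs => rw [hw]
  rw [map_sum, ← Finset.sum_add_distrib]
  refine Finset.sum_congr rfl fun k _ => ?_
  rw [map_add, map_smul, map_smul, wirtingerCLM_inl, wirtingerCLM_inr]
  have h1 := Complex.re_add_im (w k)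
  have h2 : conj (w k) = (w k).re - (w k).im * Complex.I := by
    apply Complex.ext <;> simp
  rw [h2, Complex.real_smul, Complex.real_smul]
  conv_rhs => rw [← h1]
  simp only [Complex.add_re, Complex.ofReal_re, Complex.mul_re, Complex.I_re, mul_zero,
    Complex.ofReal_im, Complex.I_im, mul_one, sub_self, add_zero, Complex.add_im, Complex.mul_im,
    zero_add]
  linear_combination (A (Pi.single k Complex.I)) * (w k).im * Complex.I_sq

section Rules

variable {f g : (Fin d → ℂ) → ℂ} {p z : Fin d → ℂ}

theorem contDiffAt_wirtinger (hf : ContDiffAt ℝ ∞ f p) (i : Fin d ⊕ Fin d) :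
    ContDiffAt ℝ ∞ (fun z => wirtinger f z i) p := by
  simp only [wirtinger_eq]
  exact (hf.fderiv_right (m := ∞) (by simp)).continuousLinearMap_comp (wirtingerCLM i)

theorem eventuallyEq_wirtinger (h : f =ᶠ[𝓝 p] g) (i : Fin d ⊕ Fin d) :
    (fun z => wirtinger f z i) =ᶠ[𝓝 p] fun z => wirtinger g z i := by
  filter_upwards [h.fderiv (𝕜 := ℝ)] with z hz
  rw [wirtinger_eq, wirtinger_eq, hz]

theorem eventually_differentiableAt {F : Type*} [NormedAddCommGroup F] [NormedSpace ℝ F]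
    {f : (Fin d → ℂ) → F} (hf : ContDiffAt ℝ ∞ f p) : ∀ᶠ z in 𝓝 p, DifferentiableAt ℝ f z := by
  have h1 : ContDiffAt ℝ 1 f p := hf.of_le (by simp)
  filter_upwards [h1.eventually (by simp)] with z hz
  exact hz.differentiableAt (by simp)

theorem wirtinger_add (hf : DifferentiableAt ℝ f z) (hg : DifferentiableAt ℝ g z)
    (i : Fin d ⊕ Fin d) :
    wirtinger (fun z => f z + g z) z i = wirtinger f z i + wirtinger g z i := by
  rw [wirtinger_eq, wirtinger_eq, wirtinger_eq, fderiv_fun_add hf hg, map_add]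

theorem wirtinger_mul (hf : DifferentiableAt ℝ f z) (hg : DifferentiableAt ℝ g z)
    (i : Fin d ⊕ Fin d) :
    wirtinger (fun z => f z * g z) z i = f z * wirtinger g z i + g z * wirtinger f z i := by
  rw [wirtinger_eq, wirtinger_eq, wirtinger_eq, fderiv_fun_mul hf hg, map_add, wirtingerCLM_smul,
    wirtingerCLM_smul]

theorem wirtinger_const (c : ℂ) (z : Fin d → ℂ) (i : Fin d ⊕ Fin d) :
    wirtinger (fun _ => c) z i = 0 := by
  rw [wirtinger_eq, fderiv_fun_const]
  simp

theorem wirtinger_conj (hf : DifferentiableAt ℝ f z) (i : Fin d ⊕ Fin d) :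
    wirtinger (fun z => conj (f z)) z i.swap = conj (wirtinger f z i) := by
  have h : fderiv ℝ (fun z => conj (f z)) z =
      (Complex.conjCLE : ℂ →L[ℝ] ℂ).comp (fderiv ℝ f z) :=
    ((Complex.conjCLE : ℂ →L[ℝ] ℂ).hasFDerivAt.comp z hf.hasFDerivAt).fderiv
  rw [wirtinger_eq, wirtinger_eq, h]
  rcases i with j | j
  · rw [Sum.swap_inl, wirtingerCLM_inl, wirtingerCLM_inr]
    simp [sub_eq_add_neg]
    exact Or.inl (map_ofNat _ 2).symm
  · rw [Sum.swap_inr, wirtingerCLM_inl, wirtingerCLM_inr]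
    simp [sub_eq_add_neg]
    exact Or.inl (map_ofNat _ 2).symm

theorem wirtinger_comm (hf : ContDiffAt ℝ ∞ f p) (i j : Fin d ⊕ Fin d) :
    (fun z => wirtinger (fun w => wirtinger f w i) z j) =ᶠ[𝓝 p]
      fun z => wirtinger (fun w => wirtinger f w j) z i := by
  have h2 : ContDiffAt ℝ 2 f p := hf.of_le (WithTop.coe_le_coe.2 (le_top : (2 : ℕ∞) ≤ ⊤))
  filter_upwards [h2.eventually (by simp)] with z hz
  have hsymm : IsSymmSndFDerivAt ℝ f z := hz.isSymmSndFDerivAt (by simp)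
  have hd : DifferentiableAt ℝ (fderiv ℝ f) z :=
    (hz.fderiv_right (m := 1) (by norm_num)).differentiableAt (by simp)
  have h : ∀ i v, fderiv ℝ (fun w => wirtinger f w i) z v =
      wirtingerCLM i (fderiv ℝ (fderiv ℝ f) z v) := by
    intro i v
    simp only [wirtinger_eq]
    have := ((wirtingerCLM i).hasFDerivAt.comp z hd.hasFDerivAt).fderiv
    exact congrArg (fun L => L v) this
  simp only [wirtinger_eq _ z]
  rcases i with i | i <;> rcases j with j | j <;>
    simp only [wirtingerCLM_inl, wirtingerCLM_inr, h] <;>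
    rw [hsymm (Pi.single i 1) (Pi.single j 1), hsymm (Pi.single i Complex.I) (Pi.single j 1),
      hsymm (Pi.single i 1) (Pi.single j Complex.I),
      hsymm (Pi.single i Complex.I) (Pi.single j Complex.I)] <;> ring

/-- The components of a map and their conjugates. -/
noncomputable def realComponents (H : (Fin d → ℂ) → Fin e → ℂ) : Fin e ⊕ Fin e → (Fin d → ℂ) → ℂ
  | Sum.inl k => fun z => H z k
  | Sum.inr k => fun z => conj (H z k)

theorem contDiffAt_realComponents {H : (Fin d → ℂ) → Fin e → ℂ} (hH : ContDiffAt ℝ ∞ H p)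
    (k : Fin e ⊕ Fin e) : ContDiffAt ℝ ∞ (realComponents H k) p := by
  rcases k with k | k
  · exact contDiffAt_pi.1 hH k
  · exact (Complex.conjCLE : ℂ →L[ℝ] ℂ).contDiff.contDiffAt.comp p (contDiffAt_pi.1 hH k)

theorem wirtinger_comp {H : (Fin d → ℂ) → Fin e → ℂ} {φ : (Fin e → ℂ) → ℂ}
    (hφ : DifferentiableAt ℝ φ (H z)) (hH : DifferentiableAt ℝ H z) (i : Fin d ⊕ Fin d) :
    wirtinger (fun z => φ (H z)) z i =
      ∑ k, wirtinger φ (H z) k * wirtinger (realComponents H k) z i := by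
  have hk : ∀ k, HasFDerivAt (fun z => H z k)
      ((ContinuousLinearMap.proj k : (Fin e → ℂ) →L[ℝ] ℂ).comp (fderiv ℝ H z)) z := fun k =>
    (ContinuousLinearMap.proj k : (Fin e → ℂ) →L[ℝ] ℂ).hasFDerivAt.comp z hH.hasFDerivAt
  have hck : ∀ k, fderiv ℝ (fun z => conj (H z k)) z = (Complex.conjCLE : ℂ →L[ℝ] ℂ).comp
      ((ContinuousLinearMap.proj k : (Fin e → ℂ) →L[ℝ] ℂ).comp (fderiv ℝ H z)) := fun k =>
    ((Complex.conjCLE : ℂ →L[ℝ] ℂ).hasFDerivAt.comp z (hk k)).fderiv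
  have h : fderiv ℝ (fun z => φ (H z)) z =
      ∑ k, wirtinger φ (H z) k • fderiv ℝ (realComponents H k) z := by
    rw [show fderiv ℝ (fun z => φ (H z)) z = (fderiv ℝ φ (H z)).comp (fderiv ℝ H z) from
      (hφ.hasFDerivAt.comp z hH.hasFDerivAt).fderiv]
    ext v
    rw [ContinuousLinearMap.comp_apply, apply_eq_sum_wirtingerCLM, Fintype.sum_sum_type]
    simp only [_root_.add_apply, _root_.sum_apply,
      _root_.smul_apply, smul_eq_mul]
    congr 1
    · refine Finset.sum_congr rfl fun k _ => ?_
      rw [wirtinger_eq]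
      change _ = _ * fderiv ℝ (fun z => H z k) z v
      rw [(hk k).fderiv]
      rfl
    · refine Finset.sum_congr rfl fun k _ => ?_
      rw [wirtinger_eq]
      change _ = _ * fderiv ℝ (fun z => conj (H z k)) z v
      rw [hck]
      rfl
  rw [wirtinger_eq, h, map_sum]
  simp only [wirtingerCLM_smul, ← wirtinger_eq]

end Rules

end CRTransversal

/-! ### Algebraic rules for Taylor series -/

namespace CRTransversal

open MvPowerSeries

variable {d e : ℕ}

/-- Iterated Wirtinger derivatives. -/
noncomputable def iterWirtinger (l : List (Fin d ⊕ Fin d)) (f : (Fin d → ℂ) → ℂ) :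
    (Fin d → ℂ) → ℂ :=
  l.foldr (fun i g z => wirtinger g z i) f

/-- The Taylor series at `p` of a smooth function, in the variables `Z` and `Z̄`. -/
noncomputable def taylor (p : Fin d → ℂ) (f : (Fin d → ℂ) → ℂ) :
    MvPowerSeries (Fin d ⊕ Fin d) ℂ := fun α =>
  (∏ i, ((α i).factorial : ℂ))⁻¹ * iterWirtinger (Finsupp.toMultiset α).toList f p

section

variable {f g : (Fin d → ℂ) → ℂ} {p : Fin d → ℂ}

theorem iterWirtinger_append_singleton (l : List (Fin d ⊕ Fin d)) (i : Fin d ⊕ Fin d)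
    (f : (Fin d → ℂ) → ℂ) :
    iterWirtinger (l ++ [i]) f = iterWirtinger l fun z => wirtinger f z i := by
  simp [iterWirtinger]

theorem contDiffAt_iterWirtinger (hf : ContDiffAt ℝ ∞ f p) (l : List (Fin d ⊕ Fin d)) :
    ContDiffAt ℝ ∞ (iterWirtinger l f) p := by
  induction l with
  | nil => exact hf
  | cons i l ih => exact contDiffAt_wirtinger ih i

theorem eventuallyEq_iterWirtinger (h : f =ᶠ[𝓝 p] g) (l : List (Fin d ⊕ Fin d)) :
    iterWirtinger l f =ᶠ[𝓝 p] iterWirtinger l g := by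
  induction l with
  | nil => exact h
  | cons i l ih => exact eventuallyEq_wirtinger ih i

/-- `taylor` lists a multiset of derivatives in an unspecified order; symmetry of second derivatives
makes the order irrelevant. -/
theorem eventuallyEq_iterWirtinger_of_perm (hf : ContDiffAt ℝ ∞ f p)
    {l l' : List (Fin d ⊕ Fin d)} (h : l.Perm l') :
    iterWirtinger l f =ᶠ[𝓝 p] iterWirtinger l' f := by
  induction h with
  | nil => rfl
  | cons i _ ih => exact eventuallyEq_wirtinger ih i
  | swap i j l => exact wirtinger_comm (contDiffAt_iterWirtinger hf l) i j
  | trans _ _ h1 h2 => exact h1.trans h2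

theorem coeff_taylor (p : Fin d → ℂ) (f : (Fin d → ℂ) → ℂ) (α : Fin d ⊕ Fin d →₀ ℕ) :
    coeff α (taylor p f) = (∏ i, ((α i).factorial : ℂ))⁻¹ *
      iterWirtinger (Finsupp.toMultiset α).toList f p := rfl

theorem constantCoeff_taylor (p : Fin d → ℂ) (f : (Fin d → ℂ) → ℂ) :
    constantCoeff (taylor p f) = f p := by
  rw [← coeff_zero_eq_constantCoeff_apply, coeff_taylor]
  simp [iterWirtinger]

theorem taylor_congr (h : f =ᶠ[𝓝 p] g) : taylor p f = taylor p g := by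
  ext α
  rw [coeff_taylor, coeff_taylor, (eventuallyEq_iterWirtinger h _).eq_of_nhds]

theorem pderiv_taylor (hf : ContDiffAt ℝ ∞ f p) (i : Fin d ⊕ Fin d) :
    pderiv ℂ i (taylor p f) = taylor p fun z => wirtinger f z i := by
  classical
  ext α
  have hperm : (Finsupp.toMultiset (α + Finsupp.single i 1)).toList.Perm
      ((Finsupp.toMultiset α).toList ++ [i]) := by
    rw [← Multiset.coe_eq_coe, Multiset.coe_toList, ← Multiset.coe_add, Multiset.coe_toList,
      map_add, Finsupp.toMultiset_single, one_smul, Multiset.coe_singleton]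
  have hfac : ∏ k, (((α + Finsupp.single i 1 : Fin d ⊕ Fin d →₀ ℕ) k).factorial : ℂ) =
      (α i + 1) * ∏ k, ((α k).factorial : ℂ) := by
    rw [← Finset.mul_prod_erase _ _ (Finset.mem_univ i),
      ← Finset.mul_prod_erase Finset.univ (fun k => ((α k).factorial : ℂ)) (Finset.mem_univ i),
      ← mul_assoc]
    congr 1
    · simp [Nat.factorial_succ]
    · refine Finset.prod_congr rfl fun k hk => ?_
      simp [Finsupp.single_eq_of_ne (Finset.ne_of_mem_erase hk)]
  rw [coeff_pderiv, coeff_taylor, coeff_taylor,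
    (eventuallyEq_iterWirtinger_of_perm hf hperm).eq_of_nhds, iterWirtinger_append_singleton, hfac]
  have h1 : ((α i : ℂ) + 1) ≠ 0 := Nat.cast_add_one_ne_zero _
  field_simp

/-- The first use of a recurring device: apply `eq_zero_of_pderiv_mem_span` to the defects of the
identity, taken for all admissible functions at once, since derivatives of defects are combinations
of defects. -/
theorem taylor_const (p : Fin d → ℂ) (c : ℂ) : taylor p (fun _ => c) = C c := by
  refine sub_eq_zero.1 (eq_zero_of_pderiv_mem_span (fun c => taylor p (fun _ => c) - C c)
    (fun c => ?_) (fun c i => ?_) c)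
  · rw [map_sub, constantCoeff_taylor, constantCoeff_C, sub_self]
  · rw [map_sub, pderiv_taylor contDiffAt_const, pderiv_C, sub_zero]
    simp only [wirtinger_const]
    refine Ideal.subset_span ⟨0, ?_⟩
    change taylor p (fun _ => 0) - C 0 = _
    rw [map_zero, sub_zero]

theorem taylor_add (hf : ContDiffAt ℝ ∞ f p) (hg : ContDiffAt ℝ ∞ g p) :
    taylor p (fun z => f z + g z) = taylor p f + taylor p g := by
  let ι := {x : ((Fin d → ℂ) → ℂ) × ((Fin d → ℂ) → ℂ) //
    ContDiffAt ℝ ∞ x.1 p ∧ ContDiffAt ℝ ∞ x.2 p}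
  refine sub_eq_zero.1 (eq_zero_of_pderiv_mem_span (ι := ι) (fun x =>
    taylor p (fun z => x.1.1 z + x.1.2 z) - (taylor p x.1.1 + taylor p x.1.2)) ?_ ?_
    ⟨(f, g), hf, hg⟩)
  · rintro ⟨⟨f, g⟩, hf, hg⟩
    simp [constantCoeff_taylor]
  · rintro ⟨⟨f, g⟩, hf, hg⟩ i
    refine Ideal.subset_span ⟨⟨(fun z => wirtinger f z i, fun z => wirtinger g z i),
      contDiffAt_wirtinger hf i, contDiffAt_wirtinger hg i⟩, ?_⟩
    simp only [map_sub, map_add, pderiv_taylor hf, pderiv_taylor hg, pderiv_taylor (hf.add hg)]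
    congr 1
    refine taylor_congr ?_
    filter_upwards [eventually_differentiableAt hf, eventually_differentiableAt hg] with z h1 h2
    rw [wirtinger_add h1 h2]

/-- By the product rule the derivative of the defect of `(f, g)` is the sum of the defects of `(f,
∂g)` and `(g, ∂f)`. -/
theorem taylor_mul (hf : ContDiffAt ℝ ∞ f p) (hg : ContDiffAt ℝ ∞ g p) :
    taylor p (fun z => f z * g z) = taylor p f * taylor p g := by
  let ι := {x : ((Fin d → ℂ) → ℂ) × ((Fin d → ℂ) → ℂ) //
    ContDiffAt ℝ ∞ x.1 p ∧ ContDiffAt ℝ ∞ x.2 p}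
  let D : ι → MvPowerSeries (Fin d ⊕ Fin d) ℂ := fun x =>
    taylor p (fun z => x.1.1 z * x.1.2 z) - taylor p x.1.1 * taylor p x.1.2
  refine sub_eq_zero.1 (eq_zero_of_pderiv_mem_span D ?_ ?_ ⟨(f, g), hf, hg⟩)
  · rintro ⟨⟨f, g⟩, hf, hg⟩
    simp [D, constantCoeff_taylor]
  · rintro ⟨⟨f, g⟩, hf, hg⟩ i
    have hf' := contDiffAt_wirtinger hf i
    have hg' := contDiffAt_wirtinger hg i
    have h1 : pderiv ℂ i (D ⟨(f, g), hf, hg⟩) =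
        D ⟨(f, fun z => wirtinger g z i), hf, hg'⟩ + D ⟨(g, fun z => wirtinger f z i), hg, hf'⟩ := by
      have h2 : pderiv ℂ i (taylor p fun z => f z * g z) =
          taylor p (fun z => f z * wirtinger g z i) + taylor p (fun z => g z * wirtinger f z i) := by
        rw [pderiv_taylor (hf.mul hg), ← taylor_add (hf.mul hg') (hg.mul hf')]
        refine taylor_congr ?_
        filter_upwards [eventually_differentiableAt hf, eventually_differentiableAt hg] with z h1 h2
        rw [wirtinger_mul h1 h2]
      simp only [D, map_sub, h2, Derivation.leibniz, pderiv_taylor hf, pderiv_taylor hg, smul_eq_mul]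
      ring
    rw [h1]
    exact add_mem (Ideal.subset_span ⟨_, rfl⟩) (Ideal.subset_span ⟨_, rfl⟩)

theorem taylor_neg (hf : ContDiffAt ℝ ∞ f p) : taylor p (fun z => -f z) = -taylor p f := by
  have := taylor_mul (contDiffAt_const (c := (-1 : ℂ))) hf
  rw [taylor_const] at this
  simpa using this

theorem taylor_sub (hf : ContDiffAt ℝ ∞ f p) (hg : ContDiffAt ℝ ∞ g p) :
    taylor p (fun z => f z - g z) = taylor p f - taylor p g := by
  simp only [sub_eq_add_neg]
  rw [taylor_add hf hg.neg, taylor_neg hg]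

theorem taylor_sum {ι : Type*} (s : Finset ι) {F : ι → (Fin d → ℂ) → ℂ}
    (hF : ∀ i ∈ s, ContDiffAt ℝ ∞ (F i) p) :
    taylor p (fun z => ∑ i ∈ s, F i z) = ∑ i ∈ s, taylor p (F i) := by
  classical
  induction s using Finset.induction_on with
  | empty => simpa using taylor_const p 0
  | insert i s hi ih =>
    simp only [Finset.sum_insert hi]
    rw [taylor_add (hF i (Finset.mem_insert_self _ _))
      (ContDiffAt.sum fun j hj => hF j (Finset.mem_insert_of_mem hj)),
      ih fun j hj => hF j (Finset.mem_insert_of_mem hj)]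

/-- The series `F̄(ξ, Z)`. -/
noncomputable def conjSwap (F : MvPowerSeries (Fin d ⊕ Fin d) ℂ) :
    MvPowerSeries (Fin d ⊕ Fin d) ℂ :=
  fun α => conj (coeff (α.mapDomain Sum.swap) F)

theorem coeff_conjSwap (F : MvPowerSeries (Fin d ⊕ Fin d) ℂ) (α : Fin d ⊕ Fin d →₀ ℕ) :
    coeff α (conjSwap F) = conj (coeff (α.mapDomain Sum.swap) F) := rfl

theorem pderiv_conjSwap (F : MvPowerSeries (Fin d ⊕ Fin d) ℂ) (i : Fin d ⊕ Fin d) :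
    pderiv ℂ i (conjSwap F) = conjSwap (pderiv ℂ i.swap F) := by
  ext α
  have h : (α.mapDomain Sum.swap) i.swap = α i :=
    Finsupp.mapDomain_apply (Sum.swap_leftInverse.injective) α i
  rw [coeff_pderiv, coeff_conjSwap, coeff_conjSwap, coeff_pderiv, Finsupp.mapDomain_add,
    Finsupp.mapDomain_single, h]
  simp

theorem taylor_conj (hf : ContDiffAt ℝ ∞ f p) :
    taylor p (fun z => conj (f z)) = conjSwap (taylor p f) := by
  have hc : ∀ {f : (Fin d → ℂ) → ℂ}, ContDiffAt ℝ ∞ f p → ContDiffAt ℝ ∞ (fun z => conj (f z)) p :=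
    fun hf => (Complex.conjCLE : ℂ →L[ℝ] ℂ).contDiff.contDiffAt.comp p hf
  let D : {f : (Fin d → ℂ) → ℂ // ContDiffAt ℝ ∞ f p} → MvPowerSeries (Fin d ⊕ Fin d) ℂ :=
    fun x => taylor p (fun z => conj (x.1 z)) - conjSwap (taylor p x.1)
  refine sub_eq_zero.1 (eq_zero_of_pderiv_mem_span D ?_ ?_ ⟨f, hf⟩)
  · rintro ⟨f, hf⟩
    rw [map_sub, constantCoeff_taylor, ← coeff_zero_eq_constantCoeff_apply, coeff_conjSwap,
      Finsupp.mapDomain_zero, coeff_zero_eq_constantCoeff_apply, constantCoeff_taylor, sub_self]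
  · rintro ⟨f, hf⟩ i
    refine Ideal.subset_span ⟨⟨fun z => wirtinger f z i.swap, contDiffAt_wirtinger hf _⟩, ?_⟩
    simp only [D, map_sub]
    rw [pderiv_taylor (hc hf), pderiv_conjSwap, pderiv_taylor hf]
    congr 1
    refine taylor_congr ?_
    filter_upwards [eventually_differentiableAt hf] with z hz
    rw [← wirtinger_conj hz, Sum.swap_swap]

theorem conjSwap_rename_inl (F : MvPowerSeries (Fin d) ℂ) :
    conjSwap (rename Sum.inl F) = rename Sum.inr (map (starRingEnd ℂ) F) := by
  ext α
  rw [coeff_conjSwap]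
  by_cases hα : α ∈ Set.range (Finsupp.mapDomain (Sum.inr : Fin d → Fin d ⊕ Fin d))
  · obtain ⟨β, rfl⟩ := hα
    rw [← Finsupp.mapDomain_comp, show (Sum.swap ∘ Sum.inr : Fin d → Fin d ⊕ Fin d) = Sum.inl from rfl]
    have h1 := coeff_embDomain_rename (R := ℂ) (Function.Embedding.inl : Fin d ↪ Fin d ⊕ Fin d) F β
    have h2 := coeff_embDomain_rename (R := ℂ) (Function.Embedding.inr : Fin d ↪ Fin d ⊕ Fin d)
      (map (starRingEnd ℂ) F) β
    rw [Finsupp.embDomain_eq_mapDomain] at h1 h2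
    rw [coeff_map] at h2
    exact (congrArg conj h1).trans h2.symm
  · rw [coeff_rename_eq_zero (f := (Sum.inr : Fin d → Fin d ⊕ Fin d)) _ hα,
      coeff_rename_eq_zero (f := (Sum.inl : Fin d → Fin d ⊕ Fin d)), map_zero]
    rintro ⟨β, hβ⟩
    refine hα ⟨β, ?_⟩
    have := congrArg (Finsupp.mapDomain Sum.swap) hβ
    rw [← Finsupp.mapDomain_comp, ← Finsupp.mapDomain_comp, Sum.swap_swap_eq,
      Finsupp.mapDomain_id] at this
    exact this

/-- By both chain rules the derivative of the defect of `φ` is a combination of the defects of the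
first derivatives of `φ`. -/
theorem taylor_comp {H : (Fin d → ℂ) → Fin e → ℂ} {φ : (Fin e → ℂ) → ℂ}
    (hφ : ContDiffAt ℝ ∞ φ (H p)) (hH : ContDiffAt ℝ ∞ H p) :
    taylor p (fun z => φ (H z)) =
      subst (fun k => taylor p (realComponents H k) - C (realComponents H k p))
        (taylor (H p) φ) := by
  set a : Fin e ⊕ Fin e → MvPowerSeries (Fin d ⊕ Fin d) ℂ :=
    fun k => taylor p (realComponents H k) - C (realComponents H k p)
  have ha : ∀ k, constantCoeff (a k) = 0 := fun k => by
    rw [map_sub, constantCoeff_taylor, constantCoeff_C, sub_self]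
  have hk := contDiffAt_realComponents hH
  let D : {φ : (Fin e → ℂ) → ℂ // ContDiffAt ℝ ∞ φ (H p)} → MvPowerSeries (Fin d ⊕ Fin d) ℂ :=
    fun x => taylor p (fun z => x.1 (H z)) - subst a (taylor (H p) x.1)
  refine sub_eq_zero.1 (eq_zero_of_pderiv_mem_span D ?_ ?_ ⟨φ, hφ⟩)
  · rintro ⟨φ, hφ⟩
    rw [map_sub, constantCoeff_taylor, constantCoeff_subst_of_constantCoeff_eq_zero ha,
      constantCoeff_taylor, sub_self]
  · rintro ⟨φ, hφ⟩ i
    have hφk : ∀ k, ContDiffAt ℝ ∞ (fun w => wirtinger φ w k) (H p) := contDiffAt_wirtinger hφ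
    have h1 : pderiv ℂ i (taylor p fun z => φ (H z)) =
        ∑ k, taylor p (fun z => wirtinger φ (H z) k) * pderiv ℂ i (a k) := by
      have h2 : ∀ k, pderiv ℂ i (a k) = taylor p fun z => wirtinger (realComponents H k) z i :=
        fun k => by rw [map_sub, pderiv_C, sub_zero, pderiv_taylor (hk k)]
      have h3 : ∀ k, ContDiffAt ℝ ∞ (fun z => wirtinger φ (H z) k) p := fun k => (hφk k).comp p hH
      have hcomp : ContDiffAt ℝ ∞ (fun z => φ (H z)) p := hφ.comp p hH
      rw [pderiv_taylor hcomp]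
      simp only [h2]
      rw [Finset.sum_congr rfl fun k _ => (taylor_mul (h3 k) (contDiffAt_wirtinger (hk k) i)).symm,
        ← taylor_sum _ fun k _ => (h3 k).mul (contDiffAt_wirtinger (hk k) i)]
      refine taylor_congr ?_
      filter_upwards [eventually_differentiableAt hH,
        hH.continuousAt.eventually (eventually_differentiableAt hφ)] with z hz1 hz2
      exact wirtinger_comp hz2 hz1 i
    have h4 : pderiv ℂ i (D ⟨φ, hφ⟩) = ∑ k, pderiv ℂ i (a k) * D ⟨_, hφk k⟩ := by
      simp only [D, map_sub, h1, pderiv_subst ha, pderiv_taylor hφ, mul_sub, Finset.sum_sub_distrib,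
        mul_comm]
    rw [h4]
    exact Ideal.sum_mem _ fun k _ => Ideal.mul_mem_left _ _ (Ideal.subset_span ⟨_, rfl⟩)

end

end CRTransversal

namespace CRTransversal

open MvPowerSeries
open scoped NNReal ENNReal

variable {d e : ℕ}

/-! ## Expansions of holomorphic functions -/

/-- The series `F` converges to `h` on the polydisc of radius `r` around `p`. -/
structure HasExpansion (p : Fin d → ℂ) (h : (Fin d → ℂ) → ℂ) (F : MvPowerSeries (Fin d) ℂ)
    (r : ℝ≥0) : Prop where
  pos : 0 < r
  convergent : F ∈ convergent (fun _ : Fin d => r)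
  eq_eval : ∀ z : Fin d → ℂ, (∀ i, ‖z i‖₊ ≤ r) → h (p + z) = eval F z

section

variable {p : Fin d → ℂ} {h : (Fin d → ℂ) → ℂ} {F : MvPowerSeries (Fin d) ℂ} {r r' : ℝ≥0}

theorem HasExpansion.mono (hF : HasExpansion p h F r) (hr : 0 < r') (hrr : r' ≤ r) :
    HasExpansion p h F r' :=
  ⟨hr, convergent_anti (fun _ => hrr) hF.convergent,
    fun z hz => hF.eq_eval z fun i => (hz i).trans hrr⟩

theorem eval_zero_eq_constantCoeff (F : MvPowerSeries (Fin d) ℂ) :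
    eval F 0 = constantCoeff F := by
  unfold eval
  rw [tsum_eq_single 0]
  · simp
  · intro α hα
    obtain ⟨i, hi⟩ : ∃ i, α i ≠ 0 := by
      by_contra! h'
      exact hα (Finsupp.ext h')
    rw [Finset.prod_eq_zero (Finset.mem_univ i) (by simp [hi]), mul_zero]

theorem HasExpansion.constantCoeff_eq (hF : HasExpansion p h F r) : constantCoeff F = h p := by
  have := hF.eq_eval 0 (by simp)
  rw [eval_zero_eq_constantCoeff, add_zero] at this
  exact this.symm

theorem eventually_forall_nnnorm_lt (p : Fin d → ℂ) (hr : 0 < r) :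
    ∀ᶠ z in 𝓝 p, ∀ i, ‖(z - p) i‖₊ < r := by
  refine eventually_all.2 fun i => ?_
  have : Continuous fun z : Fin d → ℂ => ‖(z - p) i‖₊ := by fun_prop
  exact this.continuousAt.eventually (Iio_mem_nhds (by simpa using hr))

theorem exists_forall_of_eventually {P : (Fin d → ℂ) → Prop} (hP : ∀ᶠ z in 𝓝 p, P z) :
    ∃ r : ℝ≥0, 0 < r ∧ ∀ z : Fin d → ℂ, (∀ i, ‖z i‖₊ ≤ r) → P (p + z) := by
  obtain ⟨ε, hε, hball⟩ := Metric.eventually_nhds_iff.1 hP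
  refine ⟨⟨ε / 2, (half_pos hε).le⟩, half_pos hε, fun z hz => hball ?_⟩
  rw [dist_eq_norm, add_sub_cancel_left]
  refine lt_of_le_of_lt ((pi_norm_le_iff_of_nonneg (half_pos hε).le).2 fun i => ?_) (half_lt_self hε)
  exact_mod_cast hz i

/-- Restriction to a complex line in direction `j` reduces this to the one-variable statement
`deriv_eval`. -/
theorem HasExpansion.pderiv (hF : HasExpansion p h F r) (hh : AnalyticAt ℂ h p) (j : Fin d) :
    ∃ r' ≤ r, HasExpansion p (fun z => fderiv ℂ h z (Pi.single j 1)) (pderiv ℂ j F) r' := by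
  obtain ⟨r₁, hr₁, hd⟩ := exists_forall_of_eventually hh.eventually_analyticAt
  have hr := hF.pos
  have h2 : r / 2 < r := NNReal.half_lt_self hr.ne'
  refine ⟨min r₁ (r / 2), (min_le_right _ _).trans h2.le, lt_min hr₁ (half_pos hr),
    convergent_anti (fun _ => min_le_right _ _) (pderiv_mem_convergent hr j hF.convergent),
    fun z hz => ?_⟩
  have hz2 : ∀ i, ‖z i‖₊ < r := fun i => ((hz i).trans (min_le_right _ _)).trans_lt h2
  rw [← deriv_eval j hF.convergent hz2]
  have hdz := (hd z fun i => (hz i).trans (min_le_left _ _)).differentiableAt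
  have hline : HasDerivAt (fun t : ℂ => p + z + t • (Pi.single j 1 : Fin d → ℂ))
      (Pi.single j 1) 0 := by
    simpa using ((hasDerivAt_id (0 : ℂ)).smul_const (Pi.single j 1 : Fin d → ℂ)).const_add (p + z)
  have hcomp : HasDerivAt (fun t : ℂ => h (p + z + t • (Pi.single j 1 : Fin d → ℂ)))
      (fderiv ℂ h (p + z) (Pi.single j 1)) 0 := by
    refine HasFDerivAt.comp_hasDerivAt (0 : ℂ) (l := h) ?_ hline
    rw [zero_smul, add_zero]
    exact hdz.hasFDerivAt
  rw [← hcomp.deriv]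
  refine EventuallyEq.deriv_eq ?_
  have hev : ∀ᶠ t : ℂ in 𝓝 0, ∀ i, ‖(z + Pi.single j t : Fin d → ℂ) i‖₊ < r := by
    refine eventually_all.2 fun i => ?_
    have hc : Continuous fun t : ℂ => ‖(z + Pi.single j t : Fin d → ℂ) i‖₊ := by
      have : Continuous fun t : ℂ => (Pi.single j t : Fin d → ℂ) :=
        continuous_pi fun k => by
          by_cases hk : k = j
          · subst hk; simpa using continuous_id'
          · simpa [Pi.single_eq_of_ne hk] using continuous_const
      fun_prop
    exact hc.continuousAt.eventually (Iio_mem_nhds (by simpa using hz2 i))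
  filter_upwards [hev] with t ht
  rw [← hF.eq_eval _ fun i => (ht i).le, add_assoc, ← Pi.single_smul, smul_eq_mul, mul_one]

end

section

variable {p z : Fin d → ℂ} {h : (Fin d → ℂ) → ℂ} {F : MvPowerSeries (Fin d) ℂ} {r : ℝ≥0}

theorem wirtinger_inl_of_differentiableAt (hh : DifferentiableAt ℂ h z) (j : Fin d) :
    wirtinger h z (Sum.inl j) = fderiv ℂ h z (Pi.single j 1) := by
  rw [wirtinger_eq, wirtingerCLM_inl, hh.fderiv_restrictScalars ℝ]
  have : (Pi.single j Complex.I : Fin d → ℂ) = Complex.I • Pi.single j 1 := by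
    rw [← Pi.single_smul, smul_eq_mul, mul_one]
  rw [this, ContinuousLinearMap.coe_restrictScalars', map_smul, smul_eq_mul]
  linear_combination (-1 / 2 * fderiv ℂ h z (Pi.single j 1)) * Complex.I_sq

theorem wirtinger_inr_of_differentiableAt (hh : DifferentiableAt ℂ h z) (j : Fin d) :
    wirtinger h z (Sum.inr j) = 0 := by
  rw [wirtinger_eq, wirtingerCLM_inr, hh.fderiv_restrictScalars ℝ]
  have : (Pi.single j Complex.I : Fin d → ℂ) = Complex.I • Pi.single j 1 := by
    rw [← Pi.single_smul, smul_eq_mul, mul_one]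
  rw [this, ContinuousLinearMap.coe_restrictScalars', map_smul, smul_eq_mul]
  linear_combination (1 / 2 * fderiv ℂ h z (Pi.single j 1)) * Complex.I_sq

theorem contDiffAt_real_of_analyticAt {E : Type*} [NormedAddCommGroup E] [NormedSpace ℂ E]
    [CompleteSpace E] {h : (Fin d → ℂ) → E} (hh : AnalyticAt ℂ h p) : ContDiffAt ℝ ∞ h p :=
  (hh.contDiffAt (n := ∞)).restrict_scalars ℝ

/-- The Taylor series of a holomorphic function contains no conjugate variables. -/
theorem taylor_eq_rename (hh : AnalyticAt ℂ h p) (hF : HasExpansion p h F r) :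
    taylor p h = rename Sum.inl F := by
  let ι := {x : ((Fin d → ℂ) → ℂ) × MvPowerSeries (Fin d) ℂ //
    AnalyticAt ℂ x.1 p ∧ ∃ r, HasExpansion p x.1 x.2 r}
  let D : ι → MvPowerSeries (Fin d ⊕ Fin d) ℂ := fun x => taylor p x.1.1 - holo d x.1.2
  refine sub_eq_zero.1 (eq_zero_of_pderiv_mem_span D ?_ ?_ ⟨(h, F), hh, r, hF⟩)
  · rintro ⟨⟨h, F⟩, hh, r, hF⟩
    simp only [D]
    rw [map_sub, constantCoeff_taylor, holo_apply, constantCoeff_rename, hF.constantCoeff_eq,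
      sub_self]
  · rintro ⟨⟨h, F⟩, hh, r, hF⟩ (j | j)
    · obtain ⟨r', -, hF'⟩ := hF.pderiv hh j
      have hh' : AnalyticAt ℂ (fun z => fderiv ℂ h z (Pi.single j 1)) p :=

        ((ContinuousLinearMap.apply ℂ ℂ (Pi.single j 1 : Fin d → ℂ)).analyticAt _).comp hh.fderiv
      refine Ideal.subset_span ⟨⟨(_, _), hh', r', hF'⟩, ?_⟩
      simp only [D]
      rw [map_sub, pderiv_inl_holo, pderiv_taylor (contDiffAt_real_of_analyticAt hh)]
      congr 1
      refine taylor_congr ?_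
      filter_upwards [hh.eventually_analyticAt] with z hz
      rw [wirtinger_inl_of_differentiableAt hz.differentiableAt]
    · simp only [D]
      rw [map_sub, pderiv_inr_holo, pderiv_taylor (contDiffAt_real_of_analyticAt hh), sub_zero]
      have : (fun z => wirtinger h z (Sum.inr j)) =ᶠ[𝓝 p] fun _ => (0 : ℂ) := by
        filter_upwards [hh.eventually_analyticAt] with z hz
        rw [wirtinger_inr_of_differentiableAt hz.differentiableAt]
      rw [taylor_congr this, taylor_const, map_zero]
      exact zero_mem _

end

/-! ## Division by a defining function -/

section

variable {p z : Fin d → ℂ} {ρ : (Fin d → ℂ) → ℝ} {f : (Fin d → ℂ) → ℂ}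

theorem contDiffAt_ofReal (hρ : ContDiffAt ℝ ∞ ρ p) :
    ContDiffAt ℝ ∞ (fun z => (ρ z : ℂ)) p :=
  Complex.ofRealCLM.contDiff.contDiffAt.comp p hρ

theorem fderiv_ofReal (hρ : DifferentiableAt ℝ ρ z) :
    fderiv ℝ (fun z => (ρ z : ℂ)) z = Complex.ofRealCLM.comp (fderiv ℝ ρ z) :=
  (Complex.ofRealCLM.hasFDerivAt.comp z hρ.hasFDerivAt).fderiv

theorem exists_gradient_ne_zero (hρ : DifferentiableAt ℝ ρ z) (h : fderiv ℝ ρ z ≠ 0) :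
    ∃ i, gradient ρ z i ≠ 0 := by
  by_contra! h'
  refine h (ContinuousLinearMap.ext fun w => ?_)
  have h1 := apply_eq_sum_wirtingerCLM (fderiv ℝ (fun z => (ρ z : ℂ)) z) w
  simp only [← wirtinger_eq] at h1
  have h2 : ∀ i, wirtinger (fun z => (ρ z : ℂ)) z i = 0 := h'
  simp only [h2, zero_mul, Finset.sum_const_zero, add_zero, fderiv_ofReal hρ] at h1
  exact Complex.ofReal_eq_zero.1 h1

/-- Lagrange multipliers: `g` is constant on the level set of `ρ`, so `z` is an extremum there; the
multiplier of `g` cannot vanish because `fderiv ℝ ρ z ≠ 0`. -/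
theorem exists_fderiv_eq_smul {g : (Fin d → ℂ) → ℝ} (hρ : ContDiffAt ℝ 1 ρ z)
    (hg : ContDiffAt ℝ 1 g z) (hne : fderiv ℝ ρ z ≠ 0) (hz : ρ z = 0)
    (h : ∀ᶠ w in 𝓝 z, ρ w = 0 → g w = 0) : ∃ c : ℝ, fderiv ℝ g z = c • fderiv ℝ ρ z := by
  have hext : IsLocalExtrOn g {w | ρ w = ρ z} z := by
    left
    filter_upwards [mem_nhdsWithin_of_mem_nhds h, self_mem_nhdsWithin] with w h1 h2
    rw [h1 (h2.trans hz), h.self_of_nhds hz]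
  obtain ⟨a, b, hab, heq⟩ := hext.exists_multipliers_of_hasStrictFDerivAt_1d
    (hρ.hasStrictFDerivAt (by simp)) (hg.hasStrictFDerivAt (by simp))
  have hb : b ≠ 0 := by
    rintro rfl
    rw [zero_smul, add_zero, smul_eq_zero] at heq
    exact hab (by rw [heq.resolve_right hne]; rfl)
  refine ⟨-(b⁻¹ * a), ?_⟩
  ext w
  have h1 : a * fderiv ℝ ρ z w + b * fderiv ℝ g z w = 0 := congrArg (fun L => L w) heq
  change fderiv ℝ g z w = -(b⁻¹ * a) * fderiv ℝ ρ z w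
  field_simp
  linear_combination h1

/-- The differential of a function vanishing on `ρ = 0` is a multiple of that of `ρ`. -/
theorem exists_wirtinger_eq_mul (hρ : ContDiffAt ℝ 1 ρ z) (hf : ContDiffAt ℝ 1 f z)
    (hne : fderiv ℝ ρ z ≠ 0) (hz : ρ z = 0) (h : ∀ᶠ w in 𝓝 z, ρ w = 0 → f w = 0) :
    ∃ c : ℂ, ∀ i, wirtinger f z i = c * gradient ρ z i := by
  have hre : ContDiffAt ℝ 1 (fun w => (f w).re) z := Complex.reCLM.contDiff.contDiffAt.comp z hf
  have him : ContDiffAt ℝ 1 (fun w => (f w).im) z := Complex.imCLM.contDiff.contDiffAt.comp z hf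
  obtain ⟨a, ha⟩ := exists_fderiv_eq_smul hρ hre hne hz
    (by filter_upwards [h] with w hw h0; rw [hw h0, Complex.zero_re])
  obtain ⟨b, hb⟩ := exists_fderiv_eq_smul hρ him hne hz
    (by filter_upwards [h] with w hw h0; rw [hw h0, Complex.zero_im])
  have hfd := hf.differentiableAt (by simp)
  have hre' : fderiv ℝ (fun w => (f w).re) z = Complex.reCLM.comp (fderiv ℝ f z) :=
    (Complex.reCLM.hasFDerivAt.comp z hfd.hasFDerivAt).fderiv
  have him' : fderiv ℝ (fun w => (f w).im) z = Complex.imCLM.comp (fderiv ℝ f z) :=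
    (Complex.imCLM.hasFDerivAt.comp z hfd.hasFDerivAt).fderiv
  refine ⟨a + b * Complex.I, fun i => ?_⟩
  unfold gradient
  rw [wirtinger_eq, wirtinger_eq, ← wirtingerCLM_smul, fderiv_ofReal (hρ.differentiableAt (by simp))]
  congr 1
  ext w
  have h1 := congrArg (fun L => L w) (hre'.symm.trans ha)
  have h2 := congrArg (fun L => L w) (him'.symm.trans hb)
  simp only [ContinuousLinearMap.comp_apply, Complex.reCLM_apply, Complex.imCLM_apply,
    _root_.smul_apply, smul_eq_mul] at h1 h2
  rw [_root_.smul_apply, ContinuousLinearMap.comp_apply, Complex.ofRealCLM_apply, smul_eq_mul,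
    ← Complex.re_add_im (fderiv ℝ f z w), h1, h2]
  push_cast
  ring

theorem constantCoeff_pderiv_taylor (hf : ContDiffAt ℝ ∞ f p) (i : Fin d ⊕ Fin d) :
    constantCoeff (pderiv ℂ i (taylor p f)) = wirtinger f p i := by
  rw [pderiv_taylor hf, constantCoeff_taylor]

/-- The Taylor series of a function vanishing on the hypersurface `ρ = 0` is divisible by that
of `ρ`. -/
theorem taylor_dvd_taylor (hρ : ContDiffAt ℝ ∞ ρ p) (hp : ρ p = 0) (hne : fderiv ℝ ρ p ≠ 0)
    (hf : ContDiffAt ℝ ∞ f p) (h : ∀ᶠ z in 𝓝 p, ρ z = 0 → f z = 0) :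
    taylor p (fun z => (ρ z : ℂ)) ∣ taylor p f := by
  classical
  have hρ1 : ContDiffAt ℝ 1 ρ p := hρ.of_le (by simp)
  obtain ⟨i₀, hi₀⟩ := exists_gradient_ne_zero (hρ1.differentiableAt (by simp)) hne
  have hR := contDiffAt_ofReal hρ
  have hg : ∀ i, ContDiffAt ℝ ∞ (fun z => gradient ρ z i) p := contDiffAt_wirtinger hR
  have hne' : ∀ᶠ z in 𝓝 p, gradient ρ z i₀ ≠ 0 := (hg i₀).continuousAt.eventually_ne hi₀
  have hnef : ∀ᶠ z in 𝓝 p, fderiv ℝ ρ z ≠ 0 :=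
    (hρ1.fderiv_right (m := 0) (by simp)).continuousAt.eventually_ne hne
  have hq : ∀ i, ContDiffAt ℝ ∞ (fun z => gradient ρ z i / gradient ρ z i₀) p := fun i =>
    by simp only [div_eq_mul_inv]; exact (hg i).mul ((hg i₀).inv hi₀)
  -- Taylor series of the tangential fields `∂ᵢ - (ρᵢ / ρ_{i₀}) ∂_{i₀}`, whose values at `p` are the
  -- ones that `mem_span_of_vectorFields` asks for.
  let V : Fin d ⊕ Fin d → Fin d ⊕ Fin d → MvPowerSeries (Fin d ⊕ Fin d) ℂ := fun i j =>
    (if i = j then 1 else 0) -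
      if j = i₀ then taylor p (fun z => gradient ρ z i / gradient ρ z i₀) else 0
  have hV : ∀ i {f : (Fin d → ℂ) → ℂ}, ContDiffAt ℝ ∞ f p → vectorField (V i) (taylor p f) =
      taylor p fun z => wirtinger f z i -
        gradient ρ z i / gradient ρ z i₀ * wirtinger f z i₀ := by
    intro i f hf
    rw [vectorField_apply, taylor_sub (contDiffAt_wirtinger hf i)
      ((hq i).mul (contDiffAt_wirtinger hf i₀)), taylor_mul (hq i) (contDiffAt_wirtinger hf i₀)]
    simp [V, sub_mul, pderiv_taylor hf, ite_mul]
  have hX : ∀ i {f : (Fin d → ℂ) → ℂ}, ContDiffAt ℝ ∞ f p → ContDiffAt ℝ ∞ (fun z =>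
      wirtinger f z i - gradient ρ z i / gradient ρ z i₀ * wirtinger f z i₀) p := fun i f hf =>
    (contDiffAt_wirtinger hf i).sub ((hq i).mul (contDiffAt_wirtinger hf i₀))
  rw [← Ideal.mem_span_singleton]
  -- The stable set consists of the Taylor series of all smooth functions vanishing on the
  -- hypersurface; no smooth quotient by `ρ` has to be constructed.
  refine mem_span_of_vectorFields (i₀ := i₀) (by rw [constantCoeff_taylor, hp, Complex.ofReal_zero])
    V ?_ ?_ {G | ∃ f, ContDiffAt ℝ ∞ f p ∧ (∀ᶠ z in 𝓝 p, ρ z = 0 → f z = 0) ∧ taylor p f = G}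
    ?_ ?_ ⟨f, hf, h, rfl⟩
  · intro i j
    rw [← constantCoeff_pderiv, ← constantCoeff_pderiv, constantCoeff_pderiv_taylor hR,
      constantCoeff_pderiv_taylor hR]
    simp only [V, map_sub, apply_ite (constantCoeff (σ := Fin d ⊕ Fin d) (R := ℂ)), map_one,
      map_zero, constantCoeff_taylor]
    rfl
  · intro i
    rw [hV i hR]
    have : (fun z => wirtinger (fun z => (ρ z : ℂ)) z i - gradient ρ z i / gradient ρ z i₀ *
        wirtinger (fun z => (ρ z : ℂ)) z i₀) =ᶠ[𝓝 p] fun _ => (0 : ℂ) := by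
      filter_upwards [hne'] with z hz
      change gradient ρ z i - gradient ρ z i / gradient ρ z i₀ * gradient ρ z i₀ = 0
      rw [div_mul_cancel₀ _ hz, sub_self]
    rw [taylor_congr this, taylor_const, map_zero]
    exact zero_mem _
  · rintro _ ⟨f, -, h, rfl⟩
    rw [constantCoeff_taylor, h.self_of_nhds hp]
  · rintro i _ ⟨f, hf, h, rfl⟩
    refine ⟨_, hX i hf, ?_, (hV i hf).symm⟩
    have hf1 : ContDiffAt ℝ 1 f p := hf.of_le (by simp)
    filter_upwards [hne', hnef, h.eventually_nhds, hρ1.eventually (by simp),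
      hf1.eventually (by simp)] with z h1 h2 h3 h4 h5 hz
    -- On the hypersurface the differential of `f` is a multiple of that of `ρ`, so a tangential
    -- derivative of `f` vanishes there again.
    obtain ⟨c, hc⟩ := exists_wirtinger_eq_mul h4 h5 h2 hz h3
    rw [hc, hc]
    field_simp
    ring

end

end CRTransversal

namespace CRTransversal

open MvPowerSeries
open scoped NNReal ENNReal

variable {d e : ℕ}

/-! ## From smooth to formal hypersurfaces -/

section

variable {p : Fin d → ℂ} {ρ : (Fin d → ℂ) → ℝ}

theorem isFormalHypersurface_taylor (hρ : ContDiffAt ℝ ∞ ρ p) (hp : ρ p = 0)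
    (hne : fderiv ℝ ρ p ≠ 0) : IsFormalHypersurface (taylor p fun z => (ρ z : ℂ)) where
  constantCoeff_eq_zero := by rw [constantCoeff_taylor, hp, Complex.ofReal_zero]
  hermitian m := by
    have h := taylor_conj (contDiffAt_ofReal hρ)
    simp only [Complex.conj_ofReal] at h
    have h1 := congrArg (coeff m) h
    rw [coeff_conjSwap] at h1
    rw [h1, Complex.conj_conj]
  differential_ne_zero := by
    obtain ⟨i, hi⟩ := exists_gradient_ne_zero (hρ.differentiableAt (by simp)) hne
    exact ⟨i, by rw [constantCoeff_pderiv_taylor (contDiffAt_ofReal hρ)]; exact hi⟩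

theorem formalGradient_taylor (hρ : ContDiffAt ℝ ∞ ρ p) :
    formalGradient (taylor p fun z => (ρ z : ℂ)) = gradient ρ p :=
  funext fun i => constantCoeff_pderiv_taylor (contDiffAt_ofReal hρ) i

theorem formalLeviRank_taylor (hρ : ContDiffAt ℝ ∞ ρ p) :
    formalLeviRank (taylor p fun z => (ρ z : ℂ)) = leviRank ρ p := by
  have h : formalLeviMatrix (taylor p fun z => (ρ z : ℂ)) = leviMatrix ρ p := by
    ext i j
    have hR := contDiffAt_ofReal hρ
    change constantCoeff (pderiv ℂ _ (pderiv ℂ _ (taylor p fun z => (ρ z : ℂ)))) = _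
    rw [pderiv_taylor hR, constantCoeff_pderiv_taylor (contDiffAt_wirtinger hR _)]
    rfl
  rw [formalLeviRank, h, formalGradient_taylor hρ, leviRank]

/-- Taylor expansion maps the Lie algebra of a hypersurface to that of its formal counterpart. -/
theorem CRLieAlgebra.taylor {V : Set (Fin d → ℂ)} {X : (Fin d → ℂ) → Fin d ⊕ Fin d → ℂ}
    (hX : CRLieAlgebra V ρ X) (hV : V ∈ 𝓝 p) (hρ : ContDiffAt ℝ ∞ ρ p) (hp : ρ p = 0)
    (hne : fderiv ℝ ρ p ≠ 0) :
    (∀ k, ContDiffAt ℝ ∞ (fun z => X z k) p) ∧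
      FormalCRLieAlgebra (CRTransversal.taylor p fun z => (ρ z : ℂ))
        fun k => CRTransversal.taylor p fun z => X z k := by
  have hR := contDiffAt_ofReal hρ
  have hg : ∀ i, ContDiffAt ℝ ∞ (fun z => gradient ρ z i) p := contDiffAt_wirtinger hR
  have tangent : ∀ X : (Fin d → ℂ) → Fin d ⊕ Fin d → ℂ, (∀ k, ContDiffAt ℝ ∞ (fun z => X z k) p) →
      (∀ z ∈ V, ρ z = 0 → X z ∈ complexTangent (gradient ρ z)) →
      CRTransversal.taylor p (fun z => (ρ z : ℂ)) ∣ ∑ i, CRTransversal.taylor p (fun z => X z i) *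
        pderiv ℂ i (CRTransversal.taylor p fun z => (ρ z : ℂ)) := by
    intro X hX ht
    have h1 : ∑ i, CRTransversal.taylor p (fun z => X z i) *
        pderiv ℂ i (CRTransversal.taylor p fun z => (ρ z : ℂ)) =
          CRTransversal.taylor p fun z => ∑ i, X z i * gradient ρ z i := by
      rw [taylor_sum _ fun i _ => (hX i).mul (hg i)]
      refine Finset.sum_congr rfl fun i _ => ?_
      rw [taylor_mul (hX i) (hg i), pderiv_taylor hR]
      rfl
    rw [h1]
    -- Vanishing along the hypersurface turns into divisibility by the Taylor series of `ρ`, which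
    -- is the formal notion of tangency.
    refine taylor_dvd_taylor hρ hp hne (ContDiffAt.sum fun i _ => (hX i).mul (hg i)) ?_
    filter_upwards [hV] with z hz h0
    have := ht z hz h0
    rw [← (show ∑ i, gradient ρ z i * X z i = 0 from this)]
    exact Finset.sum_congr rfl fun i _ => mul_comm _ _
  induction hX with
  | cr X smooth ht type =>
    have hX := contDiffAt_pi.1 (smooth.contDiffAt hV)
    refine ⟨hX, .cr _ (tangent X hX ht) fun j => taylor_dvd_taylor hρ hp hne (hX _) ?_⟩
    filter_upwards [hV] with z hz h0 using type z hz h0 j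
  | conjCR X smooth ht type =>
    have hX := contDiffAt_pi.1 (smooth.contDiffAt hV)
    refine ⟨hX, .conjCR _ (tangent X hX ht) fun j => taylor_dvd_taylor hρ hp hne (hX _) ?_⟩
    filter_upwards [hV] with z hz h0 using type z hz h0 j
  | add X Y _ _ hX hY =>
    refine ⟨fun k => (hX.1 k).add (hY.1 k), ?_⟩
    convert FormalCRLieAlgebra.add _ _ hX.2 hY.2 using 1
    funext k
    exact taylor_add (hX.1 k) (hY.1 k)
  | smul c X _ hX =>
    refine ⟨fun k => contDiffAt_const.mul (hX.1 k), ?_⟩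
    convert FormalCRLieAlgebra.smul c _ hX.2 using 1
    funext k
    have := taylor_mul (contDiffAt_const (c := c)) (hX.1 k)
    rw [taylor_const] at this
    rw [Pi.smul_apply, smul_eq_C_mul]
    exact this
  | lie X Y _ _ hX hY =>
    have h1 : ∀ k i, ContDiffAt ℝ ∞ (fun z => X z i * wirtinger (fun w => Y w k) z i) p :=
      fun k i => (hX.1 i).mul (contDiffAt_wirtinger (hY.1 k) i)
    have h2 : ∀ k i, ContDiffAt ℝ ∞ (fun z => Y z i * wirtinger (fun w => X w k) z i) p :=
      fun k i => (hY.1 i).mul (contDiffAt_wirtinger (hX.1 k) i)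
    refine ⟨fun k => ContDiffAt.sum fun i _ => (h1 k i).sub (h2 k i), ?_⟩
    convert FormalCRLieAlgebra.lie _ _ hX.2 hY.2 using 1
    funext k
    simp only [bracket, formalBracket]
    rw [taylor_sum _ fun i _ => (h1 k i).sub (h2 k i)]
    refine Finset.sum_congr rfl fun i _ => ?_
    rw [taylor_sub (h1 k i) (h2 k i), taylor_mul (hX.1 i) (contDiffAt_wirtinger (hY.1 k) i),
      taylor_mul (hY.1 i) (contDiffAt_wirtinger (hX.1 k) i), pderiv_taylor (hX.1 k),
      pderiv_taylor (hY.1 k)]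

end

/-! ## Expansion of a holomorphic map and of its Jacobian minors -/

section

variable {p : Fin d → ℂ} {r : ℝ≥0}

theorem HasExpansion.congr {h h' : (Fin d → ℂ) → ℂ} {F : MvPowerSeries (Fin d) ℂ}
    (hF : HasExpansion p h F r) (hh : h =ᶠ[𝓝 p] h') : ∃ r', HasExpansion p h' F r' := by
  obtain ⟨r₁, hr₁, h₁⟩ := exists_forall_of_eventually hh
  refine ⟨min r₁ r, lt_min hr₁ hF.pos, convergent_anti (fun _ => min_le_right _ _) hF.convergent,
    fun z hz => ?_⟩
  rw [← h₁ z fun i => (hz i).trans (min_le_left _ _)]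
  exact hF.eq_eval z fun i => (hz i).trans (min_le_right _ _)

theorem exists_common_radius {ι : Type*} [Finite ι] {h : ι → (Fin d → ℂ) → ℂ}
    {F : ι → MvPowerSeries (Fin d) ℂ} (hF : ∀ i, ∃ r, HasExpansion p (h i) (F i) r)
    {r₀ : ℝ≥0} (hr₀ : 0 < r₀) :
    ∃ r, 0 < r ∧ r ≤ r₀ ∧ ∀ i, HasExpansion p (h i) (F i) r := by
  classical
  cases nonempty_fintype ι
  choose r hr using hF
  refine ⟨(insert r₀ (Finset.univ.image r)).min' (Finset.insert_nonempty _ _), ?_, ?_, ?_⟩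
  · rw [Finset.lt_min'_iff]
    intro y hy
    rw [Finset.mem_insert, Finset.mem_image] at hy
    obtain rfl | ⟨i, -, rfl⟩ := hy
    exacts [hr₀, (hr i).pos]
  · exact Finset.min'_le _ _ (Finset.mem_insert_self _ _)
  · intro i
    refine (hr i).mono ?_ (Finset.min'_le _ _ (Finset.mem_insert_of_mem
      (Finset.mem_image_of_mem _ (Finset.mem_univ i))))
    rw [Finset.lt_min'_iff]
    intro y hy
    rw [Finset.mem_insert, Finset.mem_image] at hy
    obtain rfl | ⟨i, -, rfl⟩ := hy
    exacts [hr₀, (hr i).pos]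

/-- The determinant is formed inside the ring of series convergent at the fixed radius, where
evaluation is a ring homomorphism. -/
theorem HasExpansion.det {k : ℕ} {A : (Fin d → ℂ) → Matrix (Fin k) (Fin k) ℂ}
    {B : Matrix (Fin k) (Fin k) (MvPowerSeries (Fin d) ℂ)} (hr : 0 < r)
    (hA : ∀ i j, HasExpansion p (fun z => A z i j) (B i j) r) :
    HasExpansion p (fun z => (A z).det) B.det r := by
  let B' : Matrix (Fin k) (Fin k) (MvPowerSeries.convergent fun _ : Fin d => r) :=
    Matrix.of fun i j => ⟨B i j, (hA i j).convergent⟩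
  have hB : B.det = (B'.det : MvPowerSeries (Fin d) ℂ) := by
    change _ = (MvPowerSeries.convergent fun _ : Fin d => r).subtype _
    rw [RingHom.map_det]
    rfl
  refine ⟨hr, by rw [hB]; exact B'.det.2, fun z hz => ?_⟩
  rw [hB, ← evalHom_apply hz, RingHom.map_det]
  congr 1
  ext i j
  exact (hA i j).eq_eval z hz

/-- The series are the expansions of the components with their constants removed; conjugation of
functions becomes exchange of `Z` and `ξ` with conjugated coefficients, which produces
`complexification F`. -/
theorem exists_series_of_analyticAt {H : (Fin d → ℂ) → Fin e → ℂ} (hH : AnalyticAt ℂ H p) :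
    ∃ F : Fin e → MvPowerSeries (Fin d) ℂ, (∀ i, constantCoeff (F i) = 0) ∧
      (∀ φ : (Fin e → ℂ) → ℂ, ContDiffAt ℝ ∞ φ (H p) →
        taylor p (fun z => φ (H z)) = subst (complexification F) (taylor (H p) φ)) ∧
      ∃ r, 0 < r ∧ ∀ i j, HasExpansion p (fun z => jacobian H z i j) (formalJacobian F i j) r := by
  have hHi : ∀ i, AnalyticAt ℂ (fun z => H z i) p := analyticAt_pi_iff.1 hH
  choose F r hr hF hFe using fun i => exists_convergent_eval (hHi i)
  have hexp : ∀ i, HasExpansion p (fun z => H z i) (F i) (r i) := fun i => ⟨hr i, hF i, hFe i⟩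
  refine ⟨fun i => F i - C (H p i), fun i => ?_, fun φ hφ => ?_, ?_⟩
  · rw [map_sub, constantCoeff_C, (hexp i).constantCoeff_eq, sub_self]
  · rw [taylor_comp hφ (contDiffAt_real_of_analyticAt hH)]
    congr 1
    funext k
    rcases k with k | k
    · rw [complexification_inl, map_sub]
      change taylor p (fun z => H z k) - C (H p k) = _
      rw [taylor_eq_rename (hHi k) (hexp k)]
      simp [holo_apply]
    · rw [complexification_inr, map_sub]
      change taylor p (fun z => conj (H z k)) - C (conj (H p k)) = _
      rw [taylor_conj (contDiffAt_real_of_analyticAt (hHi k)),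
        taylor_eq_rename (hHi k) (hexp k), conjSwap_rename_inl]
      simp [antiholo_apply]
  · obtain ⟨r, hr, -, h⟩ := exists_common_radius (p := p)
      (h := fun (x : Fin e × Fin d) z => jacobian H z x.1 x.2)
      (F := fun x => formalJacobian (fun i => F i - C (H p i)) x.1 x.2) (fun x => by
        obtain ⟨r', -, h'⟩ := (hexp x.1).pderiv (hHi x.1) x.2
        have h1 : formalJacobian (fun i => F i - C (H p i)) x.1 x.2 = pderiv ℂ x.2 (F x.1) := by
          simp [formalJacobian]
        rw [h1]
        refine h'.congr ?_
        filter_upwards [hH.eventually_analyticAt] with z hz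
        change fderiv ℂ (fun z => H z x.1) z (Pi.single x.2 1) = fderiv ℂ H z (Pi.single x.2 1) x.1
        rw [fderiv_apply hz.differentiableAt]
        rfl) one_pos
    exact ⟨r, hr, fun i j => h (i, j)⟩

end

end CRTransversal

namespace CRTransversal

open MvPowerSeries
open scoped NNReal ENNReal

variable {d e : ℕ}

/-! ## The degeneracy loci -/

section

variable {p : Fin d → ℂ} {r : ℝ≥0} {H : (Fin d → ℂ) → Fin e → ℂ}
  {F : Fin e → MvPowerSeries (Fin d) ℂ}

theorem rank_jacobian_lt_iff {k : ℕ} (z : Fin d → ℂ) : (jacobian H z).rank < k ↔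
    ∀ (a : Fin k ↪o Fin e) (b : Fin k ↪o Fin d), ((jacobian H z).submatrix a b).det = 0 := by
  constructor
  · intro h a b
    by_contra h0
    exact absurd (IsMinor.le_rank ⟨a, b, rfl⟩ h0) (not_le.2 h)
  · intro h
    by_contra hk
    obtain ⟨δ, ⟨a, b, rfl⟩, h0⟩ := exists_isMinor_ne_zero _ (not_lt.1 hk)
    exact h0 (h a b)

theorem HasExpansion.minor {k : ℕ} (hr : 0 < r)
    (hF : ∀ i j, HasExpansion p (fun z => jacobian H z i j) (formalJacobian F i j) r)
    (a : Fin k ↪o Fin e) (b : Fin k ↪o Fin d) :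
    HasExpansion p (fun z => ((jacobian H z).submatrix a b).det)
      ((formalJacobian F).submatrix a b).det r :=
  HasExpansion.det hr fun i j => hF (a i) (b j)

theorem exists_isMinor_formalJacobian_ne_zero {k : ℕ} (hr : 0 < r)
    (hF : ∀ i j, HasExpansion p (fun z => jacobian H z i j) (formalJacobian F i j) r)
    (h : ¬ ∀ᶠ z in 𝓝 p, z ∈ degeneracyLocus H k) :
    ∃ δ, IsMinor (formalJacobian F) k δ ∧ δ ≠ 0 := by
  by_contra! h0
  refine h ?_
  filter_upwards [eventually_forall_nnnorm_lt p hr] with z hz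
  refine (rank_jacobian_lt_iff z).2 fun a b => ?_
  have := (HasExpansion.minor hr hF a b).eq_eval (z - p) fun i => (hz i).le
  rw [add_sub_cancel, h0 _ ⟨a, b, rfl⟩] at this
  rw [this]
  simpa using eval_C 0 (z - p)

/-- If the locus where the rank is less than `s` has codimension at least two, then the
`s`-minors have no common prime factor. -/
theorem exists_isMinor_not_dvd {s : ℕ} (hr : 0 < r)
    (hF : ∀ i j, HasExpansion p (fun z => jacobian H z i j) (formalJacobian F i j) r)
    (h : GermCodimGE (degeneracyLocus H s) p 2) {D : MvPowerSeries (Fin d) ℂ} (hD : Prime D) :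
    ∃ δ, IsMinor (formalJacobian F) s δ ∧ ¬ D ∣ δ := by
  by_contra! hdvd
  have hD0 : constantCoeff D = 0 := by
    by_contra h0
    exact hD.not_isUnit (isUnit_iff_constantCoeff.2 (isUnit_iff_ne_zero.2 h0))
  obtain h | ⟨k, hk, f, hf, hfz⟩ := h
  -- If the locus is empty near `p`, a common prime factor is excluded already because it would make
  -- all `s`-minors vanish at `p`.
  · refine h.self_of_nhds ((rank_jacobian_lt_iff p).2 fun a b => ?_)
    rw [← (HasExpansion.minor hr hF a b).constantCoeff_eq]
    obtain ⟨c, hc⟩ := hdvd _ ⟨a, b, rfl⟩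
    rw [hc, map_mul, hD0, zero_mul]
  · choose G R hR hG hGe using fun i => exists_convergent_eval (hf i).1
    obtain ⟨r₁, hr₁, hz₁⟩ := exists_forall_of_eventually hfz
    let ι := ((Fin s ↪o Fin e) × (Fin s ↪o Fin d)) ⊕ Fin k
    obtain ⟨r', hr', hr'le, hexp⟩ := exists_common_radius (p := p) (ι := ι)
      (h := Sum.elim (fun x z => ((jacobian H z).submatrix x.1 x.2).det) f)
      (F := Sum.elim (fun x => ((formalJacobian F).submatrix x.1 x.2).det) G) (by
        rintro (x | i)
        · exact ⟨r, HasExpansion.minor hr hF x.1 x.2⟩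
        · exact ⟨R i, hR i, hG i, hGe i⟩) hr₁
    set g : ι → MvPowerSeries (Fin d) ℂ :=
      Sum.elim (fun x => ((formalJacobian F).submatrix x.1 x.2).det) G with hg
    obtain ⟨m, ⟨ε⟩⟩ := Finite.exists_equiv_fin ι
    -- The `s`-minors together with the `k` functions `f i` have no common zero near `p` other than
    -- possibly `p`.
    have hrad := X_mem_radical_of_isolated_zero d m (g ∘ ε.symm) (fun _ => r') (fun _ => hr')
      (fun x => (hexp (ε.symm x)).convergent) (fun z hz hzero => by
        have hval : ∀ x : ι, Sum.elim (fun x : (Fin s ↪o Fin e) × (Fin s ↪o Fin d) =>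
            fun z => ((jacobian H z).submatrix x.1 x.2).det) f x (p + z) = 0 := fun x => by
          rw [(hexp x).eq_eval z hz]
          simpa using hzero (ε x)
        have := hz₁ z (fun i => (hz i).trans hr'le)
          ((rank_jacobian_lt_iff _).2 fun a b => hval (Sum.inl (a, b)))
          fun i => hval (Sum.inr i)
        simpa using this)
    have hle : Ideal.span (Set.range (g ∘ ε.symm)) ≤ Ideal.span (insert D (Set.range G)) := by
      rw [Ideal.span_le]
      rintro _ ⟨x, rfl⟩
      rw [Function.comp_apply]
      rcases ε.symm x with y | i
      · exact Ideal.mem_of_dvd _ (hdvd _ ⟨y.1, y.2, rfl⟩)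
          (Ideal.subset_span (Set.mem_insert _ _))
      · exact Ideal.subset_span (Set.mem_insert_of_mem _ ⟨i, rfl⟩)
    -- If `D` divides all minors, then `D` and the `k ≤ d - 2` series `G i` already generate an
    -- ideal with radical the maximal ideal: at most `d - 1` generators, one too few.
    have hcard := le_ncard_of_X_mem_radical (s := insert D (Set.range G))
      ((Set.finite_range G).insert D) (by
        rintro _ (rfl | ⟨i, rfl⟩)
        · exact hD0
        · rw [HasExpansion.constantCoeff_eq ⟨hR i, hG i, hGe i⟩]
          exact (hf i).2)
      fun j => Ideal.radical_mono hle (hrad j)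
    have h1 := Set.ncard_insert_le D (Set.range G)
    have h2 : (Set.range G).ncard ≤ k := by
      rw [← Set.image_univ]
      refine (Set.ncard_image_le Set.finite_univ).trans ?_
      rw [Set.ncard_univ, Nat.card_fin]
    omega

end

/-! ## Transversality of holomorphic maps -/

theorem ker_sup_range_eq_top {E G : Type*} [NormedAddCommGroup E] [NormedSpace ℝ E]
    [NormedAddCommGroup G] [NormedSpace ℝ G] (A : G →L[ℝ] ℝ) (B : E →L[ℝ] G) {v : E}
    (hv : A (B v) ≠ 0) :
    LinearMap.ker A.toLinearMap ⊔ LinearMap.range B.toLinearMap = ⊤ := by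
  rw [eq_top_iff]
  rintro z -
  rw [← sub_add_cancel z (B ((A z / A (B v)) • v))]
  refine Submodule.add_mem_sup ?_ ⟨_, rfl⟩
  rw [LinearMap.mem_ker]
  change A (z - _) = 0
  rw [map_sub, map_smul, map_smul, smul_eq_mul, div_mul_cancel₀ _ hv, sub_self]

theorem isTransversalAt_of_sum_ne_zero {p : Fin d → ℂ} {H : (Fin d → ℂ) → Fin e → ℂ}
    {ρ' : (Fin e → ℂ) → ℝ} (hH : DifferentiableAt ℂ H p) (hρ' : DifferentiableAt ℝ ρ' (H p))
    {j : Fin d} (h : ∑ i, gradient ρ' (H p) (Sum.inl i) * jacobian H p i j ≠ 0) :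
    IsTransversalAt H ρ' p := by
  set S := ∑ i, gradient ρ' (H p) (Sum.inl i) * jacobian H p i j with hS
  -- In this direction the real differential of `ρ' ∘ H` takes the value `2 |S|²`.
  refine ker_sup_range_eq_top (fderiv ℝ ρ' (H p)) (fderiv ℝ H p) (v := Pi.single j (conj S)) ?_
  have hB : fderiv ℝ H p (Pi.single j (conj S)) = fun i => conj S * jacobian H p i j := by
    rw [hH.fderiv_restrictScalars ℝ, ContinuousLinearMap.coe_restrictScalars']
    have : (Pi.single j (conj S) : Fin d → ℂ) = conj S • Pi.single j 1 := by
      rw [← Pi.single_smul, smul_eq_mul, mul_one]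
    rw [this, map_smul]
    rfl
  have hconj : ∀ i, gradient ρ' (H p) (Sum.inr i) = conj (gradient ρ' (H p) (Sum.inl i)) := by
    intro i
    have := wirtinger_conj (f := fun z => (ρ' z : ℂ)) (z := H p)
      (Complex.ofRealCLM.differentiableAt.comp _ hρ') (Sum.inl i)
    simp only [Complex.conj_ofReal] at this
    exact this
  have h1 : ((fderiv ℝ ρ' (H p) (fun i => conj S * jacobian H p i j) : ℝ) : ℂ) =
      conj S * S + S * conj S := by
    have h2 := apply_eq_sum_wirtingerCLM (fderiv ℝ (fun z => (ρ' z : ℂ)) (H p))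
      fun i => conj S * jacobian H p i j
    simp only [← wirtinger_eq] at h2
    rw [fderiv_ofReal hρ'] at h2
    refine h2.trans ?_
    change ∑ i, gradient ρ' (H p) (Sum.inl i) * _ + ∑ i, gradient ρ' (H p) (Sum.inr i) * _ = _
    congr 1
    · conv_rhs => rw [hS, Finset.mul_sum]
      refine Finset.sum_congr rfl fun i _ => by ring
    · have h3 : conj S = ∑ i, conj (gradient ρ' (H p) (Sum.inl i) * jacobian H p i j) := by
        rw [hS, map_sum]
      rw [h3, Finset.mul_sum]
      refine Finset.sum_congr rfl fun i _ => ?_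
      rw [← h3, hconj, map_mul, map_mul, Complex.conj_conj]
      ring
  rw [hB]
  intro h0
  rw [h0, Complex.ofReal_zero, mul_comm S, ← two_mul, zero_eq_mul, mul_eq_zero] at h1
  rcases h1 with h1 | h1 | h1
  · exact two_ne_zero h1
  · exact h ((_root_.map_eq_zero _).1 h1)
  · exact h h1

/-- Transversality of holomorphic maps between smooth real hypersurfaces. -/
theorem isTransversalAt_of_mapsTo {s : ℕ} (hs : s ≤ d) {M : Set (Fin d → ℂ)}
    {M' : Set (Fin e → ℂ)} {p : Fin d → ℂ} {U : Set (Fin d → ℂ)} {U' : Set (Fin e → ℂ)}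
    {ρ : (Fin d → ℂ) → ℝ} {ρ' : (Fin e → ℂ) → ℝ} {H : (Fin d → ℂ) → Fin e → ℂ}
    (hM : IsDefiningFunction M p U ρ) (hM' : IsDefiningFunction M' (H p) U' ρ')
    (hH : AnalyticAt ℂ H p) (hmaps : ∀ᶠ z in 𝓝 p, z ∈ M → H z ∈ M')
    (hft : IsFiniteTypeAt U ρ p) (hle : 2 * e + 2 ≤ leviRank ρ' (H p) + d + s)
    (hgen : ¬ ∀ᶠ z in 𝓝 p, z ∈ degeneracyLocus H d)
    (hcodim : GermCodimGE (degeneracyLocus H s) p 2) : IsTransversalAt H ρ' p := by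
  have hU : U ∈ 𝓝 p := hM.isOpen.mem_nhds hM.mem_nhd
  have hU' : U' ∈ 𝓝 (H p) := hM'.isOpen.mem_nhds hM'.mem_nhd
  have hρ : ContDiffAt ℝ ∞ ρ p := hM.smooth.contDiffAt hU
  have hρ' : ContDiffAt ℝ ∞ ρ' (H p) := hM'.smooth.contDiffAt hU'
  have h0 : ρ p = 0 := (hM.mem_iff p hM.mem_nhd).1 hM.mem_hypersurface
  have h0' : ρ' (H p) = 0 := (hM'.mem_iff _ hM'.mem_nhd).1 hM'.mem_hypersurface
  have hne := hM.fderiv_ne_zero p hM.mem_nhd h0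
  have hne' := hM'.fderiv_ne_zero _ hM'.mem_nhd h0'
  have hsm := contDiffAt_real_of_analyticAt hH
  have hF := isFormalHypersurface_taylor hρ h0 hne
  have hF' := isFormalHypersurface_taylor hρ' h0' hne'
  obtain ⟨F, hF0, hcomp, r, hr, hexp⟩ := exists_series_of_analyticAt hH
  have hR' := contDiffAt_ofReal hρ'
  -- Since `ρ' ∘ H` vanishes on `M`, its Taylor series is a multiple of that of `ρ`; the quotient
  -- `a` is only a formal series.
  obtain ⟨a, ha⟩ : taylor p (fun z => (ρ z : ℂ)) ∣ taylor p fun z => (ρ' (H z) : ℂ) := by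
    have hsmooth : ContDiffAt ℝ ∞ (fun z => (ρ' (H z) : ℂ)) p := hR'.comp p hsm
    refine taylor_dvd_taylor hρ h0 hne hsmooth ?_
    filter_upwards [hmaps, hU, hH.continuousAt.eventually hU'] with z h1 h2 h3 h4
    rw [(hM'.mem_iff _ h3).1 (h1 ((hM.mem_iff z h2).2 h4)), Complex.ofReal_zero]
  rw [hcomp _ hR', mul_comm] at ha
  have ha0 := constantCoeff_ne_zero_of_sendsInto hs hF hF' hF0 ha
    (fun v hv => by
      rw [formalGradient_taylor hρ] at hv
      -- A smooth field with prescribed value at `p` yields a formal field with that value, so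
      -- smooth finite type provides the spanning needed formally.
      obtain ⟨V, hV, hpV, -, X, hX, rfl⟩ := hft.ge hv
      exact ⟨_, (hX.taylor (hV.mem_nhds hpV) hρ h0 hne).2, funext fun i => constantCoeff_taylor _ _⟩)
    (by rwa [formalLeviRank_taylor hρ'])
    (exists_isMinor_formalJacobian_ne_zero hr hexp hgen)
    fun D hD _ => ⟨s, le_rfl, exists_isMinor_not_dvd hr hexp hcodim hD⟩
  obtain ⟨j, hj⟩ := exists_sum_formalGradient_mul_ne_zero hF hF0 ha ha0
  refine isTransversalAt_of_sum_ne_zero hH.differentiableAt (hρ'.differentiableAt (by simp))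
    (j := j) ?_
  simpa only [formalGradient_taylor hρ', (hexp _ _).constantCoeff_eq] using hj

end CRTransversal

theorem theorem3 (n N s : ℕ) (hs : 1 ≤ s) (hsn : s ≤ n + 1) :
    -- smooth hypersurfaces and holomorphic maps
    (∀ (M : Set (Fin (n + 1) → ℂ)) (M' : Set (Fin (N + 1) → ℂ))
        (p : Fin (n + 1) → ℂ) (p' : Fin (N + 1) → ℂ)
        (U : Set (Fin (n + 1) → ℂ)) (U' : Set (Fin (N + 1) → ℂ))
        (ρ : (Fin (n + 1) → ℂ) → ℝ) (ρ' : (Fin (N + 1) → ℂ) → ℝ)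
        (H : (Fin (n + 1) → ℂ) → Fin (N + 1) → ℂ),
      CRTransversal.IsDefiningFunction M p U ρ →
      CRTransversal.IsDefiningFunction M' p' U' ρ' →
      AnalyticAt ℂ H p →
      H p = p' →
      (∀ᶠ z in 𝓝 p, z ∈ M → H z ∈ M') →
      CRTransversal.IsFiniteTypeAt U ρ p →
      2 * (N : ℤ) - (CRTransversal.leviRank ρ' p' : ℤ) ≤ (n : ℤ) + (s : ℤ) - 3 →
      (¬ ∀ᶠ z in 𝓝 p, z ∈ CRTransversal.degeneracyLocus H (n + 1)) →
      CRTransversal.GermCodimGE (CRTransversal.degeneracyLocus H s) p 2 →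
      CRTransversal.IsTransversalAt H ρ' p) ∧
    -- formal hypersurfaces and formal maps
    (∀ (ρ : MvPowerSeries (Fin (n + 1) ⊕ Fin (n + 1)) ℂ)
        (ρ' : MvPowerSeries (Fin (N + 1) ⊕ Fin (N + 1)) ℂ)
        (H : Fin (N + 1) → MvPowerSeries (Fin (n + 1)) ℂ),
      CRTransversal.IsFormalHypersurface ρ →
      CRTransversal.IsFormalHypersurface ρ' →
      (∀ i, MvPowerSeries.constantCoeff (H i) = 0) →
      CRTransversal.SendsInto H ρ ρ' →
      CRTransversal.IsFormalFiniteType ρ →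
      2 * (N : ℤ) - (CRTransversal.formalLeviRank ρ' : ℤ) ≤ (n : ℤ) + (s : ℤ) - 3 →
      (∃ δ, CRTransversal.IsMinor (CRTransversal.formalJacobian H) (n + 1) δ ∧ δ ≠ 0) →
      (∀ D : MvPowerSeries (Fin (n + 1)) ℂ,
        (∀ δ, CRTransversal.IsMinor (CRTransversal.formalJacobian H) (n + 1) δ → δ ≠ 0 → D ∣ δ) →
        ∃ k, s ≤ k ∧ ∃ δ', CRTransversal.IsMinor (CRTransversal.formalJacobian H) k δ' ∧
          IsRelPrime δ' D) →
      CRTransversal.IsFormalTransversal H ρ') := by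
  refine ⟨?_, ?_⟩
  · rintro M M' p p' U U' ρ ρ' H hM hM' hH rfl hmaps hft hle hgen hcodim
    exact CRTransversal.isTransversalAt_of_mapsTo hsn hM hM' hH hmaps hft (by omega) hgen hcodim
  · exact fun ρ ρ' H => CRTransversal.isFormalTransversal_of_sendsInto hsn ρ ρ' H
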